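/- Let $C$ be a smooth closed connected oriented surface, let $m$ and $n_1,\dots,n_m$ be positive integers, let $A$ be a real number and let $A_1,\dots,A_m\ge 0$ be real numbers with $A>\sum_{i=1}^m A_i/n_i$. Let $x_1,\dots,x_m\in C$ be distinct points. Let $p:E\to C$ be a smooth oriented Euclidean real vector bundle of rank two with degree (Euler number) $-m$, i.e. it has a smooth section transverse to the zero section whose zeros, counted with signs, add up to $-m$. Let $D=\{v\in E:\|v\|\le 1\}$ be its disk bundle. Identify $C$ with the zero section, let $\mathcal F$ be the union of the fibers $p^{-1}(x_i)$ over those $x_i$ with $A_i>0$, and put $K=C\cup\mathcal F$. Then there are an open neighborhood $\Omega$ of $D$ in $E$, a symplectic form $\omega$ on $\Omega$ and a smooth vector field $V$ on $\Omega\setminus K$ with the following properties. 1. The zero section $C$ is a symplectic submanifold on which $\omega$ is positive for the orientation of $C$, with area $\pi\left(A-\sum_{i=1}^m A_i/n_i\right)$. The fibers of $p:D\to C$ are symplectic, with $\omega$ positive for their orientation. 2. $V$ is a Liouville field on $\Omega\setminus K$, i.e. $d(\iota_V\omega)=\omega$. 3. There are a number $\delta>0$, pairwise disjoint open neighborhoods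 $W_i$ of the points $x_i$ ($i=1,\dots,m$), smooth coordinate charts $\psi_i$ from $W_i$ onto the open disk of radius $\sqrt\delta$ about $0$ in $\mathbb R^2$ with $\psi_i(x_i)=0$, and smooth maps $\chi_i:E|_{W_i}\to\mathbb R^2$ that are linear on each fiber and satisfy $\|\chi_i(v)\|=\sqrt\delta\,\|v\|$, such that the following holds on $D|_{W_i}$. In the polar coordinates $(r_1,\theta_1)$ given by $\psi_i\circ p$ and $(r_2,\theta_2)$ given by $\chi_i$, $$\omega=r_1\,dr_1\wedge d\theta_1+r_2\,dr_2\wedge d\theta_2,$$ and off $K$ $$V=\tfrac12\Big(r_1+\frac{A_i}{n_i r_1}\Big)\partial_{r_1}+\tfrac12\Big(r_2+\frac{A}{m r_2}\Big)\partial_{r_2}.$$ If $A_i=0$, the first term is the smooth field $\tfrac12 r_1\partial_{r_1}$, which vanishes at $r_1=0$. 4. Every neighborhood $O$ of $K\cap D$ contains a convex neighborhood of $K\cap D$ in $D$, namely a compact set $N\subseteq O\cap D$ that is a neighborhood of $K\cap D$ relative to $D$ and whose boundary relative to $D$ is a smooth hypersurface, transverse to $\partial D$ where it meets $\partial D$,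 along which $V$ is transverse and points out of $N$. At the points of $N\cap\partial D$ outside $K$, $V$ also points out of $D$. -/

import Mathlib

open Set Bundle MeasureTheory
open scoped Manifold ContDiff Topology

noncomputable section

namespace ConvexDisk

/-- The Euclidean plane. -/
abbrev Plane : Type := EuclideanSpace ℝ (Fin 2)

/-! ### Differential forms on (boundaryless) manifolds -/

section Forms

variable {E : Type*} [NormedAddCommGroup E] [NormedSpace ℝ E]
  {H : Type*} [TopologicalSpace H] (I : ModelWithCorners ℝ E H)
  {M : Type*} [TopologicalSpace M] [ChartedSpace H M]
  {E' : Type*} [NormedAddCommGroup E'] [NormedSpace ℝ E']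
  {H' : Type*} [TopologicalSpace H'] (I' : ModelWithCorners ℝ E' H')
  {M' : Type*} [TopologicalSpace M'] [ChartedSpace H' M']

/-- A (not necessarily smooth) field of alternating `k`-forms on the manifold `M`. -/
abbrev FormField (M : Type*) [TopologicalSpace M] [ChartedSpace H M] (k : ℕ) : Type _ :=
  ∀ x : M, (TangentSpace I x) [⋀^Fin k]→L[ℝ] ℝ

variable {I I'}

/-- The pullback `g^* τ`. -/
def pullbackForm {k : ℕ} (g : M → M') (τ : FormField I' M' k) : FormField I M k :=
  fun x => (τ (g x)).compContinuousLinearMap (mfderiv I I' g x)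

/-- The expression of a form in the chart around `x₀`. -/
def chartForm {k : ℕ} (τ : FormField I M k) (x₀ : M) : E → E [⋀^Fin k]→L[ℝ] ℝ :=
  pullbackForm (I := 𝓘(ℝ, E)) (extChartAt I x₀).symm τ

/-- The part of the image of the chart around `x₀` that corresponds to points of `S`. -/
def chartDomain (I : ModelWithCorners ℝ E H) (x₀ : M) (S : Set M) : Set E :=
  (extChartAt I x₀).target ∩ (extChartAt I x₀).symm ⁻¹' S

/-- `τ` is smooth on the open set `S`: it is smooth in every chart. -/
def SmoothFormOn {k : ℕ} (τ : FormField I M k) (S : Set M) : Prop :=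
  ∀ x₀ : M, ContDiffOn ℝ ∞ (chartForm τ x₀) (chartDomain I x₀ S)

/-- `dη = τ` on the open set `S`, checked in every chart. -/
def ExtDerivEqOn {k : ℕ} (η : FormField I M k) (τ : FormField I M (k + 1)) (S : Set M) : Prop :=
  ∀ x₀ : M, ∀ y ∈ chartDomain I x₀ S, extDeriv (chartForm η x₀) y = chartForm τ x₀ y

/-- `τ` is a symplectic form on the open set `S`: smooth, closed and nondegenerate. -/
structure IsSymplecticOn (τ : FormField I M 2) (S : Set M) : Prop where
  smooth : SmoothFormOn τ S
  closed : ExtDerivEqOn τ (fun _ => 0) S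
  nondegenerate : ∀ x ∈ S, ∀ u : TangentSpace I x,
    (∀ w : TangentSpace I x, τ x ![u, w] = 0) → u = 0

/-- The contraction `ι_V τ`, i.e. the `1`-form `w ↦ τ (V, w)`. -/
def contract (V : ∀ x : M, TangentSpace I x) (τ : FormField I M 2) : FormField I M 1 :=
  fun x => ContinuousAlternatingMap.curryLeft (𝕜 := ℝ) (E := E) (F := ℝ) (τ x) (V x)

/-- `V` is a (smooth) Liouville field for the symplectic form `τ` on the open set `S`:
`d (ι_V τ) = τ`, which for closed `τ` says that the Lie derivative `L_V τ` is `τ`. -/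
structure IsLiouvilleOn [IsManifold I 1 M] (τ : FormField I M 2) (V : ∀ x : M, TangentSpace I x) (S : Set M) :
    Prop where
  smooth : ContMDiffOn I I.tangent ∞ (fun x => (⟨x, V x⟩ : TangentBundle I M)) S
  liouville : ExtDerivEqOn (contract V τ) τ S

/-- The derivative of a real function `f` at `x` in the direction of the tangent vector `u`. -/
def dirDeriv (I : ModelWithCorners ℝ E H) (f : M → ℝ) (x : M) (u : TangentSpace I x) : ℝ :=
  mfderiv I 𝓘(ℝ, ℝ) f x u

/-- The differential at `x` of a map to the plane. -/
def planeDeriv (I : ModelWithCorners ℝ E H) (f : M → Plane) (x : M) (u : TangentSpace I x) :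
    Plane :=
  mfderiv I 𝓘(ℝ, Plane) f x u

end Forms

/-! ### Orientations of rank-two bundles, the degree -/

section Orient

/-- `(u, w)` is a positively oriented basis of the oriented two-dimensional space `(X, o)`. -/
def PosPair {X : Type*} [AddCommGroup X] [Module ℝ X] (o : Orientation ℝ X (Fin 2)) (u w : X) :
    Prop :=
  ∃ b : Module.Basis (Fin 2) ℝ X, b 0 = u ∧ b 1 = w ∧ b.orientation = o

variable {B : Type*} [TopologicalSpace B] (E : B → Type*) [TopologicalSpace (TotalSpace Plane E)]
  [∀ x, AddCommGroup (E x)] [∀ x, Module ℝ (E x)] [∀ x, TopologicalSpace (E x)]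
  [FiberBundle Plane E]

/-- An orientation of a rank-two real vector bundle: an orientation of each fiber which is
continuous, i.e. a local frame (constant in a local trivialization) that is positive at a point
is positive at all nearby points. -/
structure BundleOrientation where
  or : ∀ x, Orientation ℝ (E x) (Fin 2)
  continuous : ∀ (x₀ : B) (a b : Plane),
    PosPair (or x₀) ((trivializationAt Plane E x₀).symm x₀ a)
      ((trivializationAt Plane E x₀).symm x₀ b) →
    ∀ᶠ x in 𝓝 x₀, PosPair (or x) ((trivializationAt Plane E x₀).symm x a)
      ((trivializationAt Plane E x₀).symm x b)

end Orient

/-- The model with corners of the total space of a rank-two bundle over a surface. -/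
abbrev totalModel : ModelWithCorners ℝ (Plane × Plane) (ModelProd Plane Plane) :=
  (𝓡 2).prod 𝓘(ℝ, Plane)

/-- An orientation of a smooth surface. -/
abbrev SurfaceOrientation (C : Type*) [TopologicalSpace C] [ChartedSpace Plane C]
    [IsManifold (𝓡 2) ∞ C] : Type _ :=
  BundleOrientation (TangentSpace (𝓡 2) : C → Type)

section Degree

variable {C : Type*} [TopologicalSpace C] [ChartedSpace Plane C] [IsManifold (𝓡 2) ∞ C]
  {E : C → Type*} [TopologicalSpace (TotalSpace Plane E)]
  [∀ x, AddCommGroup (E x)] [∀ x, Module ℝ (E x)] [∀ x, TopologicalSpace (E x)]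
  [FiberBundle Plane E]

/-- The vertical derivative `T_x C → E_x` of a section `s` at a zero `x` of `s` (at a zero it
does not depend on the trivialization used). -/
def vertDeriv (s : ∀ x, E x) (x : C) (u : TangentSpace (𝓡 2) x) : E x :=
  (trivializationAt Plane E x).symm x
    (planeDeriv (𝓡 2) (fun y => (trivializationAt Plane E x ⟨y, s y⟩).2) x u)

/-- The oriented rank-two bundle `E` over the closed oriented surface `C` has degree (Euler
number) `d`: it has a smooth section, transverse to the zero section, whose zeros counted with
signs add up to `d`.  `P` is the set of positive zeros and `N` the set of negative zeros. -/
def HasDegree (oC : SurfaceOrientation C) (oE : BundleOrientation E) (d : ℤ) : Prop :=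
  ∃ (s : ∀ x, E x) (P N : Finset C),
    ContMDiff (𝓡 2) totalModel ∞ (fun x => TotalSpace.mk' Plane x (s x)) ∧
    (∀ x, s x = 0 ↔ x ∈ P ∨ x ∈ N) ∧
    (∀ x ∈ P, ∀ u w, PosPair (oC.or x) u w →
      PosPair (oE.or x) (vertDeriv s x u) (vertDeriv s x w)) ∧
    (∀ x ∈ N, ∀ u w, PosPair (oC.or x) u w →
      PosPair (oE.or x) (vertDeriv s x w) (vertDeriv s x u)) ∧
    (P.card : ℤ) - (N.card : ℤ) = d

end Degree

/-! ### Area of a surface -/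

/-- `ν` is the measure of the area form `σ`: in each chart it has density `|σ (∂₁, ∂₂)|`.
There is exactly one such measure on a closed surface (for continuous `σ`); its total mass is
the integral of `σ` over the surface when `σ` is positive for the orientation. -/
def IsAreaMeasure {C : Type*} [TopologicalSpace C] [ChartedSpace Plane C] [MeasurableSpace C]
    (σ : FormField (𝓡 2) C 2) (ν : Measure C) : Prop :=
  ∀ (x₀ : C) (S : Set C), S ⊆ (extChartAt (𝓡 2) x₀).source → MeasurableSet S →
    ν S = ∫⁻ y in extChartAt (𝓡 2) x₀ '' S,
      ENNReal.ofReal |chartForm σ x₀ y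
        ![EuclideanSpace.single (0 : Fin 2) (1 : ℝ), EuclideanSpace.single (1 : Fin 2) (1 : ℝ)]|

/-! ### Plane coordinates -/

/-- The standard area form `dx ∧ dy = r dr ∧ dθ` of the plane. -/
def stdArea (a b : Plane) : ℝ := a 0 * b 1 - a 1 * b 0

/-- The unit radial vector field `∂_r` of the plane (away from the origin). -/
def radialUnit (q : Plane) : Plane := ‖q‖⁻¹ • q

/-- The radial vector field `(1/2) (r + c / r) ∂_r` of the plane, which for `c = 0` is the smooth
field `(1/2) r ∂_r`, vanishing at the origin. -/
def radialField (c : ℝ) (q : Plane) : Plane := ((1 / 2) * (‖q‖ + c / ‖q‖)) • radialUnit q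

/-! ### Disk bundles -/

section Disk

variable {C : Type*} [TopologicalSpace C] [ChartedSpace Plane C]
  (E : C → Type*) [TopologicalSpace (TotalSpace Plane E)]
  [∀ x, NormedAddCommGroup (E x)] [∀ x, InnerProductSpace ℝ (E x)]
  [FiberBundle Plane E]

/-- The (closed, unit) disk bundle of a Euclidean bundle. -/
def diskBundle : Set (TotalSpace Plane E) := {v | ‖v.2‖ ≤ 1}

/-- The zero section, as a subset of the total space. -/
def zeroSec : Set (TotalSpace Plane E) := {v | v.2 = 0}

variable {E}

/-- The squared fiber norm, whose level set at height `1` is the boundary of the disk bundle. -/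
def sqNorm (v : TotalSpace Plane E) : ℝ := ‖v.2‖ ^ 2

/-- The inclusion of the fiber over `x` into the total space. -/
def fiberIncl (x : C) (w : E x) : TotalSpace Plane E := TotalSpace.mk' Plane x w

/-- The vertical tangent vector at `v` given by the vector `w` of the fiber through `v`. -/
def vertical [VectorBundle ℝ Plane E] (v : TotalSpace Plane E) (w : E v.1) :
    TangentSpace totalModel v :=
  mfderiv 𝓘(ℝ, E v.1) totalModel (fiberIncl (E := E) v.1) v.2 w

/-- `N` is a compact neighborhood of `K` in the disk bundle `D`, with smooth boundary, along
which the vector field `V` (defined off `K`) is transverse and points outward.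

The boundary of `N` relative to `D` is a smooth hypersurface, transverse to `∂D` where it meets
`∂D`: near each of its points `N` is a sublevel set `{f ≤ 0}` and `df (V) > 0`.  If `N` reaches
`∂D`, then `V` also points outward along `N ∩ ∂D`, away from `K`. -/
structure IsConvexNbhd (V : ∀ v : TotalSpace Plane E, TangentSpace totalModel v)
    (K N : Set (TotalSpace Plane E)) : Prop where
  subset : N ⊆ diskBundle E
  isCompact : IsCompact N
  isClosed : IsClosed N
  nbhd : ∀ y ∈ K, y ∈ diskBundle E → N ∈ 𝓝[diskBundle E] y
  boundary : ∀ y ∈ N ∩ closure (diskBundle E \ N),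
    ∃ (G : Set (TotalSpace Plane E)) (f : TotalSpace Plane E → ℝ),
      IsOpen G ∧ y ∈ G ∧ ContMDiffOn totalModel 𝓘(ℝ, ℝ) ∞ f G ∧
      (∀ z ∈ G ∩ diskBundle E, z ∈ N ↔ f z ≤ 0) ∧
      0 < dirDeriv totalModel f y (V y) ∧
      (sqNorm y = 1 → ∃ u : TangentSpace totalModel y,
        dirDeriv totalModel sqNorm y u = 0 ∧ dirDeriv totalModel f y u ≠ 0)
  outer : ∀ y ∈ N, y ∉ K → sqNorm y = 1 → 0 < dirDeriv totalModel sqNorm y (V y)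

end Disk

end ConvexDisk

end

open ConvexDisk

open Set Bundle MeasureTheory
open scoped Manifold ContDiff Topology
open ConvexDisk

set_option linter.unusedSectionVars false

noncomputable section

namespace ConvexDisk

section Wedge

variable {X : Type*} [AddCommGroup X] [Module ℝ X] [TopologicalSpace X]
  {E : Type*} [NormedAddCommGroup E] [NormedSpace ℝ E]

/-- The wedge product of two linear forms. -/
def wedge (a b : X →L[ℝ] ℝ) : X [⋀^Fin 2]→L[ℝ] ℝ where
  toFun v := a (v 0) * b (v 1) - a (v 1) * b (v 0)
  map_update_add' v i x y := by
    fin_cases i <;> simp <;> ring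
  map_update_smul' v i c x := by
    fin_cases i <;> simp <;> ring
  cont := by fun_prop
  map_eq_zero_of_eq' v i j h hij := by
    fin_cases i <;> fin_cases j <;> simp_all

lemma wedge_apply (a b : X →L[ℝ] ℝ) (v : Fin 2 → X) :
    wedge a b v = a (v 0) * b (v 1) - a (v 1) * b (v 0) := rfl

lemma alt_two_ext {F G : X [⋀^Fin 2]→L[ℝ] ℝ} (h : ∀ u w, F ![u, w] = G ![u, w]) : F = G := by
  ext v
  have : v = ![v 0, v 1] := by ext i; fin_cases i <;> rfl
  rw [this, h]

lemma alt_one_ext {F G : X [⋀^Fin 1]→L[ℝ] ℝ} (h : ∀ u, F ![u] = G ![u]) : F = G := by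
  ext v
  have : v = ![v 0] := by ext i; fin_cases i; rfl
  rw [this, h]

lemma compContinuousLinearMap_two {Y : Type*} [AddCommGroup Y] [Module ℝ Y] [TopologicalSpace Y]
    (F : Y [⋀^Fin 2]→L[ℝ] ℝ) (T : X →L[ℝ] Y) (u w : X) :
    F.compContinuousLinearMap T ![u, w] = F ![T u, T w] := by
  rw [ContinuousAlternatingMap.compContinuousLinearMap_apply]
  congr 1
  ext i; fin_cases i <;> rfl

lemma sum_smul_clm_apply [IsTopologicalAddGroup X] [ContinuousSMul ℝ X] {ι : Type} [Fintype ι]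
    (c : ι → ℝ) (b : ι → X →L[ℝ] ℝ) (v : X) :
    (∑ i, c i • b i) v = ∑ i, c i * b i v := by
  simp [sum_apply]

lemma sum_smul_ofSubsingletonLIE_apply {ι : Type} [Fintype ι] (c : ι → ℝ) (b : ι → E →L[ℝ] ℝ)
    (v : Fin 1 → E) :
    (∑ i, c i • ContinuousAlternatingMap.ofSubsingletonLIE (𝕜 := ℝ) (0 : Fin 1) (b i)) v =
      ∑ i, c i * b i (v 0) := by
  simp [ContinuousAlternatingMap.sum_apply]

/-- The wedge product as a continuous bilinear map. -/
def wedgeL : (E →L[ℝ] ℝ) →L[ℝ] (E →L[ℝ] ℝ) →L[ℝ] (E [⋀^Fin 2]→L[ℝ] ℝ) :=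
  LinearMap.mkContinuous₂
    (LinearMap.mk₂ ℝ wedge
      (fun a b c => alt_two_ext fun u w => by simp [wedge_apply]; ring)
      (fun a b c => alt_two_ext fun u w => by simp [wedge_apply]; ring)
      (fun a b c => alt_two_ext fun u w => by simp [wedge_apply]; ring)
      (fun a b c => alt_two_ext fun u w => by simp [wedge_apply]; ring)) 2
    (fun a b => by
      refine ContinuousAlternatingMap.opNorm_le_bound _ (by positivity) fun v => ?_
      rw [LinearMap.mk₂_apply, wedge_apply, Fin.prod_univ_two]
      have h1 := a.le_opNorm (v 0)
      have h2 := b.le_opNorm (v 1)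
      have h3 := a.le_opNorm (v 1)
      have h4 := b.le_opNorm (v 0)
      calc ‖a (v 0) * b (v 1) - a (v 1) * b (v 0)‖
          ≤ ‖a (v 0)‖ * ‖b (v 1)‖ + ‖a (v 1)‖ * ‖b (v 0)‖ := by
            refine (norm_sub_le _ _).trans ?_; rw [norm_mul, norm_mul]
        _ ≤ (‖a‖ * ‖v 0‖) * (‖b‖ * ‖v 1‖) + (‖a‖ * ‖v 1‖) * (‖b‖ * ‖v 0‖) := by gcongr
        _ = _ := by ring)

end Wedge

section OneForms

variable {E : Type*} [NormedAddCommGroup E] [NormedSpace ℝ E]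
  {H : Type*} [TopologicalSpace H] (I : ModelWithCorners ℝ E H)
  (M : Type*) [TopologicalSpace M] [ChartedSpace H M]

/-- A field of linear forms on the manifold `M`. -/
abbrev OneForm : Type _ := ∀ x : M, TangentSpace I x →L[ℝ] ℝ

variable {M}

/-- The differential of a real function. -/
def dR (f : M → ℝ) : OneForm I M := fun x => mfderiv I 𝓘(ℝ, ℝ) f x

variable {E' : Type*} [NormedAddCommGroup E'] [NormedSpace ℝ E']
  {H' : Type*} [TopologicalSpace H'] (I' : ModelWithCorners ℝ E' H')
  {M' : Type*} [TopologicalSpace M'] [ChartedSpace H' M']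

/-- `f` is smooth in a neighborhood of `x`. -/
def SmoothNear (f : M → M') (x : M) : Prop := ∀ᶠ y in 𝓝 x, ContMDiffAt I I' ∞ f y

variable {I I'}

/-- The `1`-form `η` is smooth near `x`: it is locally a finite sum of terms `f dg`. -/
def RepAt (η : OneForm I M) (x : M) : Prop :=
  ∃ (ι : Type) (_ : Fintype ι) (f g : ι → M → ℝ),
    (∀ i, SmoothNear I 𝓘(ℝ, ℝ) (f i) x) ∧ (∀ i, SmoothNear I 𝓘(ℝ, ℝ) (g i) x) ∧
    ∀ᶠ y in 𝓝 x, η y = ∑ i, f i y • dR I (g i) y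

/-- A field of linear forms as a `1`-form. -/
def toForm (η : OneForm I M) : FormField I M 1 :=
  fun x => ContinuousAlternatingMap.ofSubsingleton ℝ (TangentSpace I x) ℝ (0 : Fin 1) (η x)

/-- The exterior derivative of a `1`-form, computed in the chart at each point. -/
def extd (η : OneForm I M) : FormField I M 2 := fun x =>
  (extDeriv (chartForm (toForm η) x) (extChartAt I x x)).compContinuousLinearMap
    (mfderiv I 𝓘(ℝ, E) (extChartAt I x) x)

/-- The pullback of a field of linear forms. -/
def pull (g : M → M') (η : OneForm I' M') : OneForm I M :=
  fun x => (η (g x)).comp (mfderiv I I' g x)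

lemma SmoothNear.self {f : M → M'} {x : M} (h : SmoothNear I I' f x) : ContMDiffAt I I' ∞ f x :=
  Filter.Eventually.self_of_nhds h

lemma SmoothNear.eventually {f : M → M'} {x : M} (h : SmoothNear I I' f x) :
    ∀ᶠ y in 𝓝 x, SmoothNear I I' f y := eventually_eventually_nhds.2 h

lemma SmoothNear.mdiff {f : M → M'} {x : M} (h : SmoothNear I I' f x) :
    MDifferentiableAt I I' f x := h.self.mdifferentiableAt (by simp)

lemma SmoothNear.continuousAt {f : M → M'} {x : M} (h : SmoothNear I I' f x) :
    ContinuousAt f x := h.self.continuousAt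

lemma ContMDiff.smoothNear {f : M → M'} (h : ContMDiff I I' ∞ f) (x : M) : SmoothNear I I' f x :=
  Filter.Eventually.of_forall fun y => h y

lemma ContMDiffOn.smoothNear {f : M → M'} {S : Set M} (h : ContMDiffOn I I' ∞ f S)
    (hS : IsOpen S) {x : M} (hx : x ∈ S) : SmoothNear I I' f x := by
  filter_upwards [hS.mem_nhds hx] with y hy using h.contMDiffAt (hS.mem_nhds hy)

lemma SmoothNear.congr {f g : M → M'} {x : M} (h : SmoothNear I I' f x) (e : g =ᶠ[𝓝 x] f) :
    SmoothNear I I' g x := by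
  filter_upwards [h, e.eventuallyEq_nhds] with y hy h2 using hy.congr_of_eventuallyEq h2

lemma SmoothNear.comp {E'' : Type*} [NormedAddCommGroup E''] [NormedSpace ℝ E'']
    {H'' : Type*} [TopologicalSpace H''] {I'' : ModelWithCorners ℝ E'' H''}
    {M'' : Type*} [TopologicalSpace M''] [ChartedSpace H'' M'']
    {g : M' → M''} {f : M → M'} {x : M} (hg : SmoothNear I' I'' g (f x))
    (hf : SmoothNear I I' f x) : SmoothNear I I'' (fun y => g (f y)) x := by
  filter_upwards [hf, hf.continuousAt.eventually hg] with y h1 h2 using ContMDiffAt.comp y h2 h1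

lemma smoothNear_const (c : M') (x : M) : SmoothNear I I' (fun _ : M => c) x :=
  Filter.Eventually.of_forall fun _ => contMDiffAt_const

section Vector
variable {V : Type*} [NormedAddCommGroup V] [NormedSpace ℝ V] {f g : M → V} {x : M}

lemma SmoothNear.add (hf : SmoothNear I 𝓘(ℝ, V) f x) (hg : SmoothNear I 𝓘(ℝ, V) g x) :
    SmoothNear I 𝓘(ℝ, V) (fun y => f y + g y) x := by
  filter_upwards [hf, hg] with y h1 h2 using h1.add h2

lemma SmoothNear.sub (hf : SmoothNear I 𝓘(ℝ, V) f x) (hg : SmoothNear I 𝓘(ℝ, V) g x) :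
    SmoothNear I 𝓘(ℝ, V) (fun y => f y - g y) x := by
  filter_upwards [hf, hg] with y h1 h2 using h1.sub h2

lemma SmoothNear.smul {h : M → ℝ} (hh : SmoothNear I 𝓘(ℝ, ℝ) h x)
    (hf : SmoothNear I 𝓘(ℝ, V) f x) : SmoothNear I 𝓘(ℝ, V) (fun y => h y • f y) x := by
  filter_upwards [hf, hh] with y h1 h2 using h2.smul h1

lemma SmoothNear.comp_contDiffAt {W : Type*} [NormedAddCommGroup W] [NormedSpace ℝ W]
    {φ : V → W} (hf : SmoothNear I 𝓘(ℝ, V) f x) (hφ : ∀ᶠ z in 𝓝 (f x), ContDiffAt ℝ ∞ φ z) :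
    SmoothNear I 𝓘(ℝ, W) (fun y => φ (f y)) x :=
  SmoothNear.comp (I' := 𝓘(ℝ, V)) (hφ.mono fun _ h => h.contMDiffAt) hf

lemma SmoothNear.comp_contDiff {W : Type*} [NormedAddCommGroup W] [NormedSpace ℝ W]
    {φ : V → W} (hf : SmoothNear I 𝓘(ℝ, V) f x) (hφ : ContDiff ℝ ∞ φ) :
    SmoothNear I 𝓘(ℝ, W) (fun y => φ (f y)) x :=
  hf.comp_contDiffAt (.of_forall fun _ => hφ.contDiffAt)

end Vector

lemma SmoothNear.mul {f g : M → ℝ} {x : M} (hf : SmoothNear I 𝓘(ℝ, ℝ) f x)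
    (hg : SmoothNear I 𝓘(ℝ, ℝ) g x) : SmoothNear I 𝓘(ℝ, ℝ) (fun y => f y * g y) x := by
  filter_upwards [hf, hg] with y h1 h2 using h1.mul h2

lemma SmoothNear.inv {f : M → ℝ} {x : M} (hf : SmoothNear I 𝓘(ℝ, ℝ) f x) (h0 : f x ≠ 0) :
    SmoothNear I 𝓘(ℝ, ℝ) (fun y => (f y)⁻¹) x :=
  hf.comp_contDiffAt (φ := fun t : ℝ => t⁻¹)
    ((eventually_ne_nhds h0).mono fun _ h => contDiffAt_inv ℝ h)

section Derivation

variable {f g : M → ℝ} {x : M}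

lemma dR_add (hf : MDifferentiableAt I 𝓘(ℝ, ℝ) f x) (hg : MDifferentiableAt I 𝓘(ℝ, ℝ) g x) :
    dR I (fun y => f y + g y) x = dR I f x + dR I g x := mfderiv_add hf hg

lemma dR_sub (hf : MDifferentiableAt I 𝓘(ℝ, ℝ) f x) (hg : MDifferentiableAt I 𝓘(ℝ, ℝ) g x) :
    dR I (fun y => f y - g y) x = dR I f x - dR I g x := mfderiv_sub hf hg

lemma dR_mul (hf : MDifferentiableAt I 𝓘(ℝ, ℝ) f x) (hg : MDifferentiableAt I 𝓘(ℝ, ℝ) g x) :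
    dR I (fun y => f y * g y) x = f x • dR I g x + g x • dR I f x :=
  (HasMFDerivAt.mul hf.hasMFDerivAt hg.hasMFDerivAt).mfderiv

lemma dR_const (c : ℝ) : dR I (fun _ : M => c) x = 0 := mfderiv_const

lemma dR_congr (h : f =ᶠ[𝓝 x] g) : dR I f x = dR I g x := h.mfderiv_eq

lemma dR_comp {φ : ℝ → ℝ} {φ' : ℝ} (hφ : HasDerivAt φ φ' (f x))
    (hf : MDifferentiableAt I 𝓘(ℝ, ℝ) f x) :
    dR I (fun y => φ (f y)) x = φ' • dR I f x := by
  have := (HasMFDerivAt.comp x (hφ.hasFDerivAt.hasMFDerivAt) hf.hasMFDerivAt).mfderiv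
  refine (this : dR I (fun y => φ (f y)) x = _).trans ?_
  ext u
  have e : ∀ t : ℝ, (ContinuousLinearMap.toSpanSingleton ℝ φ') t = φ' * t := fun t => by
    simp [mul_comm]
  exact e _

lemma dR_pull {k : M' → ℝ} {h : M → M'} (hk : MDifferentiableAt I' 𝓘(ℝ, ℝ) k (h x))
    (hh : MDifferentiableAt I I' h x) :
    dR I (fun y => k (h y)) x = (dR I' k (h x)).comp (mfderiv I I' h x) :=
  mfderiv_comp x hk hh

end Derivation

section Chart

variable [IsManifold I ∞ M] [I.Boundaryless]

lemma contMDiffAt_extChartAt_symm_of_mem (x₀ : M) {y : E} (hy : y ∈ (extChartAt I x₀).target) :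
    ContMDiffAt 𝓘(ℝ, E) I ∞ (extChartAt I x₀).symm y :=
  (contMDiffOn_extChartAt_symm x₀).contMDiffAt ((isOpen_extChartAt_target x₀).mem_nhds hy)

lemma smoothNear_extChartAt_symm (x₀ : M) {y : E} (hy : y ∈ (extChartAt I x₀).target) :
    SmoothNear 𝓘(ℝ, E) I (extChartAt I x₀).symm y :=
  (contMDiffOn_extChartAt_symm x₀).smoothNear (isOpen_extChartAt_target x₀) hy

lemma smoothNear_extChartAt {x₀ x : M} (hx : x ∈ (chartAt H x₀).source) :
    SmoothNear I 𝓘(ℝ, E) (extChartAt I x₀) x :=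
  contMDiffOn_extChartAt.smoothNear (chartAt H x₀).open_source hx

lemma SmoothNear.contDiff_chart {f : M → ℝ} (x₀ : M) {y : E} (hy : y ∈ (extChartAt I x₀).target)
    (hf : SmoothNear I 𝓘(ℝ, ℝ) f ((extChartAt I x₀).symm y)) :
    ∀ᶠ z in 𝓝 y, ContDiffAt ℝ ∞ (fun z => f ((extChartAt I x₀).symm z)) z :=
  (SmoothNear.comp hf (smoothNear_extChartAt_symm x₀ hy)).mono fun _ h =>
    contMDiffAt_iff_contDiffAt.1 h

/-- The chart expression of `∑ f dg`. -/
lemma chartForm_sum_smul_dR {ι : Type} [Fintype ι] {f g : ι → M → ℝ} {η : OneForm I M}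
    (x₀ : M) {y : E} (hy : y ∈ (extChartAt I x₀).target)
    (hg : ∀ i, SmoothNear I 𝓘(ℝ, ℝ) (g i) ((extChartAt I x₀).symm y))
    (h : ∀ᶠ z in 𝓝 ((extChartAt I x₀).symm y), η z = ∑ i, f i z • dR I (g i) z) :
    chartForm (toForm η) x₀ =ᶠ[𝓝 y] fun z => ∑ i, f i ((extChartAt I x₀).symm z) •
      ContinuousAlternatingMap.ofSubsingletonLIE (𝕜 := ℝ) (0 : Fin 1)
        (fderiv ℝ (fun z => g i ((extChartAt I x₀).symm z)) z) := by
  have hc := smoothNear_extChartAt_symm (I := I) x₀ hy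
  have hg' : ∀ᶠ z in 𝓝 y, ∀ i, SmoothNear I 𝓘(ℝ, ℝ) (g i) ((extChartAt I x₀).symm z) :=
    Filter.eventually_all.2 fun i => hc.continuousAt.eventually (hg i).eventually
  filter_upwards [hc.continuousAt.eventually h, hc, hg'] with z h1 h2 h3
  refine alt_one_ext fun u => ?_
  have e : chartForm (toForm η) x₀ z ![u] =
      η ((extChartAt I x₀).symm z) (mfderiv 𝓘(ℝ, E) I (extChartAt I x₀).symm z u) := rfl
  have e2 : ∀ i, fderiv ℝ (fun z => g i ((extChartAt I x₀).symm z)) z u =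
      dR I (g i) ((extChartAt I x₀).symm z)
        (mfderiv 𝓘(ℝ, E) I (extChartAt I x₀).symm z u) := fun i => by
    rw [← mfderiv_eq_fderiv]
    exact DFunLike.congr_fun
      (dR_pull (I := 𝓘(ℝ, E)) (h3 i).mdiff (h2.mdifferentiableAt (by simp))) u
  rw [e, h1, sum_smul_ofSubsingletonLIE_apply]
  refine (sum_smul_clm_apply _ _ _).trans (Finset.sum_congr rfl fun i _ => ?_)
  exact congrArg _ (e2 i).symm

lemma extDeriv_sum_smul {ι : Type} [Fintype ι] {F G : ι → E → ℝ} {y : E}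
    (hF : ∀ i, ContDiffAt ℝ ∞ (F i) y) (hG : ∀ i, ContDiffAt ℝ ∞ (G i) y) :
    extDeriv (fun z => ∑ i, F i z •
      ContinuousAlternatingMap.ofSubsingletonLIE (𝕜 := ℝ) (0 : Fin 1) (fderiv ℝ (G i) z)) y =
    ∑ i, wedge (fderiv ℝ (F i) y) (fderiv ℝ (G i) y) := by
  let T : (E →L[ℝ] ℝ) →L[ℝ] (E [⋀^Fin 1]→L[ℝ] ℝ) :=
    (ContinuousAlternatingMap.ofSubsingletonLIE (𝕜 := ℝ) (E := E) (F := ℝ)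
      (0 : Fin 1)).toContinuousLinearEquiv.toContinuousLinearMap
  have hG2 : ∀ i, HasFDerivAt (fun z => T (fderiv ℝ (G i) z))
      (T.comp (fderiv ℝ (fderiv ℝ (G i)) y)) y := fun i => by
    refine T.hasFDerivAt.comp y (DifferentiableAt.hasFDerivAt ?_)
    exact ((hG i).fderiv_right (m := ∞) (by simp)).differentiableAt (by simp)
  have hS : HasFDerivAt (fun z => ∑ i, F i z • T (fderiv ℝ (G i) z))
      (∑ i, (F i y • T.comp (fderiv ℝ (fderiv ℝ (G i)) y) +
        (fderiv ℝ (F i) y).smulRight (T (fderiv ℝ (G i) y)))) y := by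
    refine HasFDerivAt.fun_sum fun i _ => ?_
    exact (((hF i).differentiableAt (by simp)).hasFDerivAt).smul (hG2 i)
  have hS' : fderiv ℝ (fun z => ∑ i, F i z •
      ContinuousAlternatingMap.ofSubsingletonLIE (𝕜 := ℝ) (0 : Fin 1) (fderiv ℝ (G i) z)) y = _ :=
    hS.fderiv
  rw [extDeriv, hS']
  refine alt_two_ext fun u w => ?_
  rw [ContinuousAlternatingMap.alternatizeUncurryFin_apply, Fin.sum_univ_two]
  simp only [ContinuousAlternatingMap.sum_apply, wedge_apply, sum_apply, Finset.smul_sum]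
  rw [← Finset.sum_add_distrib]
  refine Finset.sum_congr rfl fun i _ => ?_
  have hsymm : fderiv ℝ (fderiv ℝ (G i)) y u w = fderiv ℝ (fderiv ℝ (G i)) y w u :=
    ((hG i).isSymmSndFDerivAt (by simp; exact ENat.LEInfty.out)) u w
  have eT : ∀ (b : E →L[ℝ] ℝ) (v : Fin 1 → E), T b v = b (v 0) := fun _ _ => rfl
  simp [Fin.removeNth, eT, hsymm]
  ring

lemma extDeriv_chartForm {ι : Type} [Fintype ι] {f g : ι → M → ℝ} {η : OneForm I M}
    (x₀ : M) {y : E} (hy : y ∈ (extChartAt I x₀).target)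
    (hf : ∀ i, SmoothNear I 𝓘(ℝ, ℝ) (f i) ((extChartAt I x₀).symm y))
    (hg : ∀ i, SmoothNear I 𝓘(ℝ, ℝ) (g i) ((extChartAt I x₀).symm y))
    (h : ∀ᶠ z in 𝓝 ((extChartAt I x₀).symm y), η z = ∑ i, f i z • dR I (g i) z) :
    extDeriv (chartForm (toForm η) x₀) y =
      ∑ i, wedge (fderiv ℝ (fun z => f i ((extChartAt I x₀).symm z)) y)
        (fderiv ℝ (fun z => g i ((extChartAt I x₀).symm z)) y) := by
  rw [(chartForm_sum_smul_dR x₀ hy hg h).extDeriv_eq, extDeriv_sum_smul]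
  · exact fun i => ((hf i).contDiff_chart x₀ hy).self_of_nhds
  · exact fun i => ((hg i).contDiff_chart x₀ hy).self_of_nhds

lemma fderiv_chart {f : M → ℝ} (x₀ : M) {y : E} (hy : y ∈ (extChartAt I x₀).target)
    (hf : SmoothNear I 𝓘(ℝ, ℝ) f ((extChartAt I x₀).symm y)) (u : E) :
    fderiv ℝ (fun z => f ((extChartAt I x₀).symm z)) y u =
      dR I f ((extChartAt I x₀).symm y) (mfderiv 𝓘(ℝ, E) I (extChartAt I x₀).symm y u) := by
  rw [← mfderiv_eq_fderiv]
  exact DFunLike.congr_fun (dR_pull (I := 𝓘(ℝ, E)) hf.mdiff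
    ((contMDiffAt_extChartAt_symm_of_mem x₀ hy).mdifferentiableAt (by simp))) u

lemma mfderiv_extChartAt_symm_self_apply (x : M) (u : TangentSpace I x) :
    mfderiv 𝓘(ℝ, E) I (extChartAt I x).symm (extChartAt I x x)
      (mfderiv I 𝓘(ℝ, E) (extChartAt I x) x u) = u := by
  have h := mfderivWithin_extChartAt_symm_comp_mfderiv_extChartAt' (I := I) (x := x)
    (mem_extChartAt_source (I := I) x)
  rw [I.range_eq_univ, mfderivWithin_univ] at h
  exact DFunLike.congr_fun h u

/-- The exterior derivative of `∑ f dg` is `∑ df ∧ dg`. -/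
lemma extd_eq {ι : Type} [Fintype ι] {f g : ι → M → ℝ} {η : OneForm I M} {x : M}
    (hf : ∀ i, SmoothNear I 𝓘(ℝ, ℝ) (f i) x) (hg : ∀ i, SmoothNear I 𝓘(ℝ, ℝ) (g i) x)
    (h : ∀ᶠ z in 𝓝 x, η z = ∑ i, f i z • dR I (g i) z) :
    extd η x = ∑ i, wedge (dR I (f i) x) (dR I (g i) x) := by
  have hx : (extChartAt I x).symm (extChartAt I x x) = x := extChartAt_to_inv x
  have hy := mem_extChartAt_target (I := I) x
  have hf' : ∀ i, SmoothNear I 𝓘(ℝ, ℝ) (f i) ((extChartAt I x).symm (extChartAt I x x)) := by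
    rw [hx]; exact hf
  have hg' : ∀ i, SmoothNear I 𝓘(ℝ, ℝ) (g i) ((extChartAt I x).symm (extChartAt I x x)) := by
    rw [hx]; exact hg
  have e := extDeriv_chartForm x hy hf' hg' (by rw [hx]; exact h)
  refine alt_two_ext fun u w => ?_
  have e1 : extd η x ![u, w] = extDeriv (chartForm (toForm η) x) (extChartAt I x x)
      ![mfderiv I 𝓘(ℝ, E) (extChartAt I x) x u, mfderiv I 𝓘(ℝ, E) (extChartAt I x) x w] :=
    compContinuousLinearMap_two (Y := E) _ _ _ _
  have k1 : ∀ {k : M → ℝ} (_ : SmoothNear I 𝓘(ℝ, ℝ) k ((extChartAt I x).symm (extChartAt I x x)))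
      (v : TangentSpace I x),
      fderiv ℝ (fun z => k ((extChartAt I x).symm z)) (extChartAt I x x)
        (mfderiv I 𝓘(ℝ, E) (extChartAt I x) x v) = dR I k x v := fun {k} hk v => by
    refine (fderiv_chart x hy hk _).trans ?_
    have := mfderiv_extChartAt_symm_self_apply (I := I) x v
    erw [this]
    rw [hx]
  rw [e1, e, ContinuousAlternatingMap.sum_apply, ContinuousAlternatingMap.sum_apply]
  refine Finset.sum_congr rfl fun i _ => ?_
  exact congrArg₂ (· - ·) (congrArg₂ (· * ·) (k1 (hf' i) u) (k1 (hg' i) w))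
    (congrArg₂ (· * ·) (k1 (hf' i) w) (k1 (hg' i) u))

end Chart
end OneForms

section Calculus

variable {E : Type*} [NormedAddCommGroup E] [NormedSpace ℝ E]
  {H : Type*} [TopologicalSpace H] {I : ModelWithCorners ℝ E H}
  {M : Type*} [TopologicalSpace M] [ChartedSpace H M]
  {E' : Type*} [NormedAddCommGroup E'] [NormedSpace ℝ E']
  {H' : Type*} [TopologicalSpace H'] {I' : ModelWithCorners ℝ E' H'}
  {M' : Type*} [TopologicalSpace M'] [ChartedSpace H' M']
  {η θ : OneForm I M} {x : M}

lemma RepAt.eventually (h : RepAt η x) : ∀ᶠ y in 𝓝 x, RepAt η y := by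
  obtain ⟨ι, _, f, g, hf, hg, h⟩ := h
  filter_upwards [Filter.eventually_all.2 fun i => (hf i).eventually,
    Filter.eventually_all.2 fun i => (hg i).eventually, h.eventually_nhds] with y h1 h2 h3
  exact ⟨ι, _, f, g, h1, h2, h3⟩

lemma RepAt.congr (h : RepAt η x) (e : ∀ᶠ y in 𝓝 x, θ y = η y) : RepAt θ x := by
  obtain ⟨ι, hι, f, g, hf, hg, h⟩ := h
  refine ⟨ι, hι, f, g, hf, hg, ?_⟩
  filter_upwards [h, e] with y h1 h2 using h2.trans h1

lemma repAt_zero : RepAt (0 : OneForm I M) x :=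
  ⟨Empty, inferInstance, Empty.elim, Empty.elim, fun i => i.elim, fun i => i.elim,
    Filter.Eventually.of_forall fun _ => by simp⟩

lemma repAt_smul_dR {f g : M → ℝ} (hf : SmoothNear I 𝓘(ℝ, ℝ) f x)
    (hg : SmoothNear I 𝓘(ℝ, ℝ) g x) : RepAt (fun y => f y • dR I g y) x :=
  ⟨Unit, inferInstance, fun _ => f, fun _ => g, fun _ => hf, fun _ => hg,
    Filter.Eventually.of_forall fun _ => by simp⟩

lemma repAt_dR {g : M → ℝ} (hg : SmoothNear I 𝓘(ℝ, ℝ) g x) : RepAt (dR I g) x :=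
  (repAt_smul_dR (smoothNear_const (1 : ℝ) x) hg).congr (.of_forall fun y => by simp)

lemma RepAt.add (h : RepAt η x) (h' : RepAt θ x) : RepAt (η + θ) x := by
  obtain ⟨ι, _, f, g, hf, hg, h⟩ := h
  obtain ⟨ι', _, f', g', hf', hg', h'⟩ := h'
  refine ⟨ι ⊕ ι', inferInstance, Sum.elim f f', Sum.elim g g', ?_, ?_, ?_⟩
  · rintro (i | i); exacts [hf i, hf' i]
  · rintro (i | i); exacts [hg i, hg' i]
  · filter_upwards [h, h'] with y h1 h2
    simp [h1, h2]

lemma RepAt.fsmul {h : M → ℝ} (hh : SmoothNear I 𝓘(ℝ, ℝ) h x) (hη : RepAt η x) :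
    RepAt (fun y => h y • η y) x := by
  obtain ⟨ι, _, f, g, hf, hg, e⟩ := hη
  refine ⟨ι, inferInstance, fun i y => h y * f i y, g, fun i => hh.mul (hf i), hg, ?_⟩
  filter_upwards [e] with y h1
  rw [h1, Finset.smul_sum]
  exact Finset.sum_congr rfl fun i _ => smul_smul _ _ _

lemma RepAt.const_smul (c : ℝ) (hη : RepAt η x) : RepAt (c • η) x :=
  hη.fsmul (smoothNear_const c x)

lemma RepAt.sub (h : RepAt η x) (h' : RepAt θ x) : RepAt (η - θ) x :=
  (h.add (h'.const_smul (-1))).congr (.of_forall fun y => by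
    ext u
    simp only [Pi.add_apply, Pi.sub_apply, Pi.smul_apply, add_apply, sub_apply, smul_apply,
      smul_eq_mul]
    ring)

lemma repAt_sum {J : Type*} (s : Finset J) {η : J → OneForm I M} (h : ∀ j ∈ s, RepAt (η j) x) :
    RepAt (∑ j ∈ s, η j) x := by
  classical
  induction s using Finset.induction_on with
  | empty => simpa using repAt_zero
  | insert a s ha ih =>
    rw [Finset.sum_insert ha]
    exact (h a (by simp)).add (ih fun j hj => h j (by simp [hj]))

lemma RepAt.pull {g : M → M'} {η : OneForm I' M'} (hg : SmoothNear I I' g x)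
    (hη : RepAt η (g x)) : RepAt (pull (I := I) g η) x := by
  obtain ⟨ι, _, f, k, hf, hk, e⟩ := hη
  refine ⟨ι, inferInstance, fun i y => f i (g y), fun i y => k i (g y),
    fun i => (hf i).comp hg, fun i => (hk i).comp hg, ?_⟩
  have hk' : ∀ᶠ y in 𝓝 x, ∀ i, SmoothNear I' 𝓘(ℝ, ℝ) (k i) (g y) :=
    Filter.eventually_all.2 fun i => hg.continuousAt.eventually (hk i).eventually
  filter_upwards [hg.continuousAt.eventually e, hk', hg.eventually] with y h1 h2 h3
  ext u
  have e1 : ConvexDisk.pull (I := I) g η y u = η (g y) (mfderiv I I' g y u) := rfl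
  rw [e1, h1]
  refine (sum_smul_clm_apply _ _ _).trans ?_
  refine Eq.trans ?_ (sum_smul_clm_apply _ _ _).symm
  refine Finset.sum_congr rfl fun i _ => ?_
  rw [dR_pull (h2 i).mdiff h3.mdiff]
  rfl

section Extd
variable [IsManifold I ∞ M] [I.Boundaryless] [IsManifold I' ∞ M'] [I'.Boundaryless]

lemma extd_congr (h : RepAt η x) (e : ∀ᶠ y in 𝓝 x, θ y = η y) : extd θ x = extd η x := by
  obtain ⟨ι, _, f, g, hf, hg, h⟩ := h
  rw [extd_eq hf hg h, extd_eq hf hg (h.mp (e.mono fun y h1 h2 => h1.trans h2))]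

lemma extd_smul_dR {f g : M → ℝ} (hf : SmoothNear I 𝓘(ℝ, ℝ) f x)
    (hg : SmoothNear I 𝓘(ℝ, ℝ) g x) :
    extd (fun y => f y • dR I g y) x = wedge (dR I f x) (dR I g x) := by
  rw [extd_eq (ι := Unit) (f := fun _ => f) (g := fun _ => g) (fun _ => hf) (fun _ => hg)
    (Filter.Eventually.of_forall fun _ => by simp)]
  simp

lemma extd_dR {g : M → ℝ} (hg : SmoothNear I 𝓘(ℝ, ℝ) g x) : extd (dR I g) x = 0 := by
  rw [extd_congr (repAt_smul_dR (smoothNear_const (1 : ℝ) x) hg)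
    (.of_forall fun y => by simp), extd_smul_dR (smoothNear_const (1 : ℝ) x) hg, dR_const]
  exact alt_two_ext fun u w => by simp [wedge_apply]

lemma extd_zero : extd (0 : OneForm I M) x = 0 := by
  rw [extd_eq (ι := Empty) (f := Empty.elim) (g := Empty.elim) (fun i => i.elim)
    (fun i => i.elim) (Filter.Eventually.of_forall fun _ => by simp)]
  simp

lemma extd_add (h : RepAt η x) (h' : RepAt θ x) : extd (η + θ) x = extd η x + extd θ x := by
  obtain ⟨ι, _, f, g, hf, hg, h⟩ := h
  obtain ⟨ι', _, f', g', hf', hg', h'⟩ := h'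
  rw [extd_eq hf hg h, extd_eq hf' hg' h', extd_eq (ι := ι ⊕ ι') (f := Sum.elim f f')
    (g := Sum.elim g g')]
  · simp
  · rintro (i | i); exacts [hf i, hf' i]
  · rintro (i | i); exacts [hg i, hg' i]
  · filter_upwards [h, h'] with y h1 h2
    simp [h1, h2]

lemma extd_fsmul {h : M → ℝ} (hh : SmoothNear I 𝓘(ℝ, ℝ) h x) (hη : RepAt η x) :
    extd (fun y => h y • η y) x = wedge (dR I h x) (η x) + h x • extd η x := by
  obtain ⟨ι, _, f, g, hf, hg, e⟩ := hη
  rw [extd_eq hf hg e, extd_eq (f := fun i y => h y * f i y) (g := g)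
    (fun i => hh.mul (hf i)) hg ?_]
  · rw [e.self_of_nhds]
    refine alt_two_ext fun u w => ?_
    simp only [ContinuousAlternatingMap.sum_apply, ContinuousAlternatingMap.add_apply,
      ContinuousAlternatingMap.smul_apply, wedge_apply, sum_smul_clm_apply, Finset.mul_sum,
      smul_eq_mul, ← Finset.sum_sub_distrib, ← Finset.sum_add_distrib]
    refine Finset.sum_congr rfl fun i _ => ?_
    rw [dR_mul hh.mdiff (hf i).mdiff]
    simp only [add_apply, smul_apply, smul_eq_mul]
    ring
  · filter_upwards [e] with y h1
    rw [h1, Finset.smul_sum]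
    exact Finset.sum_congr rfl fun i _ => smul_smul _ _ _

lemma extd_const_smul (c : ℝ) (hη : RepAt η x) : extd (c • η) x = c • extd η x := by
  have := extd_fsmul (smoothNear_const c x) hη
  rw [dR_const] at this
  refine this.trans ?_
  exact alt_two_ext fun u w => by simp [wedge_apply]

lemma extd_sub (h : RepAt η x) (h' : RepAt θ x) : extd (η - θ) x = extd η x - extd θ x := by
  rw [extd_congr (h.add (h'.const_smul (-1))) (.of_forall fun y => by
    ext u
    simp only [Pi.add_apply, Pi.sub_apply, Pi.smul_apply, add_apply, sub_apply, smul_apply,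
      smul_eq_mul]
    ring), extd_add h (h'.const_smul _),
    extd_const_smul _ h']
  refine alt_two_ext fun u w => ?_
  simp only [ContinuousAlternatingMap.add_apply, ContinuousAlternatingMap.sub_apply,
    ContinuousAlternatingMap.smul_apply, smul_eq_mul]
  ring

lemma extd_sum {J : Type*} (s : Finset J) {η : J → OneForm I M} (h : ∀ j ∈ s, RepAt (η j) x) :
    extd (∑ j ∈ s, η j) x = ∑ j ∈ s, extd (η j) x := by
  classical
  induction s using Finset.induction_on with
  | empty => simpa using extd_zero
  | insert a s ha ih =>
    rw [Finset.sum_insert ha, Finset.sum_insert ha, extd_add (h a (by simp))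
      (repAt_sum s fun j hj => h j (by simp [hj])), ih fun j hj => h j (by simp [hj])]

lemma extd_pull {g : M → M'} {η : OneForm I' M'} (hg : SmoothNear I I' g x)
    (hη : RepAt η (g x)) : extd (pull (I := I) g η) x = pullbackForm (I := I) g (extd η) x := by
  obtain ⟨ι, _, f, k, hf, hk, e⟩ := hη
  have hk' : ∀ᶠ y in 𝓝 x, ∀ i, SmoothNear I' 𝓘(ℝ, ℝ) (k i) (g y) :=
    Filter.eventually_all.2 fun i => hg.continuousAt.eventually (hk i).eventually
  rw [extd_eq (f := fun i y => f i (g y)) (g := fun i y => k i (g y))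
    (fun i => (hf i).comp hg) (fun i => (hk i).comp hg)]
  · refine alt_two_ext fun u w => ?_
    refine Eq.trans ?_ (compContinuousLinearMap_two _ _ _ _).symm
    rw [extd_eq hf hk e]
    simp only [ContinuousAlternatingMap.sum_apply, wedge_apply]
    refine Finset.sum_congr rfl fun i _ => ?_
    rw [dR_pull (hf i).mdiff hg.mdiff, dR_pull (hk i).mdiff hg.mdiff]
    rfl
  · filter_upwards [hg.continuousAt.eventually e, hk', hg.eventually] with y h1 h2 h3
    ext u
    have e1 : ConvexDisk.pull (I := I) g η y u = η (g y) (mfderiv I I' g y u) := rfl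
    rw [e1, h1]
    refine (sum_smul_clm_apply _ _ _).trans ?_
    refine Eq.trans ?_ (sum_smul_clm_apply _ _ _).symm
    refine Finset.sum_congr rfl fun i _ => ?_
    rw [dR_pull (h2 i).mdiff h3.mdiff]
    rfl

/-- The exterior derivative in an arbitrary chart. -/
lemma extDeriv_chartForm_eq (x₀ : M) {y : E} (hy : y ∈ (extChartAt I x₀).target)
    (hη : RepAt η ((extChartAt I x₀).symm y)) :
    extDeriv (chartForm (toForm η) x₀) y = chartForm (extd η) x₀ y := by
  obtain ⟨ι, _, f, g, hf, hg, e⟩ := hη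
  rw [extDeriv_chartForm x₀ hy hf hg e]
  refine alt_two_ext fun u w => ?_
  refine Eq.trans ?_ (compContinuousLinearMap_two _ _ _ _).symm
  rw [extd_eq hf hg e]
  simp only [ContinuousAlternatingMap.sum_apply, wedge_apply]
  refine Finset.sum_congr rfl fun i _ => ?_
  exact congrArg₂ (· - ·)
    (congrArg₂ (· * ·) (fderiv_chart x₀ hy (hf i) u) (fderiv_chart x₀ hy (hg i) w))
    (congrArg₂ (· * ·) (fderiv_chart x₀ hy (hf i) w) (fderiv_chart x₀ hy (hg i) u))

lemma contDiffAt_chartForm_toForm (x₀ : M) {y : E} (hy : y ∈ (extChartAt I x₀).target)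
    (hη : RepAt η ((extChartAt I x₀).symm y)) :
    ContDiffAt ℝ ∞ (chartForm (toForm η) x₀) y := by
  obtain ⟨ι, _, f, g, hf, hg, e⟩ := hη
  refine ContDiffAt.congr_of_eventuallyEq ?_ (chartForm_sum_smul_dR x₀ hy hg e)
  refine ContDiffAt.sum fun i _ => ((hf i).contDiff_chart x₀ hy).self_of_nhds.smul ?_
  refine ((ContinuousAlternatingMap.ofSubsingletonLIE (𝕜 := ℝ) (E := E) (F := ℝ)
    (0 : Fin 1)).toContinuousLinearEquiv.contDiff).contDiffAt.comp y ?_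
  exact ((hg i).contDiff_chart x₀ hy).self_of_nhds.fderiv_right (m := ∞) (by simp)

lemma contDiffAt_chartForm_extd (x₀ : M) {y : E} (hy : y ∈ (extChartAt I x₀).target)
    (hη : RepAt η ((extChartAt I x₀).symm y)) :
    ContDiffAt ℝ ∞ (chartForm (extd η) x₀) y := by
  have hc := smoothNear_extChartAt_symm (I := I) x₀ hy
  obtain ⟨ι, _, f, g, hf, hg, e⟩ := id hη
  have key : chartForm (extd η) x₀ =ᶠ[𝓝 y] fun z => ∑ i,
      wedgeL (fderiv ℝ (fun z => f i ((extChartAt I x₀).symm z)) z)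
        (fderiv ℝ (fun z => g i ((extChartAt I x₀).symm z)) z) := by
    filter_upwards [(isOpen_extChartAt_target x₀).mem_nhds hy,
      hc.continuousAt.eventually hη.eventually, hc.continuousAt.eventually e.eventually_nhds,
      Filter.eventually_all.2 fun i => hc.continuousAt.eventually (hf i).eventually,
      Filter.eventually_all.2 fun i => hc.continuousAt.eventually (hg i).eventually]
      with z h1 h2 h3 h4 h5
    rw [← extDeriv_chartForm_eq x₀ h1 h2, extDeriv_chartForm x₀ h1 h4 h5 h3]
    rfl
  refine ContDiffAt.congr_of_eventuallyEq ?_ key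
  refine ContDiffAt.sum fun i _ => ?_
  refine ContDiffAt.clm_apply (ContDiffAt.continuousLinearMap_comp _ ?_) ?_
  · exact ((hf i).contDiff_chart x₀ hy).self_of_nhds.fderiv_right (m := ∞) (by simp)
  · exact ((hg i).contDiff_chart x₀ hy).self_of_nhds.fderiv_right (m := ∞) (by simp)

lemma chartForm_congr {k : ℕ} {τ τ' : FormField I M k} (x₀ : M) {y : E}
    (hy : y ∈ (extChartAt I x₀).target)
    (e : ∀ᶠ z in 𝓝 ((extChartAt I x₀).symm y), τ z = τ' z) :
    chartForm τ x₀ =ᶠ[𝓝 y] chartForm τ' x₀ := by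
  filter_upwards [(smoothNear_extChartAt_symm (I := I) x₀ hy).continuousAt.eventually e] with z h
  simp only [chartForm, pullbackForm, h]
  rfl

lemma extDeriv_chartForm_extd (x₀ : M) {y : E} (hy : y ∈ (extChartAt I x₀).target)
    (hη : RepAt η ((extChartAt I x₀).symm y)) :
    extDeriv (chartForm (extd η) x₀) y = 0 := by
  have hc := smoothNear_extChartAt_symm (I := I) x₀ hy
  have key : chartForm (extd η) x₀ =ᶠ[𝓝 y] extDeriv (chartForm (toForm η) x₀) := by
    filter_upwards [(isOpen_extChartAt_target x₀).mem_nhds hy,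
      hc.continuousAt.eventually hη.eventually] with z h1 h2
    rw [extDeriv_chartForm_eq x₀ h1 h2]
  rw [key.extDeriv_eq]
  exact extDeriv_extDeriv_apply (contDiffAt_chartForm_toForm x₀ hy hη)
    (by simp; exact ENat.LEInfty.out)

lemma smoothFormOn_of_locally_exact {τ : FormField I M 2} {S : Set M}
    (h : ∀ x ∈ S, ∃ η : OneForm I M, RepAt η x ∧ ∀ᶠ y in 𝓝 x, τ y = extd η y) :
    SmoothFormOn τ S := by
  rintro x₀ y ⟨hy, hyS⟩
  obtain ⟨η, h1, h2⟩ := h _ hyS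
  exact ((contDiffAt_chartForm_extd x₀ hy h1).congr_of_eventuallyEq
    (chartForm_congr x₀ hy h2)).contDiffWithinAt

lemma closed_of_locally_exact {τ : FormField I M 2} {S : Set M}
    (h : ∀ x ∈ S, ∃ η : OneForm I M, RepAt η x ∧ ∀ᶠ y in 𝓝 x, τ y = extd η y) :
    ExtDerivEqOn τ (fun _ => 0) S := by
  rintro x₀ y ⟨hy, hyS⟩
  obtain ⟨η, h1, h2⟩ := h _ hyS
  rw [(chartForm_congr x₀ hy h2).extDeriv_eq, extDeriv_chartForm_extd x₀ hy h1]
  rfl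

lemma extDerivEqOn_of_repAt {θ : FormField I M 1} {τ : FormField I M 2} {S : Set M}
    (hS : IsOpen S) (h : ∀ x ∈ S, RepAt η x) (hθ : ∀ x ∈ S, θ x = toForm η x)
    (hτ : ∀ x ∈ S, τ x = extd η x) : ExtDerivEqOn θ τ S := by
  rintro x₀ y ⟨hy, hyS⟩
  rw [(chartForm_congr x₀ hy (Filter.mem_of_superset (hS.mem_nhds hyS) hθ)).extDeriv_eq,
    extDeriv_chartForm_eq x₀ hy (h _ hyS)]
  simp only [chartForm, pullbackForm, hτ _ hyS]
  rfl

end Extd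
end Calculus

section LinearOrient

variable {X : Type*} [AddCommGroup X] [Module ℝ X]

lemma exists_posPair [FiniteDimensional ℝ X] (hX : Module.finrank ℝ X = 2)
    (o : Orientation ℝ X (Fin 2)) : ∃ u w, PosPair o u w := by
  let b := (Module.finBasisOfFinrankEq ℝ X hX).adjustToOrientation o
  exact ⟨b 0, b 1, b, rfl, rfl, Module.Basis.orientation_adjustToOrientation _ _⟩

lemma PosPair.apply_eq_mul [TopologicalSpace X] {o : Orientation ℝ X (Fin 2)} {u w u' w' : X}
    (h : PosPair o u w) (h' : PosPair o u' w') :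
    ∃ d : ℝ, 0 < d ∧ ∀ F : X [⋀^Fin 2]→L[ℝ] ℝ, F ![u', w'] = d * F ![u, w] := by
  obtain ⟨b, rfl, rfl, hb⟩ := h
  obtain ⟨b', rfl, rfl, hb'⟩ := h'
  refine ⟨b.det b', (Module.Basis.orientation_eq_iff_det_pos _ _).1 (hb.trans hb'.symm),
    fun F => ?_⟩
  have e := F.toAlternatingMap.eq_smul_basis_det b
  have e1 : (![b' 0, b' 1] : Fin 2 → X) = b' := by ext i; fin_cases i <;> rfl
  have e2 : (![b 0, b 1] : Fin 2 → X) = b := by ext i; fin_cases i <;> rfl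
  rw [e1, e2, mul_comm]
  exact DFunLike.congr_fun e _

lemma PosPair.pos_iff [TopologicalSpace X] {o : Orientation ℝ X (Fin 2)} {u w u' w' : X}
    (h : PosPair o u w) (h' : PosPair o u' w') (F : X [⋀^Fin 2]→L[ℝ] ℝ) :
    0 < F ![u', w'] ↔ 0 < F ![u, w] := by
  obtain ⟨d, hd, e⟩ := h.apply_eq_mul h'
  rw [e, mul_pos_iff_of_pos_left hd]

/-- A linear form in the plane is determined by its values on the standard basis. -/
lemma clm_plane_apply {Y : Type*} [AddCommGroup Y] [Module ℝ Y] [TopologicalSpace Y]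
    (l : Plane →L[ℝ] Y) (a : Plane) :
    l a = a 0 • l (EuclideanSpace.single 0 1) + a 1 • l (EuclideanSpace.single 1 1) := by
  have : a = a 0 • EuclideanSpace.single 0 1 + a 1 • EuclideanSpace.single 1 1 := by
    ext i; fin_cases i <;> simp
  conv_lhs => rw [this]
  simp

lemma alt_plane_apply (F : Plane [⋀^Fin 2]→L[ℝ] ℝ) (a b : Plane) :
    F ![a, b] = stdArea a b * F ![EuclideanSpace.single 0 1, EuclideanSpace.single 1 1] := by
  have e := F.toAlternatingMap.eq_smul_basis_det (EuclideanSpace.basisFun (Fin 2) ℝ).toBasis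
  have e2 : ⇑(EuclideanSpace.basisFun (Fin 2) ℝ).toBasis =
      ![EuclideanSpace.single 0 1, EuclideanSpace.single 1 1] := by
    ext i j; fin_cases i <;> simp
  have := DFunLike.congr_fun e ![a, b]
  refine this.trans ?_
  rw [e2]
  simp [Module.Basis.det_apply, Matrix.det_fin_two, Module.Basis.toMatrix_apply, stdArea]
  ring

end LinearOrient

section Surface

variable {C : Type*} [TopologicalSpace C] [ChartedSpace Plane C] [IsManifold (𝓡 2) ∞ C]

/-- The `2`-form `τ` is positive at `y`. -/
def PosForm (oC : SurfaceOrientation C) (τ : FormField (𝓡 2) C 2) (y : C) : Prop :=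
  ∀ u w, PosPair (oC.or y) u w → 0 < τ y ![u, w]

/-- The `2`-form `τ` is nonnegative at `y`. -/
def NonnegForm (oC : SurfaceOrientation C) (τ : FormField (𝓡 2) C 2) (y : C) : Prop :=
  ∀ u w, PosPair (oC.or y) u w → 0 ≤ τ y ![u, w]

lemma exists_posPair_tangent (oC : SurfaceOrientation C) (y : C) :
    ∃ u w, PosPair (oC.or y) u w :=
  have : FiniteDimensional ℝ (TangentSpace (𝓡 2) y) :=
    inferInstanceAs (FiniteDimensional ℝ (EuclideanSpace ℝ (Fin 2)))
  exists_posPair (finrank_euclideanSpace_fin (𝕜 := ℝ) (n := 2)) (oC.or y)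

lemma posForm_of_posPair {oC : SurfaceOrientation C} {τ : FormField (𝓡 2) C 2} {y : C}
    {u w : TangentSpace (𝓡 2) y} (h : PosPair (oC.or y) u w) (h0 : 0 < τ y ![u, w]) :
    PosForm oC τ y := fun _ _ h' => (h.pos_iff h' (τ y)).2 h0

/-- The coordinate frame at `y` of the chart around `y₀`. -/
def chartFrame (y₀ y : C) (a : Plane) : TangentSpace (𝓡 2) y :=
  (trivializationAt Plane (TangentSpace (𝓡 2)) y₀).symm y a

lemma chartFrame_eq {y₀ y : C} (hy : y ∈ (chartAt Plane y₀).source) (a : Plane) :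
    chartFrame y₀ y a =
      mfderiv 𝓘(ℝ, Plane) (𝓡 2) (extChartAt (𝓡 2) y₀).symm (extChartAt (𝓡 2) y₀ y) a := by
  have h := TangentBundle.symmL_trivializationAt (I := 𝓡 2) hy
  rw [(𝓡 2).range_eq_univ, mfderivWithin_univ] at h
  refine (Trivialization.symmL_apply (R := ℝ) _ ?_ a).symm.trans (DFunLike.congr_fun h a)
  rwa [TangentBundle.trivializationAt_baseSet]

lemma chartForm_apply_chartFrame (τ : FormField (𝓡 2) C 2) {y₀ y : C}
    (hy : y ∈ (chartAt Plane y₀).source) (a b : Plane) :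
    chartForm τ y₀ (extChartAt (𝓡 2) y₀ y) ![a, b] =
      τ y ![chartFrame y₀ y a, chartFrame y₀ y b] := by
  rw [chartFrame_eq hy, chartFrame_eq hy]
  refine (compContinuousLinearMap_two (Y := TangentSpace (𝓡 2) _) _ _ _ _).trans ?_
  have : ∀ y' (_ : y' = y) (u w : Plane), (τ y' : Plane [⋀^Fin 2]→L[ℝ] ℝ) ![u, w] =
      (τ y : Plane [⋀^Fin 2]→L[ℝ] ℝ) ![u, w] := by
    rintro _ rfl u w; rfl
  exact this _ ((extChartAt (𝓡 2) y₀).left_inv (by rwa [extChartAt_source])) _ _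

lemma exists_posPair_chartFrame (oC : SurfaceOrientation C) (y₀ : C) :
    ∃ a b : Plane, ∀ᶠ y in 𝓝 y₀, y ∈ (chartAt Plane y₀).source ∧
      PosPair (oC.or y) (chartFrame y₀ y a) (chartFrame y₀ y b) := by
  obtain ⟨u, w, h⟩ := exists_posPair_tangent oC y₀
  have hs : ∀ u : TangentSpace (𝓡 2) y₀, (trivializationAt Plane (TangentSpace (𝓡 2)) y₀).symm y₀
      ((trivializationAt Plane (TangentSpace (𝓡 2)) y₀).continuousLinearMapAt ℝ y₀ u) = u :=
    fun u => (Trivialization.symmL_apply (R := ℝ) _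
      (mem_baseSet_trivializationAt Plane (TangentSpace (𝓡 2)) y₀) _).symm.trans
      (Trivialization.symmL_continuousLinearMapAt (R := ℝ) _
      (mem_baseSet_trivializationAt Plane (TangentSpace (𝓡 2)) y₀) u)
  refine ⟨(trivializationAt Plane (TangentSpace (𝓡 2)) y₀).continuousLinearMapAt ℝ y₀ u,
    (trivializationAt Plane (TangentSpace (𝓡 2)) y₀).continuousLinearMapAt ℝ y₀ w, ?_⟩
  filter_upwards [oC.continuous y₀
    ((trivializationAt Plane (TangentSpace (𝓡 2)) y₀).continuousLinearMapAt ℝ y₀ u)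
    ((trivializationAt Plane (TangentSpace (𝓡 2)) y₀).continuousLinearMapAt ℝ y₀ w)
    (by rw [hs, hs]; exact h),
    (chartAt Plane y₀).open_source.mem_nhds (mem_chart_source _ _)] with y h1 h2
  exact ⟨h2, h1⟩

lemma continuousAt_chartForm {η : OneForm (𝓡 2) C} {y₀ : C} (h : RepAt η y₀) (a b : Plane) :
    ContinuousAt (fun y => extd η y ![chartFrame y₀ y a, chartFrame y₀ y b]) y₀ := by
  have h1 : ContDiffAt ℝ ∞ (chartForm (extd η) y₀) (extChartAt (𝓡 2) y₀ y₀) :=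
    contDiffAt_chartForm_extd y₀ (mem_extChartAt_target y₀) (by rwa [extChartAt_to_inv])
  have h2 : ContinuousAt (fun y => chartForm (extd η) y₀ (extChartAt (𝓡 2) y₀ y) ![a, b]) y₀ := by
    have h3 : ContinuousAt (fun y => chartForm (extd η) y₀ (extChartAt (𝓡 2) y₀ y)) y₀ :=
      ContinuousAt.comp (f := extChartAt (𝓡 2) y₀) (x := y₀) h1.continuousAt
        (continuousAt_extChartAt y₀)
    exact ((ContinuousAlternatingMap.apply ℝ Plane ℝ ![a, b]).continuous.continuousAt).comp h3
  refine h2.congr ?_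
  filter_upwards [(chartAt Plane y₀).open_source.mem_nhds (mem_chart_source _ _)] with y hy
  exact chartForm_apply_chartFrame _ hy a b

lemma PosForm.eventually_add_smul {oC : SurfaceOrientation C} {η θ : OneForm (𝓡 2) C} {y₀ : C}
    (h : RepAt η y₀) (h' : RepAt θ y₀) (hp : PosForm oC (extd η) y₀) :
    ∃ ε > 0, ∀ᶠ y in 𝓝 y₀, ∀ t : ℝ, |t| ≤ ε →
      PosForm oC (fun y => extd η y + t • extd θ y) y := by
  obtain ⟨a, b, hab⟩ := exists_posPair_chartFrame oC y₀
  have h1 := continuousAt_chartForm h a b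
  have h2 := continuousAt_chartForm h' a b
  set p := extd η y₀ ![chartFrame y₀ y₀ a, chartFrame y₀ y₀ b] with hpdef
  set q := extd θ y₀ ![chartFrame y₀ y₀ a, chartFrame y₀ y₀ b] with hqdef
  have hp0 : 0 < p := hp _ _ hab.self_of_nhds.2
  refine ⟨p / 2 / (|q| + 1), by positivity, ?_⟩
  have h3 : ∀ᶠ y in 𝓝 y₀, p / 2 < extd η y ![chartFrame y₀ y a, chartFrame y₀ y b] :=
    h1.eventually (lt_mem_nhds (by change _ < p; linarith))
  have h4 : ∀ᶠ y in 𝓝 y₀, |extd θ y ![chartFrame y₀ y a, chartFrame y₀ y b]| < |q| + 1 :=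
    h2.abs.eventually (gt_mem_nhds (by change |q| < _; linarith))
  filter_upwards [hab, h3, h4] with y hy1 hy3 hy4 t ht
  refine posForm_of_posPair hy1.2 ?_
  rw [ContinuousAlternatingMap.add_apply, ContinuousAlternatingMap.smul_apply, smul_eq_mul]
  have h5 : |t * extd θ y ![chartFrame y₀ y a, chartFrame y₀ y b]| ≤ p / 2 := by
    rw [abs_mul]
    calc _ ≤ p / 2 / (|q| + 1) * (|q| + 1) := by gcongr
      _ = p / 2 := by field_simp
  linarith [neg_abs_le (t * extd θ y ![chartFrame y₀ y a, chartFrame y₀ y b])]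

lemma PosForm.eventually {oC : SurfaceOrientation C} {η : OneForm (𝓡 2) C} {y₀ : C}
    (h : RepAt η y₀) (hp : PosForm oC (extd η) y₀) : ∀ᶠ y in 𝓝 y₀, PosForm oC (extd η) y := by
  obtain ⟨ε, hε, H⟩ := hp.eventually_add_smul h h
  filter_upwards [H] with y hy u w huw
  have := hy 0 (by simpa using hε.le) u w huw
  simpa using this

end Surface

section PlaneMaps

variable {E : Type*} [NormedAddCommGroup E] [NormedSpace ℝ E]
  {H : Type*} [TopologicalSpace H] {I : ModelWithCorners ℝ E H}
  {M : Type*} [TopologicalSpace M] [ChartedSpace H M] {f g : M → Plane} {x : M}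

/-- A coordinate of the plane. -/
def coordL (i : Fin 2) : Plane →L[ℝ] ℝ := EuclideanSpace.proj i

lemma coordL_apply (i : Fin 2) (q : Plane) : coordL i q = q i := rfl

/-- A coordinate of a map to the plane. -/
def co (f : M → Plane) (i : Fin 2) : M → ℝ := fun y => f y i

/-- The form `f₀ df₁ - f₁ df₀`, i.e. `r² dθ` in the polar coordinates given by `f`. -/
def rot (I : ModelWithCorners ℝ E H) (f : M → Plane) : OneForm I M :=
  fun y => f y 0 • dR I (co f 1) y - f y 1 • dR I (co f 0) y

/-- The pullback `df₀ ∧ df₁` of the area form of the plane. -/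
def area (I : ModelWithCorners ℝ E H) (f : M → Plane) : FormField I M 2 :=
  fun y => wedge (dR I (co f 0) y) (dR I (co f 1) y)

lemma plane_norm_sq (q : Plane) : ‖q‖ ^ 2 = q 0 ^ 2 + q 1 ^ 2 := by
  rw [EuclideanSpace.real_norm_sq_eq, Fin.sum_univ_two]

lemma SmoothNear.co (hf : SmoothNear I 𝓘(ℝ, Plane) f x) (i : Fin 2) :
    SmoothNear I 𝓘(ℝ, ℝ) (co f i) x :=
  hf.comp_contDiff (φ := fun q : Plane => q i)
    (coordL i).contDiff

lemma SmoothNear.normSq (hf : SmoothNear I 𝓘(ℝ, Plane) f x) :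
    SmoothNear I 𝓘(ℝ, ℝ) (fun y => ‖f y‖ ^ 2) x :=
  hf.comp_contDiff (φ := fun q : Plane => ‖q‖ ^ 2) (contDiff_norm_sq ℝ)

lemma smoothNear_of_co (h0 : SmoothNear I 𝓘(ℝ, ℝ) (co f 0) x)
    (h1 : SmoothNear I 𝓘(ℝ, ℝ) (co f 1) x) : SmoothNear I 𝓘(ℝ, Plane) f x := by
  have h : SmoothNear I 𝓘(ℝ, Plane)
      (fun y => co f 0 y • (EuclideanSpace.single 0 1 : Plane) +
        co f 1 y • (EuclideanSpace.single 1 1 : Plane)) x :=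
    (h0.smul (smoothNear_const _ _)).add (h1.smul (smoothNear_const _ _))
  refine h.congr (.of_forall fun y => ?_)
  ext i; fin_cases i <;> simp [co]

lemma planeDeriv_apply (hf : MDifferentiableAt I 𝓘(ℝ, Plane) f x) (u : TangentSpace I x)
    (i : Fin 2) : planeDeriv I f x u i = dR I (co f i) x u := by
  have h : HasMFDerivAt I 𝓘(ℝ, ℝ) (co f i) x
      ((coordL i).comp
        (mfderiv I 𝓘(ℝ, Plane) f x : TangentSpace I x →L[ℝ] Plane)) :=
    HasMFDerivAt.comp x ((coordL i).hasFDerivAt.hasMFDerivAt) hf.hasMFDerivAt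
  rw [dR, h.mfderiv]
  rfl

lemma rot_apply (hf : MDifferentiableAt I 𝓘(ℝ, Plane) f x) (u : TangentSpace I x) :
    rot I f x u = stdArea (f x) (planeDeriv I f x u) := by
  simp only [rot, stdArea, planeDeriv_apply hf, sub_apply, smul_apply, smul_eq_mul]

lemma area_apply (hf : MDifferentiableAt I 𝓘(ℝ, Plane) f x) (u w : TangentSpace I x) :
    area I f x ![u, w] = stdArea (planeDeriv I f x u) (planeDeriv I f x w) := by
  simp only [area, stdArea, planeDeriv_apply hf, wedge_apply]
  simp only [Matrix.cons_val_zero, Matrix.cons_val_one]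
  ring

lemma repAt_rot (hf : SmoothNear I 𝓘(ℝ, Plane) f x) : RepAt (rot I f) x :=
  (repAt_smul_dR (hf.co 0) (hf.co 1)).sub (repAt_smul_dR (hf.co 1) (hf.co 0))

lemma extd_rot [IsManifold I ∞ M] [I.Boundaryless] (hf : SmoothNear I 𝓘(ℝ, Plane) f x) :
    extd (rot I f) x = (2 : ℝ) • area I f x := by
  refine (extd_sub (repAt_smul_dR (hf.co 0) (hf.co 1))
    (repAt_smul_dR (hf.co 1) (hf.co 0))).trans ?_
  rw [extd_smul_dR (hf.co 0) (hf.co 1), extd_smul_dR (hf.co 1) (hf.co 0)]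
  refine alt_two_ext fun u w => ?_
  simp only [ContinuousAlternatingMap.sub_apply, ContinuousAlternatingMap.smul_apply, area,
    wedge_apply, smul_eq_mul]
  ring

lemma dR_co_congr (h : f =ᶠ[𝓝 x] g) (i : Fin 2) : dR I (co f i) x = dR I (co g i) x :=
  dR_congr (h.mono fun y hy => by simp only [co, hy])

lemma rot_congr (h : f =ᶠ[𝓝 x] g) : rot I f x = rot I g x := by
  simp only [rot, dR_co_congr h, h.self_of_nhds]

end PlaneMaps

section Coordinates

variable {C : Type*} [TopologicalSpace C] [ChartedSpace Plane C] [IsManifold (𝓡 2) ∞ C]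

/-- `f` is a germ at `p` of a positively oriented coordinate system centered at `p`. -/
structure IsCoord (oC : SurfaceOrientation C) (f : C → Plane) (p : C) : Prop where
  smooth : SmoothNear (𝓡 2) 𝓘(ℝ, Plane) f p
  zero : f p = 0
  pos : PosForm oC (area (𝓡 2) f) p

lemma area_pos_eventually {oC : SurfaceOrientation C} {f : C → Plane} {p : C}
    (h : SmoothNear (𝓡 2) 𝓘(ℝ, Plane) f p) (hp : PosForm oC (area (𝓡 2) f) p) :
    ∀ᶠ y in 𝓝 p, PosForm oC (area (𝓡 2) f) y := by
  have e : ∀ {y}, SmoothNear (𝓡 2) 𝓘(ℝ, Plane) f y → ∀ u w : TangentSpace (𝓡 2) y,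
      extd (rot (𝓡 2) f) y ![u, w] = 2 * area (𝓡 2) f y ![u, w] := fun hy u w => by
    rw [extd_rot hy]; rfl
  have := PosForm.eventually (oC := oC) (repAt_rot h) (fun u w huw => by
    rw [e h]; linarith [hp u w huw])
  filter_upwards [this, h.eventually] with y h1 h2 u w huw
  have := h1 u w huw
  rw [e h2] at this
  linarith

lemma exists_equiv_of_stdArea (L : Plane →L[ℝ] Plane) {a b : Plane}
    (h : stdArea (L a) (L b) ≠ 0) : ∃ e : Plane ≃L[ℝ] Plane, (e : Plane →L[ℝ] Plane) = L := by
  let pr : Fin 2 → Plane →L[ℝ] ℝ :=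
    fun i => (coordL i).comp L
  have hF : ∀ u w, wedge (pr 0) (pr 1) ![u, w] = stdArea (L u) (L w) := fun u w => by
    simp [wedge_apply, pr, stdArea, coordL_apply]; ring
  have hne : wedge (pr 0) (pr 1) ![EuclideanSpace.single 0 1, EuclideanSpace.single 1 1] ≠ 0 := by
    intro h0
    apply h
    rw [← hF, alt_plane_apply, h0, mul_zero]
  have hinj : LinearMap.ker (L : Plane →ₗ[ℝ] Plane) = ⊥ := by
    rw [LinearMap.ker_eq_bot']
    intro u hu
    have hu' : L u = 0 := hu
    have h1 := hF u !₂[-u 1, u 0]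
    rw [hu', alt_plane_apply] at h1
    have h2 : stdArea u !₂[-u 1, u 0] = 0 := by
      rcases mul_eq_zero.1 (h1.trans (by simp [stdArea])) with h | h
      · exact h
      · exact absurd h hne
    have h3 : ‖u‖ ^ 2 = 0 := by
      rw [plane_norm_sq]
      simp [stdArea] at h2
      nlinarith
    simpa using h3
  exact ⟨ContinuousLinearEquiv.ofBijective L hinj
    (LinearMap.ker_eq_bot_iff_range_eq_top.1 hinj), by ext1 x; simp⟩

/-- The derivative of `f` in the chart around `p`. -/
lemma hasFDerivAt_chart {f : C → Plane} {p y : C}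
    (hy : y ∈ (chartAt Plane p).source) (hf : SmoothNear (𝓡 2) 𝓘(ℝ, Plane) f y) :
    ContDiffAt ℝ ∞ (fun z => f ((chartAt Plane p).symm z)) (chartAt Plane p y) ∧
    ∀ u : TangentSpace (𝓡 2) y,
      fderiv ℝ (fun z => f ((chartAt Plane p).symm z)) (chartAt Plane p y)
        (mfderiv (𝓡 2) 𝓘(ℝ, Plane) (chartAt Plane p) y u) = planeDeriv (𝓡 2) f y u := by
  have hy' : (chartAt Plane p).symm (chartAt Plane p y) = y := (chartAt Plane p).left_inv hy
  have hs : ContMDiffAt 𝓘(ℝ, Plane) (𝓡 2) ∞ (chartAt Plane p).symm (chartAt Plane p y) :=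
    contMDiffAt_symm_of_mem_maximalAtlas (IsManifold.chart_mem_maximalAtlas p)
      ((chartAt Plane p).map_source hy)
  have hf' : ContMDiffAt (𝓡 2) 𝓘(ℝ, Plane) ∞ f ((chartAt Plane p).symm (chartAt Plane p y)) := by
    rw [hy']; exact hf.self
  have h1 : ContDiffAt ℝ ∞ (fun z => f ((chartAt Plane p).symm z)) (chartAt Plane p y) :=
    contMDiffAt_iff_contDiffAt.1 (ContMDiffAt.comp _ hf' hs)
  refine ⟨h1, fun u => ?_⟩
  have hc : (mfderiv 𝓘(ℝ, Plane) 𝓘(ℝ, Plane) (fun z => f ((chartAt Plane p).symm z))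
      (chartAt Plane p y)) = (mfderiv (𝓡 2) 𝓘(ℝ, Plane) f
        ((chartAt Plane p).symm (chartAt Plane p y))).comp
      (mfderiv 𝓘(ℝ, Plane) (𝓡 2) (chartAt Plane p).symm (chartAt Plane p y)) :=
    mfderiv_comp _ (hf'.mdifferentiableAt (by simp)) (hs.mdifferentiableAt (by simp))
  rw [mfderiv_eq_fderiv] at hc
  have hd := mdifferentiable_chart (I := 𝓡 2) p
  have k := DFunLike.congr_fun (hd.symm_comp_deriv hy) u
  have k2 : ∀ v : Plane, fderiv ℝ (fun z => f ((chartAt Plane p).symm z)) (chartAt Plane p y) v =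
      planeDeriv (𝓡 2) f ((chartAt Plane p).symm (chartAt Plane p y))
        (mfderiv 𝓘(ℝ, Plane) (𝓡 2) (chartAt Plane p).symm (chartAt Plane p y) v) :=
    fun v => DFunLike.congr_fun hc v
  refine (k2 _).trans ?_
  have k3 : ∀ y' (_ : y' = y) (v : Plane), (planeDeriv (𝓡 2) f y' : Plane → Plane) v =
      (planeDeriv (𝓡 2) f y : Plane → Plane) v := by rintro _ rfl v; rfl
  exact (k3 _ hy' _).trans (congrArg (planeDeriv (𝓡 2) f y) k)

lemma exists_hasFDerivAt_equiv {oC : SurfaceOrientation C} {f : C → Plane} {p y : C}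
    (hy : y ∈ (chartAt Plane p).source) (hf : SmoothNear (𝓡 2) 𝓘(ℝ, Plane) f y)
    (hpos : PosForm oC (area (𝓡 2) f) y) :
    ContDiffAt ℝ ∞ (fun z => f ((chartAt Plane p).symm z)) (chartAt Plane p y) ∧
    ∃ e : Plane ≃L[ℝ] Plane, HasFDerivAt (fun z => f ((chartAt Plane p).symm z))
      (e : Plane →L[ℝ] Plane) (chartAt Plane p y) := by
  obtain ⟨h1, hD⟩ := hasFDerivAt_chart hy hf
  have h2 := (h1.differentiableAt (by simp)).hasFDerivAt
  obtain ⟨u, w, huw⟩ := exists_posPair_tangent oC y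
  have hne := hpos u w huw
  rw [area_apply hf.mdiff, ← hD u, ← hD w] at hne
  obtain ⟨e, he⟩ := exists_equiv_of_stdArea _ hne.ne'
  exact ⟨h1, e, by rw [he]; exact h2⟩

/-- A positively oriented coordinate germ is the germ of a chart onto a round disk. -/
lemma IsCoord.exists_chart {oC : SurfaceOrientation C} {f : C → Plane} {p : C}
    (h : IsCoord oC f p) {O : Set C} (hO : O ∈ 𝓝 p) :
    ∃ r₀ > 0, ∀ r, 0 < r → r ≤ r₀ → ∃ ψ : OpenPartialHomeomorph C Plane,
      ψ ∈ IsManifold.maximalAtlas (𝓡 2) ∞ C ∧ p ∈ ψ.source ∧ ψ.source ⊆ O ∧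
      ψ.target = Metric.ball 0 r ∧
      ∀ y ∈ ψ.source, ψ y = f y ∧ SmoothNear (𝓡 2) 𝓘(ℝ, Plane) f y ∧
        PosForm oC (area (𝓡 2) f) y := by
  have hev : ∀ᶠ y in 𝓝 p, y ∈ O ∧ y ∈ (chartAt Plane p).source ∧
      SmoothNear (𝓡 2) 𝓘(ℝ, Plane) f y ∧ PosForm oC (area (𝓡 2) f) y := by
    filter_upwards [hO, (chartAt Plane p).open_source.mem_nhds (mem_chart_source _ _),
      h.smooth.eventually, area_pos_eventually h.smooth h.pos] with y h1 h2 h3 h4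
    exact ⟨h1, h2, h3, h4⟩
  obtain ⟨W, hW, hWo, hpW⟩ := eventually_nhds_iff.1 hev
  set φ := chartAt Plane p with hφ
  have hpφ : p ∈ φ.source := mem_chart_source _ _
  obtain ⟨hG, e, he⟩ := exists_hasFDerivAt_equiv (oC := oC) hpφ h.smooth h.pos
  let κ := hG.toOpenPartialHomeomorph (fun z => f (φ.symm z)) he (by simp)
  have hκ : ∀ z, κ z = f (φ.symm z) := fun z => rfl
  let ψ₀ := (φ.restrOpen W hWo).trans κ
  have hs0 : ∀ y, y ∈ ψ₀.source ↔ (y ∈ φ.source ∧ y ∈ W) ∧ φ y ∈ κ.source := fun y => by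
    simp [ψ₀]
  have hψ0 : ∀ y ∈ ψ₀.source, ψ₀ y = f y := fun y hy => by
    have : ψ₀ y = f (φ.symm (φ y)) := rfl
    rw [this, φ.left_inv ((hs0 y).1 hy).1.1]
  have hpκ : φ p ∈ κ.source := hG.mem_toOpenPartialHomeomorph_source he (by simp)
  have hp0 : p ∈ ψ₀.source := (hs0 p).2 ⟨⟨hpφ, hpW⟩, hpκ⟩
  have h0t : (0 : Plane) ∈ ψ₀.target := by
    have := ψ₀.map_source hp0
    rwa [hψ0 p hp0, h.zero] at this
  obtain ⟨r₀, hr₀, hball⟩ := Metric.isOpen_iff.1 ψ₀.open_target 0 h0t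
  refine ⟨r₀, hr₀, fun r hr hrr => ?_⟩
  let ψ := (ψ₀.symm.restrOpen (Metric.ball 0 r) Metric.isOpen_ball).symm
  have hsub : ψ.source ⊆ ψ₀.source := fun y hy => by
    have : y ∈ ψ.symm.target := hy
    simp [ψ] at this
    exact this.1
  have hval : ∀ y, ψ y = ψ₀ y := fun y => rfl
  have htgt : ψ.target = Metric.ball 0 r := by
    change ψ₀.symm.source ∩ Metric.ball 0 r = _
    exact inter_eq_right.2 ((Metric.ball_subset_ball hrr).trans hball)
  refine ⟨ψ, ?_, ?_, fun y hy => (hW y ((hs0 y).1 (hsub hy)).1.2).1, htgt, fun y hy =>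
    ⟨hψ0 y (hsub hy), (hW y ((hs0 y).1 (hsub hy)).1.2).2.2⟩⟩
  · refine ψ.mem_maximalAtlas_of_contMDiffOn ?_ ?_
    · intro y hy
      have := (hW y ((hs0 y).1 (hsub hy)).1.2).2.2.1.self.contMDiffWithinAt (s := ψ.source)
      exact this.congr (fun z hz => hψ0 z (hsub hz)) (hψ0 y (hsub hy))
    · intro z hz
      have hz0 : z ∈ ψ₀.target := by rw [htgt] at hz; exact hball (Metric.ball_subset_ball hrr hz)
      have hy := ψ₀.map_target hz0
      set y := ψ₀.symm z with hydef
      have hyW := hW y ((hs0 y).1 hy).1.2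
      have hzκ : z ∈ κ.target := by
        have : z ∈ κ.target ∩ _ := hz0
        exact this.1
      have hφy : κ.symm z = φ y := by
        have h1 : y = φ.symm (κ.symm z) := rfl
        have h2 : κ.symm z ∈ φ.target := by
          have : z ∈ κ.symm.source ∩ κ.symm ⁻¹' (φ.restrOpen W hWo).target := hz0
          have : κ.symm z ∈ φ.target ∩ _ := this.2
          exact this.1
        rw [h1, φ.right_inv h2]
      obtain ⟨hGy, e', he'⟩ := exists_hasFDerivAt_equiv (oC := oC) hyW.2.1 hyW.2.2.1 hyW.2.2.2
      have k1 : ContDiffAt ℝ ∞ κ.symm z :=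
        κ.contDiffAt_symm hzκ (f₀' := e') (by rw [hφy]; exact he') (by rw [hφy]; exact hGy)
      have k2 : ContMDiffAt 𝓘(ℝ, Plane) (𝓡 2) ∞ φ.symm (κ.symm z) := by
        rw [hφy]
        exact contMDiffAt_symm_of_mem_maximalAtlas (IsManifold.chart_mem_maximalAtlas p)
          (φ.map_source hyW.2.1)
      exact (ContMDiffAt.comp z k2 k1.contMDiffAt).contMDiffWithinAt
  · change p ∈ ψ.symm.target
    have : p ∈ ψ₀.source ∩ ψ₀ ⁻¹' (Metric.ball 0 r) :=
      ⟨hp0, by rw [mem_preimage, hψ0 p hp0, h.zero]; exact Metric.mem_ball_self hr⟩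
    simpa [ψ] using this

end Coordinates

section Ramp

/-- A smooth step, from `0` for `t ≤ t₁` to `1` for `t ≥ t₂`. -/
def step (t₁ t₂ t : ℝ) : ℝ := Real.smoothTransition ((t - t₁) / (t₂ - t₁))

variable {t₁ t₂ t : ℝ}

lemma contDiff_step : ContDiff ℝ ∞ (step t₁ t₂) :=
  Real.smoothTransition.contDiff.comp ((contDiff_id.sub contDiff_const).div_const _)

lemma step_of_le (h : t₁ < t₂) (ht : t ≤ t₁) : step t₁ t₂ t = 0 :=
  Real.smoothTransition.zero_of_nonpos
    (div_nonpos_of_nonpos_of_nonneg (by linarith) (by linarith))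

lemma step_of_ge (h : t₁ < t₂) (ht : t₂ ≤ t) : step t₁ t₂ t = 1 :=
  Real.smoothTransition.one_of_one_le ((one_le_div (by linarith)).2 (by linarith))

lemma step_nonneg : 0 ≤ step t₁ t₂ t := Real.smoothTransition.nonneg _

lemma step_le_one : step t₁ t₂ t ≤ 1 := Real.smoothTransition.le_one _

lemma step_monotone (h : t₁ < t₂) : Monotone (step t₁ t₂) := fun a b hab =>
  Real.smoothTransition.monotone (div_le_div_of_nonneg_right (by linarith) (by linarith))

/-- A smooth nondecreasing function, equal to `t` for `t ≤ t₁` and to `t₂` for `t ≥ t₂`. -/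
def ramp (t₁ t₂ t : ℝ) : ℝ := t + (t₂ - t) * step t₁ t₂ t

lemma contDiff_ramp : ContDiff ℝ ∞ (ramp t₁ t₂) :=
  contDiff_id.add ((contDiff_const.sub contDiff_id).mul contDiff_step)

lemma ramp_of_le (h : t₁ < t₂) (ht : t ≤ t₁) : ramp t₁ t₂ t = t := by
  simp [ramp, step_of_le h ht]

lemma ramp_of_ge (h : t₁ < t₂) (ht : t₂ ≤ t) : ramp t₁ t₂ t = t₂ := by
  simp [ramp, step_of_ge h ht]

lemma le_ramp (h : t₁ < t₂) (ht : t₁ ≤ t) : t₁ ≤ ramp t₁ t₂ t := by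
  rcases le_total t t₂ with h2 | h2
  · have := step_nonneg (t₁ := t₁) (t₂ := t₂) (t := t)
    unfold ramp; nlinarith
  · rw [ramp_of_ge h h2]; exact h.le

lemma deriv_ramp_nonneg (h : t₁ < t₂) (t : ℝ) : 0 ≤ deriv (ramp t₁ t₂) t := by
  rcases le_total t₂ t with h2 | h2
  · rcases eq_or_lt_of_le h2 with rfl | h2
    · have h3 : HasDerivAt (ramp t₁ t₂) (1 + ((0 - 1) * step t₁ t₂ t₂ +
          (t₂ - t₂) * deriv (step t₁ t₂) t₂)) t₂ := by
        refine (hasDerivAt_id t₂).add (((hasDerivAt_const _ _).sub (hasDerivAt_id t₂)).mul ?_)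
        exact ((contDiff_step.differentiable (by simp)) _).hasDerivAt
      rw [h3.deriv, step_of_ge h le_rfl]
      simp
    · have : ramp t₁ t₂ =ᶠ[𝓝 t] fun _ => t₂ := by
        filter_upwards [lt_mem_nhds h2] with z hz using ramp_of_ge h hz.le
      rw [this.deriv_eq]; simp
  · have h3 : HasDerivAt (ramp t₁ t₂) (1 + ((0 - 1) * step t₁ t₂ t +
        (t₂ - t) * deriv (step t₁ t₂) t)) t := by
      refine (hasDerivAt_id t).add (((hasDerivAt_const _ _).sub (hasDerivAt_id t)).mul ?_)
      exact ((contDiff_step.differentiable (by simp)) _).hasDerivAt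
    rw [h3.deriv]
    have h4 : 0 ≤ deriv (step t₁ t₂) t := (step_monotone h).deriv_nonneg
    have h5 := step_le_one (t₁ := t₁) (t₂ := t₂) (t := t)
    nlinarith [mul_nonneg (sub_nonneg.2 h2) h4]

lemma deriv_ramp_of_lt (h : t₁ < t₂) (ht : t < t₁) : deriv (ramp t₁ t₂) t = 1 := by
  have : ramp t₁ t₂ =ᶠ[𝓝 t] id := by
    filter_upwards [gt_mem_nhds ht] with z hz using ramp_of_le h hz.le
  rw [this.deriv_eq]; simp

lemma hasDerivAt_ramp : HasDerivAt (ramp t₁ t₂) (deriv (ramp t₁ t₂) t) t :=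
  ((contDiff_ramp.differentiable (by simp)) t).hasDerivAt

end Ramp

section Disc

variable {C : Type*} [TopologicalSpace C] [ChartedSpace Plane C] [IsManifold (𝓡 2) ∞ C]

/-- A disk `{s < t}` around `p`, contained in `O`, on which `f` is a positive coordinate system
with `‖f‖² = s`; the function `s` is smooth on the whole surface. -/
structure Disc (oC : SurfaceOrientation C) (f : C → Plane) (p : C) (O : Set C) where
  s : C → ℝ
  t : ℝ
  inv : Plane → C
  t_pos : 0 < t
  smooth : ContMDiff (𝓡 2) 𝓘(ℝ, ℝ) ∞ s
  zero : s p = 0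
  subset : ∀ y, s y < t → y ∈ O
  eq : ∀ y, s y < t → s y = ‖f y‖ ^ 2
  smooth_f : ∀ y, s y < t → SmoothNear (𝓡 2) 𝓘(ℝ, Plane) f y
  pos : ∀ y, s y < t → PosForm oC (area (𝓡 2) f) y
  inv_f : ∀ y, s y < t → inv (f y) = y
  inv_mem : ∀ q, ‖q‖ ^ 2 < t → s (inv q) < t ∧ f (inv q) = q
  inv_cont : ContinuousOn inv {q | ‖q‖ ^ 2 < t}
  grad : ∀ y, dR (𝓡 2) s y = 0 ∨
    (y ∈ O ∧ ∃ c : ℝ, 0 ≤ c ∧ dR (𝓡 2) s y = c • dR (𝓡 2) (fun z => ‖f z‖ ^ 2) y)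

variable {oC : SurfaceOrientation C} {f : C → Plane} {p : C} {O : Set C}

lemma IsCoord.exists_disc [T2Space C] (h : IsCoord oC f p) (hO : O ∈ 𝓝 p) :
    Nonempty (Disc oC f p O) := by
  obtain ⟨r, hr, H⟩ := h.exists_chart hO
  obtain ⟨ψ, -, hp, hsub, htgt, hψ⟩ := H r hr le_rfl
  set a := r ^ 2 / 3 with ha
  have ha0 : 0 < a := by positivity
  have hab : a < 2 * a := by linarith
  have hnorm : ∀ y ∈ ψ.source, ‖f y‖ ^ 2 < 3 * a := fun y hy => by
    have := ψ.map_source hy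
    rw [htgt, mem_ball_zero_iff, (hψ y hy).1] at this
    rw [ha]; nlinarith [norm_nonneg (f y)]
  have hmemt : ∀ q : Plane, ‖q‖ ^ 2 < 3 * a → q ∈ ψ.target := fun q hq => by
    rw [htgt, mem_ball_zero_iff]
    refine lt_of_pow_lt_pow_left₀ 2 hr.le ?_
    rw [ha] at hq; linarith
  classical
  let s : C → ℝ := fun y => if y ∈ ψ.source then ramp a (2 * a) (‖f y‖ ^ 2) else 2 * a
  have hs1 : ∀ y ∈ ψ.source, s y = ramp a (2 * a) (‖f y‖ ^ 2) := fun y hy => if_pos hy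
  have hs1' : ∀ y ∈ ψ.source, s =ᶠ[𝓝 y] fun z => ramp a (2 * a) (‖f z‖ ^ 2) := fun y hy => by
    filter_upwards [ψ.open_source.mem_nhds hy] with z hz using hs1 z hz
  have hs2' : ∀ y, y ∉ ψ.source → s =ᶠ[𝓝 y] fun _ => 2 * a := by
    intro y hy
    have hK : IsCompact (ψ.symm '' Metric.closedBall 0 (Real.sqrt (2 * a))) := by
      refine (ProperSpace.isCompact_closedBall _ _).image_of_continuousOn
        (ψ.continuousOn_symm.mono fun q hq => hmemt q ?_)
      rw [mem_closedBall_zero_iff] at hq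
      have := pow_le_pow_left₀ (norm_nonneg q) hq 2
      rw [Real.sq_sqrt (by positivity)] at this
      linarith
    have hyK : y ∉ ψ.symm '' Metric.closedBall 0 (Real.sqrt (2 * a)) := by
      rintro ⟨q, hq, rfl⟩
      refine hy (ψ.map_target (hmemt q ?_))
      rw [mem_closedBall_zero_iff] at hq
      have := pow_le_pow_left₀ (norm_nonneg q) hq 2
      rw [Real.sq_sqrt (by positivity)] at this
      linarith
    filter_upwards [hK.isClosed.isOpen_compl.mem_nhds hyK] with z hz
    by_cases hzs : z ∈ ψ.source
    · rw [hs1 z hzs]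
      refine ramp_of_ge hab ?_
      by_contra hlt
      push Not at hlt
      refine hz ⟨ψ z, ?_, ψ.left_inv hzs⟩
      rw [mem_closedBall_zero_iff, (hψ z hzs).1]
      exact Real.le_sqrt_of_sq_le hlt.le
    · exact if_neg hzs
  have hlt : ∀ y, s y < a → y ∈ ψ.source ∧ ‖f y‖ ^ 2 < a := by
    intro y hy
    by_cases hys : y ∈ ψ.source
    · refine ⟨hys, ?_⟩
      by_contra hge
      push Not at hge
      rw [hs1 y hys] at hy
      exact absurd (le_ramp hab hge) (not_le.2 hy)
    · rw [(hs2' y hys).self_of_nhds] at hy; linarith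
  refine ⟨{ s := s, t := a, inv := ψ.symm, t_pos := ha0, smooth := ?smooth, zero := ?zero, subset := ?subset, eq := ?eq, smooth_f := ?smooth_f, pos := ?pos, inv_f := ?inv_f, inv_mem := ?inv_mem, inv_cont := ?inv_cont, grad := ?grad }⟩
  case smooth =>
    intro y
    by_cases hy : y ∈ ψ.source
    · exact ((((hψ y hy).2.1.normSq).comp_contDiff contDiff_ramp).congr (hs1' y hy)).self
    · exact contMDiffAt_const.congr_of_eventuallyEq (hs2' y hy)
  case zero => rw [hs1 p hp, h.zero]; simp [ramp_of_le hab ha0.le]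
  case subset => exact fun y hy => hsub (hlt y hy).1
  case eq => exact fun y hy => by rw [hs1 y (hlt y hy).1, ramp_of_le hab (hlt y hy).2.le]
  case smooth_f => exact fun y hy => (hψ y (hlt y hy).1).2.1
  case pos => exact fun y hy => (hψ y (hlt y hy).1).2.2
  case inv_f => exact fun y hy => by rw [← (hψ y (hlt y hy).1).1, ψ.left_inv (hlt y hy).1]
  case inv_mem =>
    intro q hq
    have hqt := hmemt q (by linarith)
    have hqs := ψ.map_target hqt
    have e : f (ψ.symm q) = q := by rw [← (hψ _ hqs).1, ψ.right_inv hqt]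
    refine ⟨?_, e⟩
    rw [hs1 _ hqs, e, ramp_of_le hab hq.le]; exact hq
  case inv_cont =>
    refine ψ.continuousOn_symm.mono fun q hq => hmemt q ?_
    have : ‖q‖ ^ 2 < a := hq
    linarith
  case grad =>
    intro y
    by_cases hy : y ∈ ψ.source
    · refine Or.inr ⟨hsub hy, deriv (ramp a (2 * a)) (‖f y‖ ^ 2), deriv_ramp_nonneg hab _, ?_⟩
      rw [dR_congr (hs1' y hy), dR_comp hasDerivAt_ramp (hψ y hy).2.1.normSq.mdiff]
    · exact Or.inl (by rw [dR_congr (hs2' y hy), dR_const])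

lemma Disc.isOpen (D : Disc oC f p O) (t : ℝ) : IsOpen {y | D.s y < t} :=
  isOpen_lt D.smooth.continuous continuous_const

lemma Disc.mem (D : Disc oC f p O) : D.s p < D.t := by rw [D.zero]; exact D.t_pos

lemma Disc.mem_nhds (D : Disc oC f p O) {t : ℝ} (ht : 0 < t) : {y | D.s y < t} ∈ 𝓝 p :=
  (D.isOpen t).mem_nhds (by simpa [D.zero] using ht)

lemma Disc.f_zero (D : Disc oC f p O) : f p = 0 := by
  have := D.eq p D.mem
  rw [D.zero] at this
  simpa using this.symm

lemma Disc.eq_of_f_eq (D : Disc oC f p O) {y z : C} (hy : D.s y < D.t) (hz : D.s z < D.t)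
    (h : f y = f z) : y = z := by rw [← D.inv_f y hy, ← D.inv_f z hz, h]

lemma Disc.s_pos (D : Disc oC f p O) {y : C} (hy : y ≠ p) : 0 < D.s y := by
  rcases lt_or_ge (D.s y) D.t with h | h
  · rw [D.eq y h]
    have : f y ≠ 0 := fun h0 => hy (D.eq_of_f_eq h D.mem (h0.trans D.f_zero.symm))
    positivity
  · exact D.t_pos.trans_le h

lemma Disc.f_ne_zero (D : Disc oC f p O) {y : C} (h : D.s y < D.t) (hy : y ≠ p) : f y ≠ 0 :=
  fun h0 => hy (D.eq_of_f_eq h D.mem (h0.trans D.f_zero.symm))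

end Disc

section Angular

variable {E : Type*} [NormedAddCommGroup E] [NormedSpace ℝ E]
  {H : Type*} [TopologicalSpace H] {I : ModelWithCorners ℝ E H}
  {M : Type*} [TopologicalSpace M] [ChartedSpace H M] {f g : M → Plane} {x : M}

/-- The angular form `dθ` in the polar coordinates given by `f`. -/
def ang (I : ModelWithCorners ℝ E H) (f : M → Plane) : OneForm I M :=
  fun y => (‖f y‖ ^ 2)⁻¹ • rot I f y

lemma repAt_ang (hf : SmoothNear I 𝓘(ℝ, Plane) f x) (h0 : f x ≠ 0) : RepAt (ang I f) x :=
  (repAt_rot hf).fsmul (hf.normSq.inv (by positivity))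

lemma dR_sq {h : M → ℝ} (hh : MDifferentiableAt I 𝓘(ℝ, ℝ) h x) :
    dR I (fun y => h y ^ 2) x = (2 * h x) • dR I h x := by
  simpa using dR_comp (φ := fun t => t ^ 2) (hasDerivAt_pow 2 (h x)) hh

lemma dR_normSq (hf : SmoothNear I 𝓘(ℝ, Plane) f x) :
    dR I (fun y => ‖f y‖ ^ 2) x =
      (2 * f x 0) • dR I (co f 0) x + (2 * f x 1) • dR I (co f 1) x := by
  have e : (fun y => ‖f y‖ ^ 2) = fun y => co f 0 y ^ 2 + co f 1 y ^ 2 :=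
    funext fun y => plane_norm_sq _
  have h0 : SmoothNear I 𝓘(ℝ, ℝ) (fun y => co f 0 y ^ 2) x := by
    simpa only [pow_two] using (hf.co 0).mul (hf.co 0)
  have h1 : SmoothNear I 𝓘(ℝ, ℝ) (fun y => co f 1 y ^ 2) x := by
    simpa only [pow_two] using (hf.co 1).mul (hf.co 1)
  rw [e, dR_add h0.mdiff h1.mdiff, dR_sq (hf.co 0).mdiff, dR_sq (hf.co 1).mdiff]
  rfl

lemma dR_inv {h : M → ℝ} (hh : MDifferentiableAt I 𝓘(ℝ, ℝ) h x) (h0 : h x ≠ 0) :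
    dR I (fun y => (h y)⁻¹) x = (-(h x ^ 2)⁻¹) • dR I h x :=
  dR_comp (φ := fun t => t⁻¹) (hasDerivAt_inv h0) hh

lemma wedge_dR_normSq_rot (hf : SmoothNear I 𝓘(ℝ, Plane) f x) :
    wedge (dR I (fun y => ‖f y‖ ^ 2) x) (rot I f x) = (2 * ‖f x‖ ^ 2) • area I f x := by
  rw [dR_normSq hf]
  refine alt_two_ext fun u w => ?_
  simp only [ContinuousAlternatingMap.smul_apply, area, rot, wedge_apply, smul_eq_mul,
    add_apply, sub_apply, smul_apply, plane_norm_sq]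
  ring

lemma extd_ang [IsManifold I ∞ M] [I.Boundaryless] (hf : SmoothNear I 𝓘(ℝ, Plane) f x)
    (h0 : f x ≠ 0) : extd (ang I f) x = 0 := by
  have hn : ‖f x‖ ^ 2 ≠ 0 := by positivity
  refine (extd_fsmul (hf.normSq.inv hn) (repAt_rot hf)).trans ?_
  rw [dR_inv hf.normSq.mdiff hn, extd_rot hf]
  refine alt_two_ext fun u w => ?_
  have := congrArg (fun F => F ![u, w]) (wedge_dR_normSq_rot hf)
  simp only [ContinuousAlternatingMap.smul_apply, ContinuousAlternatingMap.add_apply, wedge_apply,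
    smul_eq_mul, smul_apply] at this ⊢
  change _ = (0 : ℝ)
  field_simp
  linear_combination -this

lemma dR_arctan_div {w0 w1 : M → ℝ} (h0 : SmoothNear I 𝓘(ℝ, ℝ) w0 x)
    (h1 : SmoothNear I 𝓘(ℝ, ℝ) w1 x) (hpos : w0 x ≠ 0) :
    dR I (fun y => Real.arctan (w1 y * (w0 y)⁻¹)) x =
      (w0 x ^ 2 + w1 x ^ 2)⁻¹ • (w0 x • dR I w1 x - w1 x • dR I w0 x) := by
  rw [dR_comp (Real.hasDerivAt_arctan _) (h1.mul (h0.inv hpos)).mdiff,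
    dR_mul h1.mdiff (h0.inv hpos).mdiff, dR_inv h0.mdiff hpos]
  ext u
  have : w0 x ^ 2 + w1 x ^ 2 ≠ 0 := by positivity
  simp only [smul_apply, add_apply, sub_apply, smul_eq_mul]
  field_simp
  ring

/-- The real part of `g * conj (a * f)`. -/
def reQuot (a : Plane) (f g : M → Plane) (y : M) : ℝ :=
  a 0 * (g y 0 * f y 0 + g y 1 * f y 1) + a 1 * (g y 1 * f y 0 - g y 0 * f y 1)

/-- The imaginary part of `g * conj (a * f)`. -/
def imQuot (a : Plane) (f g : M → Plane) (y : M) : ℝ :=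
  a 0 * (g y 1 * f y 0 - g y 0 * f y 1) - a 1 * (g y 0 * f y 0 + g y 1 * f y 1)

/-- The angle from `a * f` to `g`. -/
def angle (a : Plane) (f g : M → Plane) (y : M) : ℝ :=
  Real.arctan (imQuot a f g y * (reQuot a f g y)⁻¹)

lemma smoothNear_reQuot (a : Plane) (hf : SmoothNear I 𝓘(ℝ, Plane) f x)
    (hg : SmoothNear I 𝓘(ℝ, Plane) g x) : SmoothNear I 𝓘(ℝ, ℝ) (reQuot a f g) x :=
  ((smoothNear_const (a 0) x).mul (((hg.co 0).mul (hf.co 0)).add ((hg.co 1).mul (hf.co 1)))).add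
    ((smoothNear_const (a 1) x).mul (((hg.co 1).mul (hf.co 0)).sub ((hg.co 0).mul (hf.co 1))))

lemma smoothNear_imQuot (a : Plane) (hf : SmoothNear I 𝓘(ℝ, Plane) f x)
    (hg : SmoothNear I 𝓘(ℝ, Plane) g x) : SmoothNear I 𝓘(ℝ, ℝ) (imQuot a f g) x :=
  ((smoothNear_const (a 0) x).mul (((hg.co 1).mul (hf.co 0)).sub ((hg.co 0).mul (hf.co 1)))).sub
    ((smoothNear_const (a 1) x).mul (((hg.co 0).mul (hf.co 0)).add ((hg.co 1).mul (hf.co 1))))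

lemma smoothNear_angle {a : Plane} (hf : SmoothNear I 𝓘(ℝ, Plane) f x)
    (hg : SmoothNear I 𝓘(ℝ, Plane) g x) (h : reQuot a f g x ≠ 0) :
    SmoothNear I 𝓘(ℝ, ℝ) (angle a f g) x :=
  ((smoothNear_imQuot a hf hg).mul ((smoothNear_reQuot a hf hg).inv h)).comp_contDiff
    Real.contDiff_arctan

lemma dR_angle {a : Plane} (hf : SmoothNear I 𝓘(ℝ, Plane) f x)
    (hg : SmoothNear I 𝓘(ℝ, Plane) g x) (h : reQuot a f g x ≠ 0) :
    dR I (angle a f g) x = ang I g x - ang I f x := by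
  have hre := smoothNear_reQuot a hf hg
  have him := smoothNear_imQuot a hf hg
  refine (dR_arctan_div hre him h).trans ?_
  have c : ∀ t : ℝ, SmoothNear I 𝓘(ℝ, ℝ) (fun _ => t) x := fun t => smoothNear_const t x
  have dc : ∀ (t : ℝ) {k : M → ℝ}, SmoothNear I 𝓘(ℝ, ℝ) k x →
      dR I (fun y => t * k y) x = t • dR I k x := fun t k hk => by
    rw [dR_mul (c t).mdiff hk.mdiff, dR_const]; simp
  have m : ∀ i j, SmoothNear I 𝓘(ℝ, ℝ) (fun y => co g i y * co f j y) x :=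
    fun i j => (hg.co i).mul (hf.co j)
  have dm : ∀ i j, dR I (fun y => co g i y * co f j y) x =
      g x i • dR I (co f j) x + f x j • dR I (co g i) x := fun i j =>
    dR_mul (hg.co i).mdiff (hf.co j).mdiff
  have d1 : dR I (reQuot a f g) x =
      a 0 • (dR I (fun y => co g 0 y * co f 0 y) x + dR I (fun y => co g 1 y * co f 1 y) x) +
      a 1 • (dR I (fun y => co g 1 y * co f 0 y) x - dR I (fun y => co g 0 y * co f 1 y) x) := by
    rw [← dR_add (m 0 0).mdiff (m 1 1).mdiff, ← dR_sub (m 1 0).mdiff (m 0 1).mdiff,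
      ← dc _ ((m 0 0).add (m 1 1)), ← dc _ ((m 1 0).sub (m 0 1)),
      ← dR_add ((c _).mul ((m 0 0).add (m 1 1))).mdiff ((c _).mul ((m 1 0).sub (m 0 1))).mdiff]
    rfl
  have d2 : dR I (imQuot a f g) x =
      a 0 • (dR I (fun y => co g 1 y * co f 0 y) x - dR I (fun y => co g 0 y * co f 1 y) x) -
      a 1 • (dR I (fun y => co g 0 y * co f 0 y) x + dR I (fun y => co g 1 y * co f 1 y) x) := by
    rw [← dR_add (m 0 0).mdiff (m 1 1).mdiff, ← dR_sub (m 1 0).mdiff (m 0 1).mdiff,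
      ← dc _ ((m 0 0).add (m 1 1)), ← dc _ ((m 1 0).sub (m 0 1)),
      ← dR_sub ((c _).mul ((m 1 0).sub (m 0 1))).mdiff ((c _).mul ((m 0 0).add (m 1 1))).mdiff]
    rfl
  have hn : reQuot a f g x ^ 2 + imQuot a f g x ^ 2 =
      (a 0 ^ 2 + a 1 ^ 2) * ((f x 0 ^ 2 + f x 1 ^ 2) * (g x 0 ^ 2 + g x 1 ^ 2)) := by
    simp only [reQuot, imQuot]; ring
  have hne : reQuot a f g x ^ 2 + imQuot a f g x ^ 2 ≠ 0 := by positivity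
  rw [hn] at hne
  have ha : a 0 ^ 2 + a 1 ^ 2 ≠ 0 := left_ne_zero_of_mul hne
  have hf0 : f x 0 ^ 2 + f x 1 ^ 2 ≠ 0 := left_ne_zero_of_mul (right_ne_zero_of_mul hne)
  have hg0 : g x 0 ^ 2 + g x 1 ^ 2 ≠ 0 := right_ne_zero_of_mul (right_ne_zero_of_mul hne)
  rw [hn, d1, d2]
  simp only [dm, ang, rot, plane_norm_sq, reQuot, imQuot]
  ext u
  simp only [smul_apply, add_apply, sub_apply, smul_eq_mul]
  generalize dR I (co f 0) x u = F0
  generalize dR I (co f 1) x u = F1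
  generalize dR I (co g 0) x u = G0
  generalize dR I (co g 1) x u = G1
  rw [inv_mul_eq_div, inv_mul_eq_div, inv_mul_eq_div, div_sub_div _ _ hg0 hf0,
    div_eq_div_iff hne (mul_ne_zero hg0 hf0)]
  ring

end Angular

section Coordinates

variable {C : Type*} [TopologicalSpace C] [ChartedSpace Plane C] [IsManifold (𝓡 2) ∞ C]
  {oC : SurfaceOrientation C} {f f' : C → Plane} {p p' : C}

lemma exists_isCoord (oC : SurfaceOrientation C) (p : C) : ∃ f, IsCoord oC f p := by
  obtain ⟨u, w, b, hu, hw, hb⟩ := exists_posPair_tangent oC p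
  let b' : Module.Basis (Fin 2) ℝ Plane := b
  let T : Plane →L[ℝ] Plane := LinearMap.toContinuousLinearMap
    (b'.constr ℝ ![(EuclideanSpace.single 0 1 : Plane), EuclideanSpace.single 1 1])
  have hT : ∀ i, T (b' i) = ![(EuclideanSpace.single 0 1 : Plane), EuclideanSpace.single 1 1] i :=
    fun i => b'.constr_basis ℝ _ i
  let S : Plane →L[ℝ] Plane :=
    mfderiv 𝓘(ℝ, Plane) (𝓡 2) (extChartAt (𝓡 2) p).symm (extChartAt (𝓡 2) p p)
  let φ : C → Plane := extChartAt (𝓡 2) p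
  have hφ : SmoothNear (𝓡 2) 𝓘(ℝ, Plane) φ p := smoothNear_extChartAt (mem_chart_source _ _)
  let f : C → Plane := fun y => T (S (φ y - φ p))
  have hf : SmoothNear (𝓡 2) 𝓘(ℝ, Plane) f p :=
    (hφ.sub (smoothNear_const _ _)).comp_contDiff (T.comp S).contDiff
  have hD : ∀ v : TangentSpace (𝓡 2) p, planeDeriv (𝓡 2) f p v = T v := by
    intro v
    have h1 : HasFDerivAt (fun z : Plane => T (S (z - φ p))) (T.comp S) (φ p) := by
      have := (T.comp S).hasFDerivAt.comp (φ p) ((hasFDerivAt_id (𝕜 := ℝ) (φ p)).sub_const (φ p))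
      exact this
    have h2 := (HasMFDerivAt.comp p h1.hasMFDerivAt hφ.mdiff.hasMFDerivAt).mfderiv
    have h3 : planeDeriv (𝓡 2) f p v = T (S (mfderiv (𝓡 2) 𝓘(ℝ, Plane) φ p v)) :=
      DFunLike.congr_fun h2 v
    exact h3.trans (congrArg T (mfderiv_extChartAt_symm_self_apply (I := 𝓡 2) p v))
  refine ⟨f, hf, by simp [f], posForm_of_posPair ⟨b, hu, hw, hb⟩ ?_⟩
  rw [area_apply hf.mdiff, hD, hD, ← hu, ← hw]
  have e0 := hT 0
  have e1 := hT 1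
  change T (b 0) = _ at e0
  change T (b 1) = _ at e1
  rw [e0, e1]
  simp [stdArea]

lemma inner_conformal_part (L : Plane →L[ℝ] Plane) (z : Plane) {A B C D : ℝ}
    (h0 : L (EuclideanSpace.single 0 1) = !₂[A, C]) (h1 : L (EuclideanSpace.single 1 1) = !₂[B, D])
    : (A + D) * (L z 0 * z 0 + L z 1 * z 1) + (C - B) * (L z 1 * z 0 - L z 0 * z 1) =
      ‖L z‖ ^ 2 + (A * D - B * C) * ‖z‖ ^ 2 := by
  rw [plane_norm_sq, plane_norm_sq, clm_plane_apply L z, h0, h1]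
  simp
  ring

/-- Two positive coordinate systems centered at `p` have, up to a constant angle, nearly equal
polar angles. -/
lemma IsCoord.exists_reQuot_pos (h : IsCoord oC f p) (h' : IsCoord oC f' p) :
    ∃ a : Plane, ∀ᶠ y in 𝓝 p, y ≠ p → 0 < reQuot a f f' y := by
  set φ := chartAt Plane p with hφ
  have hp : p ∈ φ.source := mem_chart_source _ _
  obtain ⟨-, hD⟩ := hasFDerivAt_chart hp h.smooth
  obtain ⟨-, hD'⟩ := hasFDerivAt_chart hp h'.smooth
  obtain ⟨-, e, he⟩ := exists_hasFDerivAt_equiv (oC := oC) hp h.smooth h.pos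
  obtain ⟨-, e', he'⟩ := exists_hasFDerivAt_equiv (oC := oC) hp h'.smooth h'.pos
  rw [he.fderiv] at hD
  rw [he'.fderiv] at hD'
  let L : Plane →L[ℝ] Plane := (e' : Plane →L[ℝ] Plane).comp (e.symm : Plane →L[ℝ] Plane)
  have hLe : ∀ v, L (e v) = e' v := fun v => by simp [L]
  obtain ⟨A, C, hAC⟩ : ∃ A C, L (EuclideanSpace.single 0 1) = !₂[A, C] :=
    ⟨_, _, by ext i; fin_cases i <;> rfl⟩
  obtain ⟨B, D, hBD⟩ : ∃ B D, L (EuclideanSpace.single 1 1) = !₂[B, D] :=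
    ⟨_, _, by ext i; fin_cases i <;> rfl⟩
  have hdet : 0 < A * D - B * C := by
    obtain ⟨u', w', h1, h2⟩ : ∃ u' w' : Plane, 0 < stdArea (e u') (e w') ∧
        0 < stdArea (e' u') (e' w') := by
      obtain ⟨u, w, huw⟩ := exists_posPair_tangent oC p
      have h1 := h.pos u w huw
      have h2 := h'.pos u w huw
      rw [area_apply h.smooth.mdiff, ← hD u, ← hD w] at h1
      rw [area_apply h'.smooth.mdiff, ← hD' u, ← hD' w] at h2
      exact ⟨_, _, h1, h2⟩
    have k : ∀ a b : Plane, stdArea (L a) (L b) = (A * D - B * C) * stdArea a b := fun a b => by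
      rw [clm_plane_apply L a, clm_plane_apply L b, hAC, hBD]
      simp [stdArea]
      ring
    have h3 : stdArea (L (e u')) (L (e w')) = stdArea (e' u') (e' w') := by rw [hLe, hLe]
    rw [k] at h3
    exact pos_of_mul_pos_left (by rw [h3]; exact h2) h1.le
  let a : Plane := !₂[A + D, C - B]
  refine ⟨a, ?_⟩
  set z₀ := φ p
  set F : Plane → Plane := fun z => f (φ.symm z) with hF
  set F' : Plane → Plane := fun z => f' (φ.symm z) with hF'
  have hF0 : F z₀ = 0 := by simp [hF, z₀, φ.left_inv hp, h.zero]
  have hF0' : F' z₀ = 0 := by simp [hF', z₀, φ.left_inv hp, h'.zero]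
  have ho : (fun z => F' z - L (F z)) =o[𝓝 z₀] fun z => z - z₀ := by
    have h1 := he'.sub (L.hasFDerivAt.comp z₀ he)
    have h2 : (e' : Plane →L[ℝ] Plane) - L.comp (e : Plane →L[ℝ] Plane) = 0 := by
      ext1 v; simp [hLe]
    rw [h2] at h1
    have h3 := h1.isLittleO
    simpa [hF0, hF0'] using h3
  have hO : (fun z => z - z₀) =O[𝓝 z₀] F := by
    have h1 := he.isLittleO
    have h2 : (fun z => z - z₀) =O[𝓝 z₀] fun z => e (z - z₀) :=
      (e.isBigO_comp_rev (fun z => z - z₀) (𝓝 z₀))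
    have h3 : (fun z => F z - e (z - z₀)) =o[𝓝 z₀] fun z => e (z - z₀) := by
      refine Asymptotics.IsLittleO.trans_isBigO ?_ h2
      simpa [hF0] using h1
    have h4 := h3.right_isBigO_add
    refine h2.trans ?_
    simpa using h4
  have ho2 := ho.trans_isBigO hO
  set ε := (A * D - B * C) / (2 * (‖a‖ + 1)) with hε
  have hε0 : 0 < ε := by positivity
  have hz := ho2.def hε0
  have hne : ∀ᶠ z in 𝓝 z₀, z ≠ z₀ → F z ≠ 0 := by
    obtain ⟨c, hc⟩ := hO.bound
    filter_upwards [hc] with z h1 h2 h3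
    rw [h3, norm_zero, mul_zero] at h1
    exact h2 (sub_eq_zero.1 (norm_le_zero_iff.1 h1))
  have hcont : ContinuousAt φ p := φ.continuousAt hp
  filter_upwards [hcont.eventually hz, hcont.eventually hne, φ.open_source.mem_nhds hp] with
    y h1 h2 hy hyp
  have hFy : F (φ y) = f y := by simp [hF, φ.left_inv hy]
  have hFy' : F' (φ y) = f' y := by simp [hF', φ.left_inv hy]
  have h3 : f y ≠ 0 := by
    rw [← hFy]; exact h2 fun h => hyp (φ.injOn hy hp h)
  rw [hFy, hFy'] at h1
  set z := f y
  set r := f' y - L z with hr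
  have key := inner_conformal_part L z hAC hBD
  have hfr : f' y = L z + r := by simp [hr]
  let az : Plane := !₂[a 0 * z 0 - a 1 * z 1, a 0 * z 1 + a 1 * z 0]
  have haz : ‖az‖ = ‖a‖ * ‖z‖ := by
    have : ‖az‖ ^ 2 = (‖a‖ * ‖z‖) ^ 2 := by
      rw [mul_pow, plane_norm_sq, plane_norm_sq, plane_norm_sq]; simp [az]; ring
    exact (pow_left_inj₀ (norm_nonneg _) (by positivity) two_ne_zero).1 this
  have hre : reQuot a f f' y = (‖L z‖ ^ 2 + (A * D - B * C) * ‖z‖ ^ 2) + inner ℝ r az := by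
    rw [← key]
    simp only [reQuot, hfr, PiLp.inner_apply, Fin.sum_univ_two]
    simp [az, a, z]
    ring
  have hin : |inner ℝ r az| ≤ ε * ‖z‖ * (‖a‖ * ‖z‖) := by
    refine (abs_real_inner_le_norm _ _).trans ?_
    rw [haz]
    gcongr
  have h5 : ε * ‖a‖ < A * D - B * C := by
    rw [hε, div_mul_eq_mul_div, div_lt_iff₀ (by positivity)]
    nlinarith [norm_nonneg a]
  have h6 : 0 < ‖z‖ := norm_pos_iff.2 h3
  have h7 := neg_le_of_abs_le hin
  rw [hre]
  nlinarith [mul_pos (sub_pos.2 h5) (pow_pos h6 2), sq_nonneg ‖L z‖]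

end Coordinates

section Pole

variable {C : Type*} [TopologicalSpace C] [ChartedSpace Plane C] [IsManifold (𝓡 2) ∞ C]
  {oC : SurfaceOrientation C} {f f' : C → Plane} {p p' : C} {b : FormField (𝓡 2) C 2}

/-- `R` is a primitive of `-b` off `p`, with the singularity of the angular form of `f` at `p`. -/
structure IsPole (b : FormField (𝓡 2) C 2) (p : C) (f : C → Plane) (R : OneForm (𝓡 2) C) :
    Prop where
  repAt : ∀ y, y ≠ p → RepAt R y
  extd_eq : ∀ y, y ≠ p → extd R y = -b y
  repAt_sub : RepAt (R - ang (𝓡 2) f) p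
  extd_sub_eq : extd (R - ang (𝓡 2) f) p = -b p

lemma smoothNear_step {s : C → ℝ} (hs : ContMDiff (𝓡 2) 𝓘(ℝ, ℝ) ∞ s) (s₁ s₂ : ℝ) (y : C) :
    SmoothNear (𝓡 2) 𝓘(ℝ, ℝ) (fun z => step s₁ s₂ (s z)) y :=
  (ContMDiff.smoothNear hs y).comp_contDiff contDiff_step

/-- A form with a pole at `p` can be changed into one with a pole at `p'`, if the angles of `f` and
`f'` are comparable on an annulus around `p` and `p'`. -/
lemma IsPole.transfer {R : OneForm (𝓡 2) C} (hR : IsPole b p f R) {W : Set C} {s : C → ℝ}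
    {s₁ s₂ : ℝ} {a : Plane} (hs : ContMDiff (𝓡 2) 𝓘(ℝ, ℝ) ∞ s) (h12 : s₁ < s₂)
    (hsW : ∀ y, y ∉ W → s₂ < s y) (hf : ∀ y ∈ W, SmoothNear (𝓡 2) 𝓘(ℝ, Plane) f y)
    (hf' : ∀ y ∈ W, SmoothNear (𝓡 2) 𝓘(ℝ, Plane) f' y) (hp : p ∈ W) (hp' : p' ∈ W)
    (hsp : s p < s₁) (hsp' : s p' < s₁) (h0 : ∀ y ∈ W, y ≠ p → f y ≠ 0)
    (h0' : ∀ y ∈ W, y ≠ p' → f' y ≠ 0) (hre : ∀ y ∈ W, s₁ ≤ s y → 0 < reQuot a f f' y) :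
    ∃ R', IsPole b p' f' R' := by
  let θ : OneForm (𝓡 2) C := ang (𝓡 2) f' - ang (𝓡 2) f
  let T : C → ℝ := fun y => step s₁ s₂ (s y)
  have hT : ∀ y, SmoothNear (𝓡 2) 𝓘(ℝ, ℝ) T y := smoothNear_step hs _ _
  have hT1 : ∀ y, SmoothNear (𝓡 2) 𝓘(ℝ, ℝ) (fun z => 1 - T z) y :=
    fun y => (smoothNear_const 1 y).sub (hT y)
  let g := angle a f f'
  let κ : OneForm (𝓡 2) C := (fun y => (1 - T y) • θ y) - fun y => g y • dR (𝓡 2) T y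
  let R' : OneForm (𝓡 2) C := R + κ
  have hpos : ∀ y, y ∈ W → s₁ ≤ s y → y ≠ p ∧ y ≠ p' := fun y _ h =>
    ⟨by rintro rfl; linarith, by rintro rfl; linarith⟩
  have hout : ∀ y, y ∉ W → RepAt R' y ∧ extd R' y = -b y := by
    intro y hy
    have hyp : y ≠ p := by rintro rfl; exact hy hp
    have hTy : ∀ᶠ z in 𝓝 y, T z = 1 := by
      filter_upwards [hs.continuous.continuousAt.eventually (lt_mem_nhds (hsW y hy))] with z hz
      exact step_of_ge h12 hz.le
    have e : ∀ᶠ z in 𝓝 y, R' z = R z := by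
      filter_upwards [hTy.eventually_nhds] with z hz
      have h1 : dR (𝓡 2) T z = 0 := by
        rw [dR_congr (g := fun _ => (1 : ℝ)) hz, dR_const]
      simp only [R', κ, Pi.add_apply, Pi.sub_apply, h1, hz.self_of_nhds]
      ext u
      simp
    exact ⟨(hR.repAt y hyp).congr e, by rw [extd_congr (hR.repAt y hyp) e, hR.extd_eq y hyp]⟩
  have hmid : ∀ y ∈ W, s₁ ≤ s y → RepAt R' y ∧ extd R' y = -b y := by
    intro y hy hsy
    obtain ⟨hyp, hyp'⟩ := hpos y hy hsy
    have r1 := repAt_ang (hf y hy) (h0 y hy hyp)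
    have r2 := repAt_ang (hf' y hy) (h0' y hy hyp')
    have rθ : RepAt θ y := r2.sub r1
    have hr0 := (hre y hy hsy).ne'
    have rg := smoothNear_angle (hf y hy) (hf' y hy) hr0
    have r3 : RepAt (fun y => (1 - T y) • θ y) y := rθ.fsmul (hT1 y)
    have r4 : RepAt (fun y => g y • dR (𝓡 2) T y) y := repAt_smul_dR rg (hT y)
    refine ⟨(hR.repAt y hyp).add (r3.sub r4), ?_⟩
    have hθ0 : extd θ y = 0 := by
      refine (extd_sub r2 r1).trans ?_
      rw [extd_ang (hf y hy) (h0 y hy hyp), extd_ang (hf' y hy) (h0' y hy hyp'), sub_zero]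
    have hκ : extd κ y = 0 := by
      refine (extd_sub r3 r4).trans ?_
      rw [extd_fsmul (hT1 y) rθ, extd_smul_dR rg (hT y), hθ0, dR_sub (smoothNear_const 1 y).mdiff
        (hT y).mdiff, dR_const, dR_angle (hf y hy) (hf' y hy) hr0]
      refine alt_two_ext fun u w => ?_
      simp only [ContinuousAlternatingMap.sub_apply, ContinuousAlternatingMap.add_apply,
        wedge_apply, sub_apply, smul_zero, zero_sub, neg_apply,
        θ, Pi.sub_apply]
      change _ + (0 : ℝ) - _ = 0
      ring
    refine (extd_add (hR.repAt y hyp) (r3.sub r4)).trans ?_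
    rw [hR.extd_eq y hyp]
    exact (congrArg (fun F => -b y + F) hκ).trans (add_zero _)
  have hin : ∀ y ∈ W, s y < s₁ → RepAt (R' - ang (𝓡 2) f') y ∧
      extd (R' - ang (𝓡 2) f') y = -b y := by
    intro y hy hsy
    have hTy : ∀ᶠ z in 𝓝 y, T z = 0 := by
      filter_upwards [hs.continuous.continuousAt.eventually (gt_mem_nhds hsy)] with z hz
      exact step_of_le h12 (le_of_lt hz)
    have e : ∀ᶠ z in 𝓝 y, (R' - ang (𝓡 2) f') z = (R - ang (𝓡 2) f) z := by
      filter_upwards [hTy.eventually_nhds] with z hz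
      have h1 : dR (𝓡 2) T z = 0 := by
        rw [dR_congr (g := fun _ => (0 : ℝ)) hz, dR_const]
      simp only [R', κ, θ, Pi.add_apply, Pi.sub_apply, h1, hz.self_of_nhds]
      ext u
      simp
      ring
    have hA : RepAt (R - ang (𝓡 2) f) y ∧ extd (R - ang (𝓡 2) f) y = -b y := by
      by_cases hyp : y = p
      · rw [hyp]; exact ⟨hR.repAt_sub, hR.extd_sub_eq⟩
      · have r1 := repAt_ang (hf y hy) (h0 y hy hyp)
        refine ⟨(hR.repAt y hyp).sub r1, ?_⟩
        rw [extd_sub (hR.repAt y hyp) r1, hR.extd_eq y hyp, extd_ang (hf y hy) (h0 y hy hyp)]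
        exact sub_zero _
    exact ⟨hA.1.congr e, by rw [extd_congr hA.1 e, hA.2]⟩
  have hall : ∀ y, y ≠ p' → RepAt R' y ∧ extd R' y = -b y := by
    intro y hyp'
    by_cases hy : y ∈ W
    · rcases le_or_gt s₁ (s y) with h | h
      · exact hmid y hy h
      · obtain ⟨h1, h2⟩ := hin y hy h
        have r2 := repAt_ang (hf' y hy) (h0' y hy hyp')
        have e : R' = (R' - ang (𝓡 2) f') + ang (𝓡 2) f' := (sub_add_cancel _ _).symm
        rw [e]
        refine ⟨h1.add r2, ?_⟩
        rw [extd_add h1 r2, h2, extd_ang (hf' y hy) (h0' y hy hyp')]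
        exact add_zero _
    · exact hout y hy
  exact ⟨R', fun y hy => (hall y hy).1, fun y hy => (hall y hy).2, (hin p' hp' hsp').1,
    (hin p' hp' hsp').2⟩

lemma exists_isPole_self [T2Space C] (h : IsCoord oC f p) :
    ∃ (b : FormField (𝓡 2) C 2) (R : OneForm (𝓡 2) C), IsPole b p f R := by
  classical
  obtain ⟨D⟩ := h.exists_disc (O := univ) Filter.univ_mem
  have h12 : D.t / 3 < 2 * D.t / 3 := by linarith [D.t_pos]
  let T : C → ℝ := fun y => step (D.t / 3) (2 * D.t / 3) (D.s y)
  have hT1 : ∀ y, SmoothNear (𝓡 2) 𝓘(ℝ, ℝ) (fun z => 1 - T z) y :=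
    fun y => (smoothNear_const 1 y).sub (smoothNear_step D.smooth _ _ y)
  let R : OneForm (𝓡 2) C := fun y => (1 - T y) • ang (𝓡 2) f y
  have e : ∀ᶠ z in 𝓝 p, (R - ang (𝓡 2) f) z = (0 : OneForm (𝓡 2) C) z := by
    filter_upwards [D.mem_nhds (t := D.t / 3) (by linarith [D.t_pos])] with z hz
    have hz : D.s z < D.t / 3 := hz
    simp only [R, T, Pi.sub_apply, step_of_le h12 hz.le]
    simp
  refine ⟨fun y => if y = p then 0 else -extd R y, R, fun y hy => ?_, fun y hy => by simp [hy],
    repAt_zero.congr e, ?_⟩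
  · rcases lt_or_ge (D.s y) D.t with h | h
    · exact (repAt_ang (D.smooth_f y h) (D.f_ne_zero h hy)).fsmul (hT1 y)
    · refine (repAt_zero (x := y)).congr ?_
      have : ∀ᶠ z in 𝓝 y, 2 * D.t / 3 < D.s z :=
        D.smooth.continuous.continuousAt.eventually (lt_mem_nhds (by linarith [D.t_pos]))
      filter_upwards [this] with z hz
      simp [R, T, step_of_ge h12 hz.le]
  · rw [extd_congr repAt_zero e, extd_zero]
    simp

lemma IsPole.change [T2Space C] {R : OneForm (𝓡 2) C} (hR : IsPole b p f R) (h : IsCoord oC f p)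
    (h' : IsCoord oC f' p) : ∃ R', IsPole b p f' R' := by
  obtain ⟨a, ha⟩ := h.exists_reQuot_pos h'
  obtain ⟨D⟩ := h.exists_disc (ha.and h'.smooth.eventually)
  have ht := D.t_pos
  have hsub : ∀ y, D.s y < D.t → (y ≠ p → 0 < reQuot a f f' y) ∧
    SmoothNear (𝓡 2) 𝓘(ℝ, Plane) f' y := fun y hy => D.subset y hy
  refine hR.transfer (W := {y | D.s y < D.t}) (s := D.s) (s₁ := D.t / 3) (s₂ := 2 * D.t / 3)
    (a := a) D.smooth (by linarith) ?_ D.smooth_f (fun y hy => (hsub y hy).2) D.mem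
    D.mem (by rw [D.zero]; linarith) (by rw [D.zero]; linarith)
    (fun y hy => D.f_ne_zero hy) ?_ ?_
  · intro y hy
    have : D.t ≤ D.s y := not_lt.1 hy
    linarith
  · intro y hy hyp h0
    have := (hsub y hy).1 hyp
    simp [reQuot, h0] at this
  · intro y hy hsy
    exact (hsub y hy).1 (by rintro rfl; rw [D.zero] at hsy; linarith)

lemma Disc.isCoord_sub {O : Set C} (D : Disc oC f p O) (hp' : D.s p' < D.t) :
    IsCoord oC (fun y => f y - f p') p' := by
  have hs := D.smooth_f p' hp'
  refine ⟨hs.sub (smoothNear_const _ _), sub_self _, ?_⟩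
  have e : area (𝓡 2) (fun y => f y - f p') p' = area (𝓡 2) f p' := by
    have : ∀ i, dR (𝓡 2) (co (fun y => f y - f p') i) p' = dR (𝓡 2) (co f i) p' := fun i => by
      have := dR_sub (hs.co i).mdiff (smoothNear_const (f p' i) p').mdiff
      rw [dR_const, sub_zero] at this
      exact this
    simp only [area, this]
  intro u w huw
  rw [e]
  exact D.pos p' hp' u w huw

lemma Disc.isPole_iff {O : Set C} (D : Disc oC f p O) (hp' : D.s p' < D.t / 3) :
    (∃ R, IsPole b p f R) ↔ ∃ R, IsPole b p' (fun y => f y - f p') R := by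
  have ht := D.t_pos
  have hp't : D.s p' < D.t := by linarith
  have hW : ∀ y, y ∉ {y | D.s y < D.t} → 2 * D.t / 3 < D.s y := fun y hy => by
    have : D.t ≤ D.s y := not_lt.1 hy
    linarith
  have hs : ∀ y ∈ {y | D.s y < D.t}, SmoothNear (𝓡 2) 𝓘(ℝ, Plane) (fun y => f y - f p') y :=
    fun y hy => (D.smooth_f y hy).sub (smoothNear_const _ _)
  have hne : ∀ y ∈ {y | D.s y < D.t}, y ≠ p' → f y - f p' ≠ 0 := fun y hy hyp h0 =>
    hyp (D.eq_of_f_eq hy hp't (sub_eq_zero.1 h0))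
  have hin : ∀ y ∈ {y | D.s y < D.t}, D.t / 3 ≤ D.s y → 0 < inner ℝ (f y - f p') (f y) := by
    intro y hy hsy
    rw [inner_sub_left, real_inner_self_eq_norm_sq]
    have h1 := real_inner_le_norm (f p') (f y)
    have h2 : ‖f p'‖ < ‖f y‖ := by
      refine lt_of_pow_lt_pow_left₀ 2 (norm_nonneg _) ?_
      rw [← D.eq y hy, ← D.eq p' hp't]
      linarith
    nlinarith [norm_nonneg (f p')]
  have e1 : ∀ y, reQuot !₂[1, 0] f (fun y => f y - f p') y = inner ℝ (f y - f p') (f y) := by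
    intro y
    simp [reQuot, PiLp.inner_apply, Fin.sum_univ_two]; ring
  have e2 : ∀ y, reQuot !₂[1, 0] (fun y => f y - f p') f y = inner ℝ (f y - f p') (f y) := by
    intro y
    simp [reQuot, PiLp.inner_apply, Fin.sum_univ_two]
  constructor
  · rintro ⟨R, hR⟩
    exact hR.transfer D.smooth (show D.t / 3 < 2 * D.t / 3 by linarith) hW D.smooth_f
      hs D.mem hp't (by rw [D.zero]; linarith) hp' (fun y hy => D.f_ne_zero hy) hne
      (fun y hy h => by rw [e1]; exact hin y hy h)
  · rintro ⟨R, hR⟩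
    exact hR.transfer D.smooth (show D.t / 3 < 2 * D.t / 3 by linarith) hW hs
      D.smooth_f hp't D.mem hp' (by rw [D.zero]; linarith) hne (fun y hy => D.f_ne_zero hy)
      (fun y hy h => by rw [e2]; exact hin y hy h)

/-- There is a `2`-form `b` which has primitives with a pole at any given point. -/
theorem exists_isPole [T2Space C] [ConnectedSpace C] (oC : SurfaceOrientation C) :
    ∃ b : FormField (𝓡 2) C 2, ∀ (p : C) (f : C → Plane), IsCoord oC f p →
      ∃ R, IsPole b p f R := by
  obtain ⟨q⟩ := (inferInstance : Nonempty C)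
  obtain ⟨f₀, hf₀⟩ := exists_isCoord oC q
  obtain ⟨b, R₀, hR₀⟩ := exists_isPole_self hf₀
  refine ⟨b, ?_⟩
  let S : Set C := {p | ∃ f, IsCoord oC f p ∧ ∃ R, IsPole b p f R}
  have key : ∀ p, ∀ᶠ p' in 𝓝 p, (p ∈ S ↔ p' ∈ S) := by
    intro p
    obtain ⟨f, hf⟩ := exists_isCoord oC p
    obtain ⟨D⟩ := hf.exists_disc (O := univ) Filter.univ_mem
    have ht := D.t_pos
    filter_upwards [D.mem_nhds (t := D.t / 3) (by linarith)] with p' hp'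
    have hp' : D.s p' < D.t / 3 := hp'
    have hc := D.isCoord_sub (p' := p') (by linarith)
    have h1 : p ∈ S ↔ ∃ R, IsPole b p f R :=
      ⟨fun ⟨g, hg, R, hR⟩ => hR.change hg hf, fun h => ⟨f, hf, h⟩⟩
    have h2 : p' ∈ S ↔ ∃ R, IsPole b p' (fun y => f y - f p') R :=
      ⟨fun ⟨g, hg, R, hR⟩ => hR.change hg hc, fun h => ⟨_, hc, h⟩⟩
    rw [h1, h2, D.isPole_iff hp']
  have hcl : IsClopen S := by
    constructor
    · rw [← isOpen_compl_iff, isOpen_iff_mem_nhds]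
      intro p hp
      filter_upwards [key p] with p' h using fun h' => hp (h.2 h')
    · rw [isOpen_iff_mem_nhds]
      intro p hp
      filter_upwards [key p] with p' h using h.1 hp
  have huniv := hcl.eq_univ ⟨q, f₀, hf₀, R₀, hR₀⟩
  intro p f hf
  obtain ⟨g, hg, R, hR⟩ : p ∈ S := by rw [huniv]; trivial
  exact hR.change hg hf

end Pole

section Bump

variable {C : Type*} [TopologicalSpace C] [ChartedSpace Plane C] [IsManifold (𝓡 2) ∞ C]
  {oC : SurfaceOrientation C} {f : C → Plane} {p : C} {O : Set C} {b : FormField (𝓡 2) C 2}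

/-- The profile of a bump form: a smooth function from `0` at `0` to `1` for large `u`. -/
def profile (t u : ℝ) : ℝ := ramp (t / 3) (2 * t / 3) u / (2 * t / 3)

variable {t u : ℝ}

lemma contDiff_profile : ContDiff ℝ ∞ (profile t) := contDiff_ramp.div_const _

lemma profile_of_le (ht : 0 < t) (h : u ≤ t / 3) : profile t u = u / (2 * t / 3) := by
  rw [profile, ramp_of_le (by linarith) h]

lemma profile_of_ge (ht : 0 < t) (h : 2 * t / 3 ≤ u) : profile t u = 1 := by
  rw [profile, ramp_of_ge (by linarith) h, div_self (by positivity)]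

lemma deriv_profile : deriv (profile t) u = deriv (ramp (t / 3) (2 * t / 3)) u / (2 * t / 3) :=
  deriv_div_const _

lemma deriv_profile_nonneg (ht : 0 < t) : 0 ≤ deriv (profile t) u := by
  rw [deriv_profile]
  exact div_nonneg (deriv_ramp_nonneg (by linarith) _) (by positivity)

lemma deriv_profile_of_lt (ht : 0 < t) (h : u < t / 3) :
    deriv (profile t) u = 1 / (2 * t / 3) := by
  rw [deriv_profile, deriv_ramp_of_lt (by linarith) h]

lemma deriv_profile_of_gt (ht : 0 < t) (h : 2 * t / 3 < u) : deriv (profile t) u = 0 := by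
  have : profile t =ᶠ[𝓝 u] fun _ => 1 := by
    filter_upwards [lt_mem_nhds h] with z hz using profile_of_ge ht hz.le
  rw [this.deriv_eq, deriv_const]

lemma hasDerivAt_profile : HasDerivAt (profile t) (deriv (profile t) u) u :=
  ((contDiff_profile.differentiable (by simp)) u).hasDerivAt

open Classical in
/-- A nonnegative `2`-form supported in a disk, of total area `2π`. -/
def Disc.bump (D : Disc oC f p O) : FormField (𝓡 2) C 2 := fun y =>
  if D.s y < D.t then (2 * deriv (profile D.t) (‖f y‖ ^ 2)) • area (𝓡 2) f y else 0

lemma Disc.bump_of_lt (D : Disc oC f p O) {y : C} (h : D.s y < D.t) :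
    D.bump y = (2 * deriv (profile D.t) (‖f y‖ ^ 2)) • area (𝓡 2) f y := if_pos h

lemma Disc.bump_of_gt (D : Disc oC f p O) {y : C} (h : 2 * D.t / 3 < D.s y) : D.bump y = 0 := by
  by_cases h1 : D.s y < D.t
  · rw [D.bump_of_lt h1, ← D.eq y h1, deriv_profile_of_gt D.t_pos h, mul_zero]
    exact alt_two_ext fun u w => zero_mul _
  · exact if_neg h1

lemma Disc.bump_of_small (D : Disc oC f p O) {y : C} (h : D.s y < D.t / 3) :
    D.bump y = (3 / D.t) • area (𝓡 2) f y := by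
  have ht := D.t_pos
  have h1 : D.s y < D.t := by linarith
  rw [D.bump_of_lt h1, ← D.eq y h1, deriv_profile_of_lt ht h]
  congr 1
  field_simp

lemma Disc.bump_nonneg (D : Disc oC f p O) (y : C) : NonnegForm oC D.bump y := by
  intro u w huw
  by_cases h1 : D.s y < D.t
  · rw [D.bump_of_lt h1]
    exact mul_nonneg (mul_nonneg zero_le_two (deriv_profile_nonneg D.t_pos)) (D.pos y h1 u w huw).le
  · rw [Disc.bump, if_neg h1]; exact le_rfl

lemma Disc.bump_pos (D : Disc oC f p O) {y : C} (h : D.s y < D.t / 3) : PosForm oC D.bump y := by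
  intro u w huw
  rw [D.bump_of_small h]
  exact mul_pos (div_pos three_pos D.t_pos) (D.pos y (by linarith [D.t_pos]) u w huw)

lemma Disc.eventually_bump_eq_zero (D : Disc oC f p O) {y : C} (h : 2 * D.t / 3 < D.s y) :
    ∀ᶠ z in 𝓝 y, D.bump z = 0 := by
  filter_upwards [D.smooth.continuous.continuousAt.eventually (lt_mem_nhds h)] with z hz
  exact D.bump_of_gt hz

/-- The difference of a bump form and `b` is exact. -/
lemma IsPole.exists_bump_primitive {R : OneForm (𝓡 2) C} (hR : IsPole b p f R)
    (D : Disc oC f p O) :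
    ∃ γ : OneForm (𝓡 2) C, ∀ y, RepAt γ y ∧ extd γ y = D.bump y - b y := by
  have ht := D.t_pos
  let H : C → ℝ := fun y => profile D.t (D.s y)
  have hH : ∀ y, SmoothNear (𝓡 2) 𝓘(ℝ, ℝ) H y := fun y =>
    (ContMDiff.smoothNear D.smooth y).comp_contDiff contDiff_profile
  have hH1 : ∀ y, SmoothNear (𝓡 2) 𝓘(ℝ, ℝ) (fun z => H z - 1) y :=
    fun y => (hH y).sub (smoothNear_const 1 y)
  let γ : OneForm (𝓡 2) C := R + fun y => (H y - 1) • ang (𝓡 2) f y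
  refine ⟨γ, fun y => ?_⟩
  rcases lt_or_ge (D.s y) D.t with hy | hy
  · have hsm := D.smooth_f y hy
    by_cases hyp : y = p
    · have h0 : f p = 0 := D.f_zero
      have hs3 : D.s p < D.t / 3 := by rw [D.zero]; linarith
      let γ' : OneForm (𝓡 2) C := (R - ang (𝓡 2) f) + (1 / (2 * D.t / 3)) • rot (𝓡 2) f
      have e : ∀ᶠ z in 𝓝 y, γ z = γ' z := by
        rw [hyp]
        filter_upwards [D.mem_nhds (t := D.t / 3) (by linarith)] with z hz
        have hz : D.s z < D.t / 3 := hz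
        have hz2 : D.s z = ‖f z‖ ^ 2 := D.eq z (by linarith)
        have hHz : H z = ‖f z‖ ^ 2 / (2 * D.t / 3) := by
          simp only [H, profile_of_le ht hz.le, hz2]
        have key : H z • ang (𝓡 2) f z = (1 / (2 * D.t / 3)) • rot (𝓡 2) f z := by
          rw [hHz, ang, smul_smul]
          by_cases hf0 : f z = 0
          · simp [rot, hf0]
          · have : ‖f z‖ ^ 2 ≠ 0 := by positivity
            congr 1
            field_simp
        have k2 : γ z = (R z - ang (𝓡 2) f z) + H z • ang (𝓡 2) f z := by
          simp only [γ, Pi.add_apply]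
          ext u
          simp
          ring
        rw [k2, key]
        rfl
      have r1 : RepAt (R - ang (𝓡 2) f) y := by rw [hyp]; exact hR.repAt_sub
      have r2 : RepAt ((1 / (2 * D.t / 3)) • rot (𝓡 2) f) y := (repAt_rot hsm).const_smul _
      refine ⟨(r1.add r2).congr e, ?_⟩
      rw [extd_congr (r1.add r2) e]
      refine (extd_add r1 r2).trans ?_
      have e1 : extd (R - ang (𝓡 2) f) y = -b y := by rw [hyp]; exact hR.extd_sub_eq
      rw [e1, extd_const_smul _ (repAt_rot hsm), extd_rot hsm, D.bump_of_small (hyp ▸ hs3)]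
      refine alt_two_ext fun u w => ?_
      simp only [ContinuousAlternatingMap.sub_apply, ContinuousAlternatingMap.add_apply,
        ContinuousAlternatingMap.smul_apply, ContinuousAlternatingMap.neg_apply, smul_eq_mul]
      field_simp
      ring
    · have h0 := D.f_ne_zero hy hyp
      have r1 := repAt_ang hsm h0
      refine ⟨(hR.repAt y hyp).add (r1.fsmul (hH1 y)), ?_⟩
      refine (extd_add (hR.repAt y hyp) (r1.fsmul (hH1 y))).trans ?_
      rw [hR.extd_eq y hyp, extd_fsmul (hH1 y) r1, extd_ang hsm h0, dR_sub (hH y).mdiff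
        (smoothNear_const 1 y).mdiff, dR_const,
        dR_congr (g := fun z => profile D.t (‖f z‖ ^ 2)) (by
          filter_upwards [(D.isOpen D.t).mem_nhds hy] with z hz
          simp only [H]; rw [D.eq z hz]),
        dR_comp hasDerivAt_profile hsm.normSq.mdiff, D.bump_of_lt hy]
      have hn : ‖f y‖ ^ 2 ≠ 0 := by positivity
      refine alt_two_ext fun u w => ?_
      have := congrArg (fun F => F ![u, w]) (wedge_dR_normSq_rot hsm)
      simp only [ContinuousAlternatingMap.smul_apply, wedge_apply,
        smul_eq_mul, smul_apply, ContinuousAlternatingMap.sub_apply,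
        ContinuousAlternatingMap.add_apply, ContinuousAlternatingMap.neg_apply, ang, sub_zero,
        smul_zero, add_zero] at this ⊢
      field_simp
      linear_combination (deriv (profile D.t) (‖f y‖ ^ 2)) * this
  · have h2 : 2 * D.t / 3 < D.s y := by linarith
    have hyp : y ≠ p := by rintro rfl; rw [D.zero] at hy; linarith
    have e : ∀ᶠ z in 𝓝 y, γ z = R z := by
      filter_upwards [D.smooth.continuous.continuousAt.eventually (lt_mem_nhds h2)] with z hz
      have : H z = 1 := profile_of_ge ht hz.le
      simp [γ, this]
    refine ⟨(hR.repAt y hyp).congr e, ?_⟩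
    rw [extd_congr (hR.repAt y hyp) e, hR.extd_eq y hyp, D.bump_of_gt h2, zero_sub]

end Bump

section ChartArea

variable {C : Type*} [TopologicalSpace C] [ChartedSpace Plane C] [IsManifold (𝓡 2) ∞ C]
  {f : C → Plane}

lemma chartForm_area (x₀ : C) {y : Plane} (hy : y ∈ (extChartAt (𝓡 2) x₀).target)
    (hf : SmoothNear (𝓡 2) 𝓘(ℝ, Plane) f ((extChartAt (𝓡 2) x₀).symm y)) (u w : Plane) :
    chartForm (area (𝓡 2) f) x₀ y ![u, w] =
      stdArea (fderiv ℝ (fun z => f ((extChartAt (𝓡 2) x₀).symm z)) y u)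
        (fderiv ℝ (fun z => f ((extChartAt (𝓡 2) x₀).symm z)) y w) := by
  have hc := smoothNear_extChartAt_symm (I := 𝓡 2) x₀ hy
  have h1 := area_apply (I := 𝓘(ℝ, Plane)) (SmoothNear.comp hf hc).mdiff u w
  have e : ∀ v : Plane, planeDeriv 𝓘(ℝ, Plane) (fun z => f ((extChartAt (𝓡 2) x₀).symm z)) y v =
      fderiv ℝ (fun z => f ((extChartAt (𝓡 2) x₀).symm z)) y v := fun v =>
    DFunLike.congr_fun (mfderiv_eq_fderiv (𝕜 := ℝ)
      (f := fun z => f ((extChartAt (𝓡 2) x₀).symm z)) (x := y)) v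
  refine Eq.trans ?_ (h1.trans (congrArg₂ stdArea (e u) (e w)))
  refine (compContinuousLinearMap_two (Y := TangentSpace (𝓡 2) _) _ _ _ _).trans ?_
  have d : ∀ i, dR 𝓘(ℝ, Plane) (co (fun z => f ((extChartAt (𝓡 2) x₀).symm z)) i) y =
      (dR (𝓡 2) (co f i) ((extChartAt (𝓡 2) x₀).symm y)).comp
        (mfderiv 𝓘(ℝ, Plane) (𝓡 2) (extChartAt (𝓡 2) x₀).symm y) := fun i =>
    dR_pull (hf.co i).mdiff hc.mdiff
  simp only [area, d, wedge_apply]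
  rfl

lemma continuousAt_chartForm_area (x₀ : C) {y : Plane} (hy : y ∈ (extChartAt (𝓡 2) x₀).target)
    (hf : SmoothNear (𝓡 2) 𝓘(ℝ, Plane) f ((extChartAt (𝓡 2) x₀).symm y)) (u w : Plane) :
    ContinuousAt (fun z => chartForm (area (𝓡 2) f) x₀ z ![u, w]) y := by
  have h := (contDiffAt_chartForm_extd x₀ hy (repAt_rot hf)).continuousAt
  have h2 : ContinuousAt (fun z => (1 / 2 : ℝ) * chartForm (extd (rot (𝓡 2) f)) x₀ z ![u, w]) y :=
    continuousAt_const.mul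
      ((ContinuousAlternatingMap.apply ℝ Plane ℝ ![u, w]).continuous.continuousAt.comp h)
  refine h2.congr ?_
  filter_upwards [(isOpen_extChartAt_target x₀).mem_nhds hy,
    (smoothNear_extChartAt_symm (I := 𝓡 2) x₀ hy).continuousAt.eventually hf.eventually]
    with z _ h2
  have : chartForm (extd (rot (𝓡 2) f)) x₀ z ![u, w] =
      2 * chartForm (area (𝓡 2) f) x₀ z ![u, w] := by
    simp only [chartForm, pullbackForm, extd_rot h2]
    rfl
  rw [this]; ring

lemma plane_det (L : Plane →L[ℝ] Plane) :
    L.det = stdArea (L (EuclideanSpace.single 0 1)) (L (EuclideanSpace.single 1 1)) := by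
  have := LinearMap.det_toMatrix (EuclideanSpace.basisFun (Fin 2) ℝ).toBasis (L : Plane →ₗ[ℝ] Plane)
  rw [ContinuousLinearMap.det, ← this, Matrix.det_fin_two]
  simp [LinearMap.toMatrix_apply, stdArea]
  ring

lemma measurableSet_extChartAt_image [MeasurableSpace C] [BorelSpace C] (x₀ : C) {S : Set C}
    (hS : S ⊆ (extChartAt (𝓡 2) x₀).source) (hm : MeasurableSet S) :
    MeasurableSet (extChartAt (𝓡 2) x₀ '' S) := by
  rw [PartialEquiv.image_eq_target_inter_inv_preimage _ hS]
  have hc : Continuous ((extChartAt (𝓡 2) x₀).target.domRestrict (extChartAt (𝓡 2) x₀).symm) :=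
    (continuousOn_extChartAt_symm x₀).domRestrict
  have := (isOpen_extChartAt_target (I := 𝓡 2) x₀).measurableSet.subtype_image (hc.measurable hm)
  convert this using 1
  ext y
  exact ⟨fun h => ⟨⟨y, h.1⟩, h.2, rfl⟩, by rintro ⟨z, hz, rfl⟩; exact ⟨z.2, hz⟩⟩

end ChartArea

section Measure

variable {C : Type*} [TopologicalSpace C] [ChartedSpace Plane C] [IsManifold (𝓡 2) ∞ C]
  {oC : SurfaceOrientation C} {f : C → Plane} {p : C} {O : Set C} {t : ℝ}

lemma lintegral_profile (ht : 0 < t) :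
    ∫⁻ q in {q : Plane | ‖q‖ ^ 2 < t}, ENNReal.ofReal (2 * deriv (profile t) (‖q‖ ^ 2)) =
      ENNReal.ofReal (2 * Real.pi) := by
  have hzero : ∀ q : Plane, q ∉ {q : Plane | ‖q‖ ^ 2 < t} → 2 * deriv (profile t) (‖q‖ ^ 2) = 0 :=
    fun q hq => by
      have : t ≤ ‖q‖ ^ 2 := not_lt.1 hq
      rw [deriv_profile_of_gt ht (by linarith), mul_zero]
  have hcont : Continuous fun q : Plane => 2 * deriv (profile t) (‖q‖ ^ 2) :=
    continuous_const.mul ((contDiff_profile.continuous_deriv (by simp)).comp (by fun_prop))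
  have hint : Integrable fun q : Plane => 2 * deriv (profile t) (‖q‖ ^ 2) := by
    refine hcont.integrable_of_hasCompactSupport ?_
    refine HasCompactSupport.of_support_subset_isCompact
      (ProperSpace.isCompact_closedBall (0 : Plane) (Real.sqrt t)) fun q hq => ?_
    rw [mem_closedBall_zero_iff]
    by_contra hlt
    push Not at hlt
    refine hq (hzero q ?_)
    exact fun h : ‖q‖ ^ 2 < t => absurd (Real.le_sqrt_of_sq_le h.le) (not_le.2 hlt)
  rw [← ofReal_integral_eq_lintegral_ofReal hint.integrableOn
    (.of_forall fun q => mul_nonneg zero_le_two (deriv_profile_nonneg ht)),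
    setIntegral_eq_integral_of_forall_compl_eq_zero hzero]
  congr 1
  have h1 := integral_fun_norm_addHaar (volume : Measure Plane)
    (fun r => 2 * deriv (profile t) (r ^ 2))
  rw [h1]
  have hd : ∀ y : ℝ, HasDerivAt (fun y => profile t (y ^ 2))
      (y ^ (Module.finrank ℝ Plane - 1) • (2 * deriv (profile t) (y ^ 2))) y := fun y => by
    have := (hasDerivAt_profile (t := t) (u := y ^ 2)).comp y (hasDerivAt_pow 2 y)
    have e : deriv (profile t) (y ^ 2) * (↑2 * y ^ (2 - 1)) =
        y ^ (Module.finrank ℝ Plane - 1) • (2 * deriv (profile t) (y ^ 2)) := by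
      rw [finrank_euclideanSpace_fin, smul_eq_mul]
      norm_num
      ring
    exact e ▸ this
  have h2 := integral_Ioi_of_hasDerivAt_of_nonneg' (a := 0) (l := 1) (fun y _ => hd y)
    (fun y hy => smul_nonneg (pow_nonneg (le_of_lt hy) _)
      (mul_nonneg zero_le_two (deriv_profile_nonneg ht))) (by
        refine tendsto_const_nhds.congr' ?_
        filter_upwards [(Filter.tendsto_pow_atTop two_ne_zero).eventually_ge_atTop (2 * t / 3)]
          with y hy
        exact (profile_of_ge ht hy).symm)
  rw [h2]
  have h3 : profile t (0 ^ 2) = 0 := by rw [profile_of_le ht (by simp; positivity)]; simp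
  have h4 : (volume : Measure Plane).real (Metric.ball 0 1) = Real.pi := by
    simp [Measure.real, ENNReal.toReal_ofReal Real.pi_pos.le]
  rw [h3, h4]
  simp

/-- The density of the bump form in the chart around `x₀`. -/
def Disc.density (D : Disc oC f p O) (x₀ : C) (y : Plane) : ENNReal :=
  ENNReal.ofReal |chartForm D.bump x₀ y
    ![EuclideanSpace.single (0 : Fin 2) (1 : ℝ), EuclideanSpace.single (1 : Fin 2) (1 : ℝ)]|

lemma Disc.aemeasurable_density (D : Disc oC f p O) (x₀ : C) :
    AEMeasurable (D.density x₀) (volume.restrict (extChartAt (𝓡 2) x₀).target) := by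
  refine ContinuousOn.aemeasurable (fun y hy => ContinuousAt.continuousWithinAt ?_)
    (isOpen_extChartAt_target x₀).measurableSet
  refine ENNReal.continuous_ofReal.continuousAt.comp (continuous_abs.continuousAt.comp ?_)
  set z := (extChartAt (𝓡 2) x₀).symm y with hz
  have hcs := (smoothNear_extChartAt_symm (I := 𝓡 2) x₀ hy).continuousAt
  rcases lt_or_ge (D.s z) D.t with h | h
  · have h1 : ContinuousAt (fun y => 2 * deriv (profile D.t)
        (‖f ((extChartAt (𝓡 2) x₀).symm y)‖ ^ 2)) y := by
      refine continuousAt_const.mul ?_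
      refine ContinuousAt.comp (f := fun y => ‖f ((extChartAt (𝓡 2) x₀).symm y)‖ ^ 2)
        (contDiff_profile.continuous_deriv (by simp)).continuousAt ?_
      exact (ContinuousAt.comp (f := (extChartAt (𝓡 2) x₀).symm) (g := f)
        (D.smooth_f z h).continuousAt hcs).norm.pow 2
    refine (h1.mul (continuousAt_chartForm_area x₀ hy (D.smooth_f z h)
      (EuclideanSpace.single 0 1) (EuclideanSpace.single 1 1))).congr ?_
    filter_upwards [hcs.eventually ((D.isOpen D.t).mem_nhds h)] with y' hy'
    simp only [chartForm, pullbackForm, D.bump_of_lt hy']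
    rfl
  · refine (continuousAt_const (y := (0 : ℝ))).congr ?_
    filter_upwards [hcs.eventually (D.eventually_bump_eq_zero (y := z)
      (by linarith [D.t_pos]))] with y' hy'
    simp only [chartForm, pullbackForm, hy']
    rfl

variable [MeasurableSpace C] [BorelSpace C]

lemma Disc.exists_areaMeasure (D : Disc oC f p O) :
    ∃ ν : Measure C, IsAreaMeasure D.bump ν ∧ ν univ = ENNReal.ofReal (2 * Real.pi) := by
  let B : Set Plane := {q | ‖q‖ ^ 2 < D.t}
  have hB : MeasurableSet B := (isOpen_lt (by fun_prop) continuous_const).measurableSet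
  let ρ : Plane → ENNReal := fun q => ENNReal.ofReal (2 * deriv (profile D.t) (‖q‖ ^ 2))
  let μ : Measure Plane := (volume.restrict B).withDensity ρ
  have hinv : AEMeasurable D.inv μ :=
    (D.inv_cont.aemeasurable hB).mono_ac (withDensity_absolutelyContinuous _ _)
  have hval : ∀ S : Set C, MeasurableSet S →
      (μ.map D.inv) S = ∫⁻ q in D.inv ⁻¹' S ∩ B, ρ q := fun S hS => by
    rw [Measure.map_apply_of_aemeasurable hinv hS, withDensity_apply', Measure.restrict_restrict' hB]
  refine ⟨μ.map D.inv, ?_, ?_⟩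
  swap
  · rw [hval _ MeasurableSet.univ, preimage_univ, univ_inter]
    exact lintegral_profile D.t_pos
  intro x₀ S hS hSm
  rw [hval S hSm]
  let F : Plane → Plane := fun z => f ((extChartAt (𝓡 2) x₀).symm z)
  let A := extChartAt (𝓡 2) x₀ '' (S ∩ {y | D.s y < D.t})
  have hAm : MeasurableSet A := measurableSet_extChartAt_image x₀
    (inter_subset_left.trans hS) (hSm.inter (D.isOpen _).measurableSet)
  have hFA : ∀ z ∈ S, F (extChartAt (𝓡 2) x₀ z) = f z := fun z hz => by
    simp only [F, (extChartAt (𝓡 2) x₀).left_inv (hS hz)]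
  have himg : D.inv ⁻¹' S ∩ B = F '' A := by
    ext q
    constructor
    · rintro ⟨hq, hqB⟩
      obtain ⟨h1, h2⟩ := D.inv_mem q hqB
      exact ⟨_, ⟨D.inv q, ⟨hq, h1⟩, rfl⟩, by rw [hFA _ hq, h2]⟩
    · rintro ⟨_, ⟨z, ⟨hz, hz1⟩, rfl⟩, rfl⟩
      have hz1 : D.s z < D.t := hz1
      rw [hFA z hz]
      refine ⟨by rw [mem_preimage, D.inv_f z hz1]; exact hz, ?_⟩
      change ‖f z‖ ^ 2 < D.t
      rw [← D.eq z hz1]; exact hz1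
  have hsm : ∀ y ∈ A, y ∈ (extChartAt (𝓡 2) x₀).target ∧
      D.s ((extChartAt (𝓡 2) x₀).symm y) < D.t := by
    rintro _ ⟨z, ⟨hz, hz1⟩, rfl⟩
    exact ⟨(extChartAt (𝓡 2) x₀).map_source (hS hz),
      by rw [(extChartAt (𝓡 2) x₀).left_inv (hS hz)]; exact hz1⟩
  have hder : ∀ y ∈ A, HasFDerivWithinAt F (fderiv ℝ F y) A y := fun y hy => by
    obtain ⟨h1, h2⟩ := hsm y hy
    have := SmoothNear.comp (D.smooth_f _ h2) (smoothNear_extChartAt_symm (I := 𝓡 2) x₀ h1)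
    exact (mdifferentiableAt_iff_differentiableAt.1 this.mdiff).hasFDerivAt.hasFDerivWithinAt
  have hinj : InjOn F A := by
    rintro _ ⟨z, ⟨hz, hz1⟩, rfl⟩ _ ⟨z', ⟨hz', hz1'⟩, rfl⟩ h
    rw [hFA z hz, hFA z' hz'] at h
    rw [D.eq_of_f_eq hz1 hz1' h]
  rw [himg, lintegral_image_eq_lintegral_abs_det_fderiv_mul volume hAm hder hinj]
  have hAS : A ⊆ extChartAt (𝓡 2) x₀ '' S := image_mono inter_subset_left
  have hd : EqOn (fun y => ENNReal.ofReal |chartForm D.bump x₀ y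
      ![EuclideanSpace.single (0 : Fin 2) (1 : ℝ), EuclideanSpace.single (1 : Fin 2) (1 : ℝ)]|)
      (A.indicator fun y => ENNReal.ofReal |(fderiv ℝ F y).det| * ρ (F y))
      (extChartAt (𝓡 2) x₀ '' S) := by
    rintro y ⟨z, hz, hzy⟩
    have hzs : (extChartAt (𝓡 2) x₀).symm y = z := by
      rw [← hzy, (extChartAt (𝓡 2) x₀).left_inv (hS hz)]
    by_cases hyA : y ∈ A
    · obtain ⟨h1, h2⟩ := hsm y hyA
      have e : chartForm D.bump x₀ y = (2 * deriv (profile D.t) (‖F y‖ ^ 2)) •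
          chartForm (area (𝓡 2) f) x₀ y := by
        simp only [chartForm, pullbackForm, D.bump_of_lt h2]
        rfl
      rw [indicator_of_mem hyA, plane_det, ← chartForm_area x₀ h1 (D.smooth_f _ h2), mul_comm]
      simp only [e, ContinuousAlternatingMap.smul_apply, smul_eq_mul, ρ]
      have h0 : 0 ≤ 2 * deriv (profile D.t) (‖F y‖ ^ 2) :=
        mul_nonneg zero_le_two (deriv_profile_nonneg D.t_pos)
      rw [abs_mul, abs_of_nonneg h0, ENNReal.ofReal_mul h0]
    · have h2 : ¬ D.s ((extChartAt (𝓡 2) x₀).symm y) < D.t := fun h =>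
        hyA ⟨z, ⟨hz, by rw [hzs] at h; exact h⟩, hzy⟩
      have e : chartForm D.bump x₀ y = 0 := by
        simp only [chartForm, pullbackForm, Disc.bump, if_neg h2]
        rfl
      rw [indicator_of_notMem hyA]
      simp only [e]
      exact (congrArg ENNReal.ofReal (abs_zero (α := ℝ))).trans ENNReal.ofReal_zero
  rw [setLIntegral_congr_fun (measurableSet_extChartAt_image x₀ hS hSm) hd,
    setLIntegral_indicator hAm, inter_eq_self_of_subset_left hAS]

lemma exists_apply_eq_mul {X : Type*} [AddCommGroup X] [Module ℝ X] [TopologicalSpace X]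
    {o : Orientation ℝ X (Fin 2)} {u w : X} (h : PosPair o u w) (u' w' : X) :
    ∃ d : ℝ, ∀ F : X [⋀^Fin 2]→L[ℝ] ℝ, F ![u', w'] = d * F ![u, w] := by
  obtain ⟨b, rfl, rfl, -⟩ := h
  refine ⟨b.det ![u', w'], fun F => ?_⟩
  have e := DFunLike.congr_fun (F.toAlternatingMap.eq_smul_basis_det b) ![u', w']
  have e2 : (⇑b : Fin 2 → X) = ![b 0, b 1] := by ext i; fin_cases i <;> rfl
  rw [AlternatingMap.smul_apply, smul_eq_mul, mul_comm] at e
  refine e.trans ?_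
  rw [e2]
  rfl

/-- The area measure of a sum of bump forms. -/
lemma exists_areaMeasure_sum {J : Type*} [Fintype J] {f : J → C → Plane} {p : J → C}
    {O : J → Set C} (D : ∀ j, Disc oC (f j) (p j) (O j)) {κ : ℝ} (hκ : 0 ≤ κ) :
    ∃ ν : Measure C, IsAreaMeasure (fun y => κ • ∑ j, (D j).bump y) ν ∧
      ν univ = ENNReal.ofReal (κ * (Fintype.card J * (2 * Real.pi))) := by
  choose ν hν hmass using fun j => (D j).exists_areaMeasure
  refine ⟨ENNReal.ofReal κ • ∑ j, ν j, ?_, ?_⟩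
  swap
  · rw [Measure.smul_apply, Measure.finsetSum_apply]
    simp only [hmass, smul_eq_mul, Finset.sum_const, Finset.card_univ, nsmul_eq_mul]
    rw [ENNReal.ofReal_mul hκ, ENNReal.ofReal_mul (Nat.cast_nonneg _), ENNReal.ofReal_natCast]
  intro x₀ S hS hSm
  rw [Measure.smul_apply, Measure.finsetSum_apply]
  have e : ∀ y, ENNReal.ofReal |chartForm (fun y => κ • ∑ j, (D j).bump y) x₀ y
      ![EuclideanSpace.single (0 : Fin 2) (1 : ℝ), EuclideanSpace.single (1 : Fin 2) (1 : ℝ)]| =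
      ENNReal.ofReal κ * ∑ j, (D j).density x₀ y := by
    intro y
    obtain ⟨u₀, w₀, h0⟩ := exists_posPair_tangent oC ((extChartAt (𝓡 2) x₀).symm y)
    let Dy := mfderiv 𝓘(ℝ, Plane) (𝓡 2) (extChartAt (𝓡 2) x₀).symm y
    obtain ⟨d, hd⟩ := exists_apply_eq_mul h0 (Dy (EuclideanSpace.single (0 : Fin 2) (1 : ℝ)))
      (Dy (EuclideanSpace.single (1 : Fin 2) (1 : ℝ)))
    have k : ∀ τ : FormField (𝓡 2) C 2, chartForm τ x₀ y ![EuclideanSpace.single (0 : Fin 2) (1 : ℝ),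
        EuclideanSpace.single (1 : Fin 2) (1 : ℝ)] =
        d * τ ((extChartAt (𝓡 2) x₀).symm y) ![u₀, w₀] := fun τ => by
      refine Eq.trans ?_ (hd _)
      exact compContinuousLinearMap_two (Y := TangentSpace (𝓡 2) _) _ _ _ _
    have hnn : ∀ j, 0 ≤ (D j).bump ((extChartAt (𝓡 2) x₀).symm y) ![u₀, w₀] :=
      fun j => (D j).bump_nonneg _ _ _ h0
    simp only [Disc.density, k]
    rw [ContinuousAlternatingMap.smul_apply, ContinuousAlternatingMap.sum_apply, abs_mul, smul_eq_mul,
      abs_mul, abs_of_nonneg hκ, abs_of_nonneg (Finset.sum_nonneg fun j _ => hnn j),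
      mul_left_comm, ENNReal.ofReal_mul hκ, Finset.mul_sum,
      ENNReal.ofReal_sum_of_nonneg fun j _ => mul_nonneg (abs_nonneg d) (hnn j)]
    congr 1
    refine Finset.sum_congr rfl fun j _ => ?_
    rw [abs_mul, abs_of_nonneg (hnn j)]
  simp only [e]
  have hsub : extChartAt (𝓡 2) x₀ '' S ⊆ (extChartAt (𝓡 2) x₀).target := by
    rintro _ ⟨z, hz, rfl⟩; exact (extChartAt (𝓡 2) x₀).map_source (hS hz)
  have hm : ∀ j, AEMeasurable ((D j).density x₀)
      (volume.restrict (extChartAt (𝓡 2) x₀ '' S)) := fun j =>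
    ((D j).aemeasurable_density x₀).mono_measure (Measure.restrict_mono hsub le_rfl)
  rw [lintegral_const_mul'' _ (Finset.aemeasurable_fun_sum _ fun j _ => hm j),
    lintegral_finsetSum' _ fun j _ => hm j, smul_eq_mul]
  congr 1
  exact Finset.sum_congr rfl fun j _ => hν j x₀ S hS hSm

end Measure

section Poincare

variable {E : Type*} [NormedAddCommGroup E] [NormedSpace ℝ E]
  {H : Type*} [TopologicalSpace H] {I : ModelWithCorners ℝ E H}
  {M : Type*} [TopologicalSpace M] [ChartedSpace H M] [IsManifold I ∞ M] [I.Boundaryless]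

/-- The Poincaré lemma for `1`-forms. -/
lemma RepAt.exists_primitive {η : OneForm I M} {q : M} (h : RepAt η q)
    (hd : ∀ᶠ y in 𝓝 q, extd η y = 0) :
    ∃ G : M → ℝ, SmoothNear I 𝓘(ℝ, ℝ) G q ∧ ∀ᶠ y in 𝓝 q, η y = dR I G y := by
  obtain ⟨ι, _, f, g, hf, hg, e⟩ := h
  set φ := extChartAt I q with hφ
  have hz : φ q ∈ φ.target := mem_extChartAt_target q
  have hq : φ.symm (φ q) = q := extChartAt_to_inv q
  have hs := smoothNear_extChartAt_symm (I := I) q hz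
  have hf' : ∀ i, ∀ᶠ z in 𝓝 (φ q), SmoothNear I 𝓘(ℝ, ℝ) (f i) (φ.symm z) := fun i =>
    hs.continuousAt.eventually (by rw [← hφ, hq]; exact (hf i).eventually)
  have hg' : ∀ i, ∀ᶠ z in 𝓝 (φ q), SmoothNear I 𝓘(ℝ, ℝ) (g i) (φ.symm z) := fun i =>
    hs.continuousAt.eventually (by rw [← hφ, hq]; exact (hg i).eventually)
  have he' : ∀ᶠ z in 𝓝 (φ q), ∀ᶠ y in 𝓝 (φ.symm z), η y = ∑ i, f i y • dR I (g i) y :=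
    hs.continuousAt.eventually (by rw [← hφ, hq]; exact e.eventually_nhds)
  have hd' : ∀ᶠ z in 𝓝 (φ q), extd η (φ.symm z) = 0 :=
    hs.continuousAt.eventually (by rw [← hφ, hq]; exact hd)
  obtain ⟨r, hr, hball⟩ := Metric.eventually_nhds_iff_ball.1
    ((Filter.eventually_all.2 hf').and ((Filter.eventually_all.2 hg').and
      (he'.and (hd'.and ((isOpen_extChartAt_target q).mem_nhds hz)))))
  let F : ι → E → ℝ := fun i z => f i (φ.symm z)
  let K : ι → E → ℝ := fun i z => g i (φ.symm z)
  let om : E → E →L[ℝ] ℝ := fun z => ∑ i, F i z • fderiv ℝ (K i) z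
  have hF : ∀ z ∈ Metric.ball (φ q) r, ∀ i, ContDiffAt ℝ ∞ (F i) z := fun z hz i =>
    ((hball z hz).1 i).contDiff_chart q (hball z hz).2.2.2.2 |>.self_of_nhds
  have hK : ∀ z ∈ Metric.ball (φ q) r, ∀ i, ContDiffAt ℝ ∞ (K i) z := fun z hz i =>
    ((hball z hz).2.1 i).contDiff_chart q (hball z hz).2.2.2.2 |>.self_of_nhds
  have hK' : ∀ z ∈ Metric.ball (φ q) r, ∀ i, ContDiffAt ℝ ∞ (fderiv ℝ (K i)) z := fun z hz i =>
    (hK z hz i).fderiv_right (m := ∞) (by simp)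
  have hom : ∀ z ∈ Metric.ball (φ q) r, ContDiffAt ℝ ∞ om z := fun z hz =>
    ContDiffAt.sum fun i _ => (hF z hz i).smul (hK' z hz i)
  have hsymm : ∀ z ∈ Metric.ball (φ q) r, ∀ x y, fderiv ℝ om z x y = fderiv ℝ om z y x := by
    intro z hz x y
    have hder : HasFDerivAt om (∑ i, (F i z • fderiv ℝ (fderiv ℝ (K i)) z +
        (fderiv ℝ (F i) z).smulRight (fderiv ℝ (K i) z))) z :=
      HasFDerivAt.fun_sum fun i _ =>
        ((hF z hz i).differentiableAt (by simp)).hasFDerivAt.smul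
          ((hK' z hz i).differentiableAt (by simp)).hasFDerivAt
    have hval : ∀ x y, fderiv ℝ om z x y = ∑ i, (F i z * fderiv ℝ (fderiv ℝ (K i)) z x y +
        fderiv ℝ (F i) z x * fderiv ℝ (K i) z y) := fun x y => by
      rw [hder.fderiv]
      simp [sum_apply]
    have hw : ∑ i, wedge (fderiv ℝ (F i) z) (fderiv ℝ (K i) z) = 0 := by
      obtain ⟨h1, h2, h3, h4, h5⟩ := hball z hz
      have k1 := extDeriv_chartForm q h5 h1 h2 h3
      have k2 := extDeriv_chartForm_eq q h5 ⟨ι, ‹_›, f, g, h1, h2, h3⟩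
      refine k1.symm.trans (k2.trans ?_)
      exact congrArg (fun T => T.compContinuousLinearMap
        (mfderiv 𝓘(ℝ, E) I (extChartAt I q).symm z)) h4
    have hw' := congrArg (fun T : E [⋀^Fin 2]→L[ℝ] ℝ => T ![x, y]) hw
    simp only [ContinuousAlternatingMap.sum_apply, wedge_apply, Matrix.cons_val_zero,
      Matrix.cons_val_one] at hw'
    have hw2 : ∑ i, (fderiv ℝ (F i) z x * fderiv ℝ (K i) z y -
      fderiv ℝ (F i) z y * fderiv ℝ (K i) z x) = 0 := hw'
    rw [hval, hval, ← sub_eq_zero, ← Finset.sum_sub_distrib, ← hw2]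
    refine Finset.sum_congr rfl fun i _ => ?_
    have : fderiv ℝ (fderiv ℝ (K i)) z x y = fderiv ℝ (fderiv ℝ (K i)) z y x :=
      (hK z hz i).isSymmSndFDerivAt (by
        rw [minSmoothness_of_isRCLikeNormedField]; exact ENat.LEInfty.out) x y
    rw [this]; ring
  obtain ⟨G, hG⟩ := (convex_ball (φ q) r).exists_forall_hasFDerivAt_of_fderiv_symmetric
    Metric.isOpen_ball (fun z hz => ((hom z hz).differentiableAt (by simp)).differentiableWithinAt)
    hsymm
  have hGs : ContDiffOn ℝ ∞ G (Metric.ball (φ q) r) := by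
    rw [contDiffOn_infty_iff_fderiv_of_isOpen Metric.isOpen_ball]
    exact ⟨fun z hz => (hG z hz).differentiableAt.differentiableWithinAt, fun z hz =>
      ((hom z hz).contDiffWithinAt.congr (fun z' hz' => (hG z' hz').fderiv) (hG z hz).fderiv)⟩
  have hGn : ∀ z ∈ Metric.ball (φ q) r, SmoothNear 𝓘(ℝ, E) 𝓘(ℝ, ℝ) G z := fun z hz => by
    filter_upwards [Metric.isOpen_ball.mem_nhds hz] with z' hz'
    exact (hGs.contDiffAt (Metric.isOpen_ball.mem_nhds hz')).contMDiffAt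
  have hφs : SmoothNear I 𝓘(ℝ, E) φ q := smoothNear_extChartAt (mem_chart_source _ _)
  refine ⟨fun y => G (φ y), SmoothNear.comp (hGn _ (Metric.mem_ball_self hr)) hφs, ?_⟩
  filter_upwards [e, hφs.eventually, hφs.continuousAt.eventually
    (Metric.isOpen_ball.mem_nhds (Metric.mem_ball_self hr)),
    extChartAt_source_mem_nhds (I := I) q] with y h1 h2 h3 h4
  rw [h1]
  have k1 : dR I (fun y => G (φ y)) y = (dR 𝓘(ℝ, E) G (φ y)).comp (mfderiv I 𝓘(ℝ, E) φ y) :=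
    dR_pull (hGn _ h3).mdiff h2.mdiff
  have k2 : ∀ i, dR I (g i) y = (dR 𝓘(ℝ, E) (K i) (φ y)).comp (mfderiv I 𝓘(ℝ, E) φ y) := by
    intro i
    rw [← dR_pull ((hK _ h3 i).contMDiffAt.mdifferentiableAt (by simp)) h2.mdiff]
    refine dR_congr ?_
    filter_upwards [extChartAt_source_mem_nhds' (I := I) h4] with y' hy'
    simp only [K, φ.left_inv hy']
  have k3 : ∀ v : E, (dR 𝓘(ℝ, E) G (φ y) : E → ℝ) v = ∑ i, F i (φ y) * fderiv ℝ (K i) (φ y) v := by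
    intro v
    have : dR 𝓘(ℝ, E) G (φ y) = om (φ y) := (mfderiv_eq_fderiv (𝕜 := ℝ)).trans (hG _ h3).fderiv
    rw [this]
    exact sum_smul_clm_apply (X := E) (fun i => F i (φ y)) (fun i => fderiv ℝ (K i) (φ y)) v
  ext u
  refine (sum_smul_clm_apply _ _ _).trans ?_
  rw [k1]
  refine Eq.trans ?_ (k3 _).symm
  refine Finset.sum_congr rfl fun i _ => ?_
  rw [k2]
  simp only [F, φ.left_inv h4]
  congr 1
  exact DFunLike.congr_fun (mfderiv_eq_fderiv (𝕜 := ℝ) (f := K i) (x := φ y)) _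

end Poincare

section BaseForm

variable {C : Type*} [TopologicalSpace C] [ChartedSpace Plane C] [IsManifold (𝓡 2) ∞ C]
  {oC : SurfaceOrientation C}

/-- A function defined near `q` agrees near `q` with a smooth function on `C` that vanishes near
the other points of `Q`. -/
lemma exists_cutoff [T2Space C] {f : C → Plane} {q : C} (hf : IsCoord oC f q) (Q : Set C)
    (hQ : Q.Finite) {G : C → ℝ} (hG : SmoothNear (𝓡 2) 𝓘(ℝ, ℝ) G q) :
    ∃ h : C → ℝ, (∀ y, SmoothNear (𝓡 2) 𝓘(ℝ, ℝ) h y) ∧ (∀ᶠ y in 𝓝 q, h y = G y) ∧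
      ∀ q' ∈ Q, q' ≠ q → ∀ᶠ y in 𝓝 q', h y = 0 := by
  have hO : ∀ᶠ y in 𝓝 q, SmoothNear (𝓡 2) 𝓘(ℝ, ℝ) G y ∧ y ∉ Q \ {q} :=
    hG.eventually.and ((hQ.subset sdiff_subset).isClosed.isOpen_compl.mem_nhds (by simp))
  obtain ⟨D⟩ := hf.exists_disc hO
  have ht := D.t_pos
  have h12 : D.t / 3 < 2 * D.t / 3 := by linarith
  let h : C → ℝ := fun y => (1 - step (D.t / 3) (2 * D.t / 3) (D.s y)) * G y
  have hout : ∀ y, 2 * D.t / 3 < D.s y → ∀ᶠ z in 𝓝 y, h z = 0 := fun y hy => by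
    filter_upwards [D.smooth.continuous.continuousAt.eventually (lt_mem_nhds hy)] with z hz
    simp [h, step_of_ge h12 hz.le]
  refine ⟨h, fun y => ?_, ?_, fun q' hq' hne => hout q' ?_⟩
  · rcases lt_or_ge (D.s y) D.t with hy | hy
    · exact ((smoothNear_const 1 y).sub (smoothNear_step D.smooth _ _ y)).mul (D.subset y hy).1
    · exact (smoothNear_const 0 y).congr (hout y (by linarith))
  · filter_upwards [D.mem_nhds (t := D.t / 3) (by linarith)] with z hz
    have hz : D.s z < D.t / 3 := hz
    simp [h, step_of_le h12 hz.le]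
  · by_contra hlt
    push Not at hlt
    exact (D.subset q' (by linarith)).2 ⟨hq', hne⟩

lemma smul_bump_sum {X : Type*} [AddCommGroup X] [Module ℝ X] [TopologicalSpace X] {J : Type*}
    [Fintype J] (κ M : ℝ) (hκ : κ * Fintype.card J = M) (B : J → X [⋀^Fin 2]→L[ℝ] ℝ)
    (b : X [⋀^Fin 2]→L[ℝ] ℝ) : (-M) • (-b) + κ • ∑ j, (B j - b) = κ • ∑ j, B j := by
  rw [Finset.sum_sub_distrib, smul_sub, Finset.sum_const, Finset.card_univ, ← Nat.cast_smul_eq_nsmul ℝ,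
    smul_smul, hκ]
  simp

/-- An area form on `C` with a primitive that has prescribed singularities of rotation type. -/
theorem exists_base_form [T2Space C] [CompactSpace C] [ConnectedSpace C] [MeasurableSpace C]
    [BorelSpace C] (oC : SurfaceOrientation C) (Q : Finset C) (f : C → C → Plane)
    (hf : ∀ q ∈ Q, IsCoord oC (f q) q) (c : C → ℝ) {M : ℝ} (hM : 0 < M)
    (hc : ∑ q : Q, c q = -M) :
    ∃ (β : OneForm (𝓡 2) C) (σ : FormField (𝓡 2) C 2) (k : C → ℝ),
      (∀ y, y ∉ Q → RepAt β y ∧ extd β y = σ y) ∧ (∀ y, PosForm oC σ y) ∧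
      (∀ q ∈ Q, 0 < k q ∧
        (∀ᶠ y in 𝓝 q, β y = k q • rot (𝓡 2) (f q) y + c q • ang (𝓡 2) (f q) y) ∧
        ∀ᶠ y in 𝓝 q, σ y = (2 * k q) • area (𝓡 2) (f q) y) ∧
      ∃ ν : Measure C, IsAreaMeasure σ ν ∧ ν univ = ENNReal.ofReal (2 * Real.pi * M) := by
  classical
  obtain ⟨b, hb⟩ := exists_isPole oC
  choose f₀ hf₀ using exists_isCoord oC
  let F : C → C → Plane := fun y => if y ∈ Q then f y else f₀ y
  have hF : ∀ y, IsCoord oC (F y) y := fun y => by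
    by_cases hy : y ∈ Q
    · simpa [F, hy] using hf y hy
    · simpa [F, hy] using hf₀ y
  have hFQ : ∀ q ∈ Q, F q = f q := fun q hq => by simp [F, hq]
  let O : C → Set C := fun y => ((Q : Set C) \ {y})ᶜ
  have hO : ∀ y, O y ∈ 𝓝 y := fun y =>
    (Q.finite_toSet.subset sdiff_subset).isClosed.isOpen_compl.mem_nhds (by simp)
  let D : ∀ y, Disc oC (F y) y (O y) := fun y => ((hF y).exists_disc (hO y)).some
  obtain ⟨T, hT⟩ := isCompact_univ.elim_finite_subcover (fun y => {z | (D y).s z < (D y).t / 3})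
    (fun y => (D y).isOpen _) (fun y _ => mem_iUnion.2 ⟨y, by
      have := (D y).t_pos
      simp only [mem_ofPred_eq, (D y).zero]; positivity⟩)
  let J := T ∪ Q
  have hcov : ∀ y, ∃ j : J, (D j).s y < (D j).t / 3 := fun y => by
    obtain ⟨j, hj, h⟩ := mem_iUnion₂.1 (hT (mem_univ y))
    exact ⟨⟨j, Finset.mem_union_left _ hj⟩, h⟩
  have hJ : 0 < (Fintype.card J : ℝ) := by
    obtain ⟨y⟩ := (inferInstance : Nonempty C)
    obtain ⟨j, -⟩ := hcov y
    exact Nat.cast_pos.2 (Fintype.card_pos_iff.2 ⟨j⟩)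
  set κ : ℝ := M / Fintype.card J with hκdef
  have hκ : 0 < κ := div_pos hM hJ
  have hκJ : κ * Fintype.card J = M := div_mul_cancel₀ _ hJ.ne'
  choose R hR using fun y => hb y (F y) (hF y)
  choose γ hγ using fun y => (hR y).exists_bump_primitive (D y)
  let σ : FormField (𝓡 2) C 2 := fun y => κ • ∑ j : J, (D j).bump y
  let γs : OneForm (𝓡 2) C := κ • ∑ j : J, γ j
  have hγs : ∀ y, RepAt γs y ∧ extd γs y = κ • ∑ j : J, ((D j).bump y - b y) := fun y => by
    have h1 : RepAt (∑ j : J, γ j) y := repAt_sum _ fun j _ => (hγ j y).1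
    refine ⟨h1.const_smul κ, ?_⟩
    refine (extd_const_smul κ h1).trans ?_
    rw [extd_sum (η := fun j : J => γ j) _ fun j _ => (hγ j y).1]
    simp only [(hγ _ y).2]
  let β₀ : OneForm (𝓡 2) C := ∑ q : Q, c q • R q + γs
  let k : C → ℝ := fun q => κ * (3 / (D q).t) / 2
  have hk : ∀ q, 0 < k q := fun q => by
    have := (D q).t_pos
    positivity
  have hσq : ∀ q ∈ Q, ∀ᶠ y in 𝓝 q, σ y = (2 * k q) • area (𝓡 2) (f q) y := by
    intro q hq
    have h1 : ∀ᶠ y in 𝓝 q, ∀ j : J, (j : C) ≠ q → (D j).bump y = 0 := by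
      refine Filter.eventually_all.2 fun j => ?_
      by_cases hj : (j : C) = q
      · exact .of_forall fun y h => absurd hj h
      · refine ((D j).eventually_bump_eq_zero (y := q) ?_).mono fun y h _ => h
        by_contra hlt
        push Not at hlt
        exact (D j).subset q (by linarith [(D j).t_pos]) ⟨hq, fun h => hj h.symm⟩
    filter_upwards [h1, (D q).mem_nhds (t := (D q).t / 3) (by linarith [(D q).t_pos])] with y h1 h2
    have hqJ : q ∈ J := Finset.mem_union_right _ hq
    have : ∑ j : J, (D j).bump y = (D q).bump y :=
      Finset.sum_eq_single (⟨q, hqJ⟩ : J) (fun j _ hj => h1 j fun h => hj (Subtype.ext h)) (by simp)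
    simp only [σ, this, (D q).bump_of_small h2, hFQ q hq, smul_smul, k]
    congr 1
    ring
  have hsum : ∀ y, ∑ q : Q, c q • (-b y) = (-M) • (-b y) := fun y => by
    rw [← Finset.sum_smul, hc]
  have hprim : ∀ q : Q, ∃ G : C → ℝ, SmoothNear (𝓡 2) 𝓘(ℝ, ℝ) G q ∧ ∀ᶠ y in 𝓝 (q : C),
      β₀ y = dR (𝓡 2) G y + (k q • rot (𝓡 2) (f q) y + c q • ang (𝓡 2) (f q) y) := by
    rintro ⟨q, hq⟩
    let S : Q → OneForm (𝓡 2) C := fun q' => if (q' : C) = q then R q - ang (𝓡 2) (f q) else R q'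
    have hSev : ∀ᶠ y in 𝓝 q, ∀ q' : Q, RepAt (S q') y ∧ extd (S q') y = -b y := by
      refine Filter.eventually_all.2 fun q' => ?_
      by_cases h : (q' : C) = q
      · simp only [S, if_pos h]
        filter_upwards [(D q).mem_nhds (D q).t_pos] with y hy
        rw [← hFQ q hq]
        by_cases hyq : y = q
        · rw [hyq]; exact ⟨(hR q).repAt_sub, (hR q).extd_sub_eq⟩
        · have h0 := (D q).f_ne_zero hy hyq
          have r1 := repAt_ang ((D q).smooth_f y hy) h0
          refine ⟨((hR q).repAt y hyq).sub r1, ?_⟩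
          rw [extd_sub ((hR q).repAt y hyq) r1, extd_ang ((D q).smooth_f y hy) h0,
            (hR q).extd_eq y hyq, sub_zero]
      · simp only [S, if_neg h]
        filter_upwards [isOpen_ne.mem_nhds (Ne.symm h)] with y hy
        exact ⟨(hR q').repAt y hy, (hR q').extd_eq y hy⟩
    let θ : OneForm (𝓡 2) C := (∑ q' : Q, c q' • S q' + γs) - k q • rot (𝓡 2) (f q)
    have hθ : ∀ᶠ y in 𝓝 q, RepAt θ y ∧ extd θ y = 0 := by
      filter_upwards [hSev, (hf q hq).smooth.eventually, hσq q hq] with y h1 h2 h3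
      have r1 : RepAt (∑ q' : Q, c q' • S q') y := repAt_sum _ fun q' _ => (h1 q').1.const_smul _
      have r2 : RepAt (k q • rot (𝓡 2) (f q)) y := (repAt_rot h2).const_smul _
      refine ⟨(r1.add (hγs y).1).sub r2, ?_⟩
      rw [extd_sub (r1.add (hγs y).1) r2, extd_add r1 (hγs y).1,
        extd_sum _ fun q' _ => (h1 q').1.const_smul _, extd_const_smul _ (repAt_rot h2),
        extd_rot h2, (hγs y).2]
      have : ∀ q' : Q, extd (c q' • S q') y = c q' • (-b y) := fun q' => by
        rw [extd_const_smul _ (h1 q').1, (h1 q').2]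
      simp only [this]
      rw [hsum, smul_bump_sum κ M hκJ, smul_smul, mul_comm (k q), ← h3]
      exact sub_self _
    obtain ⟨G, hG, hGe⟩ := hθ.self_of_nhds.1.exists_primitive (hθ.mono fun y h => h.2)
    refine ⟨G, hG, ?_⟩
    filter_upwards [hGe] with y hy
    rw [← hy]
    have e : ∑ q' : Q, c q' • R q' = ∑ q' : Q, c q' • S q' + c q • ang (𝓡 2) (f q) := by
      have : ∀ q' : Q, c q' • R q' = c q' • S q' +
          if q' = (⟨q, hq⟩ : Q) then c q • ang (𝓡 2) (f q) else 0 := by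
        intro q'
        by_cases h : q' = (⟨q, hq⟩ : Q)
        · subst h
          simp only [S, if_true]
          rw [← smul_add, sub_add_cancel]
        · have h' : (q' : C) ≠ q := fun h' => h (Subtype.ext h')
          simp only [S, if_neg h', if_neg h, add_zero]
      rw [Finset.sum_congr rfl fun q' _ => this q', Finset.sum_add_distrib, Finset.sum_ite_eq']
      simp
    have e2 : β₀ = θ + (k q • rot (𝓡 2) (f q) + c q • ang (𝓡 2) (f q)) := by
      simp only [β₀, θ, e]
      abel
    rw [e2]
    rfl
  choose G hG hGe using hprim
  choose h hh hhq hhq' using fun q : Q =>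
    exists_cutoff (hf q q.2) (Q : Set C) Q.finite_toSet (hG q)
  let β : OneForm (𝓡 2) C := β₀ - ∑ q : Q, dR (𝓡 2) (h q)
  refine ⟨β, σ, k, fun y hy => ?_, fun y u w huw => ?_, fun q hq => ⟨hk q, ?_, hσq q hq⟩, ?_⟩
  · have hyq : ∀ q : Q, y ≠ q := fun q h => hy (h ▸ q.2)
    have r0 : ∀ q : Q, RepAt (c q • R q) y := fun q => ((hR q).repAt y (hyq q)).const_smul _
    have r1 : RepAt (∑ q : Q, c q • R q) y := repAt_sum _ fun q _ => r0 q
    have r2 : RepAt (∑ q : Q, dR (𝓡 2) (h q)) y := repAt_sum _ fun q _ => repAt_dR (hh q y)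
    refine ⟨(r1.add (hγs y).1).sub r2, ?_⟩
    rw [extd_sub (r1.add (hγs y).1) r2, extd_add r1 (hγs y).1, extd_sum _ fun q _ => r0 q,
      extd_sum _ fun q _ => repAt_dR (hh q y), (hγs y).2]
    have : ∀ q : Q, extd (c q • R q) y = c q • (-b y) := fun q => by
      rw [extd_const_smul _ ((hR q).repAt y (hyq q)), (hR q).extd_eq y (hyq q)]
    simp only [this, extd_dR (hh _ y)]
    rw [hsum, smul_bump_sum κ M hκJ, Finset.sum_const_zero, sub_zero]
  · obtain ⟨j, hj⟩ := hcov y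
    have e : σ y ![u, w] = κ * ∑ j : J, (D j).bump y ![u, w] := by
      simp only [σ, ContinuousAlternatingMap.smul_apply, ContinuousAlternatingMap.sum_apply,
        smul_eq_mul]
    rw [e]
    exact mul_pos hκ (Finset.sum_pos' (fun j _ => (D j).bump_nonneg y u w huw)
      ⟨j, Finset.mem_univ _, (D j).bump_pos hj u w huw⟩)
  · have h1 : ∀ᶠ y in 𝓝 q, ∀ q' : Q, q' ≠ ⟨q, hq⟩ → dR (𝓡 2) (h q') y = 0 := by
      refine Filter.eventually_all.2 fun q' => ?_
      by_cases hqq : q' = ⟨q, hq⟩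
      · exact .of_forall fun y h => absurd hqq h
      · have hne : q ≠ q' := fun h => hqq (Subtype.ext h.symm)
        filter_upwards [(hhq' q' q hq hne).eventually_nhds] with y hy _
        rw [dR_congr hy, dR_const]
    filter_upwards [h1, hGe ⟨q, hq⟩, (hhq ⟨q, hq⟩).eventually_nhds] with y h1 h2 h3
    have e : (∑ q' : Q, dR (𝓡 2) (h q')) y = dR (𝓡 2) (G ⟨q, hq⟩) y := by
      rw [Finset.sum_apply, Finset.sum_eq_single (⟨q, hq⟩ : Q) (fun q' _ hne => h1 q' hne) (by simp),
        dR_congr h3]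
    change β₀ y - (∑ q' : Q, dR (𝓡 2) (h q')) y = _
    rw [h2, e, add_sub_cancel_left]
  · obtain ⟨ν, h1, h2⟩ := exists_areaMeasure_sum (fun j : J => D j) hκ.le
    refine ⟨ν, h1, ?_⟩
    rw [h2, ← mul_assoc, hκJ]
    congr 1
    ring

end BaseForm

section OrthoPos

lemma PosPair.exists_coeff {X : Type*} [AddCommGroup X] [Module ℝ X]
    {o : Orientation ℝ X (Fin 2)} {a b : X} (h : PosPair o a b) (w : X) :
    ∃ x y : ℝ, w = x • a + y • b := by
  obtain ⟨e, rfl, rfl, -⟩ := h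
  exact ⟨e.repr w 0, e.repr w 1, by rw [← Fin.sum_univ_two fun i => e.repr w i • e i, e.sum_repr]⟩

variable {X : Type*} [NormedAddCommGroup X] [InnerProductSpace ℝ X] {o : Orientation ℝ X (Fin 2)}
  {a b u w : X}

lemma PosPair.comb (h : PosPair o a b) {p q r t : ℝ} (hd : 0 < p * t - q * r) :
    PosPair o (p • a + q • b) (r • a + t • b) := by
  obtain ⟨e, rfl, rfl, he⟩ := h
  set v : Fin 2 → X := ![p • e 0 + q • e 1, r • e 0 + t • e 1] with hv
  have hdet : e.det v = p * t - q * r := by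
    rw [Module.Basis.det_apply, Matrix.det_fin_two]
    simp [Module.Basis.toMatrix_apply, hv]
    ring
  obtain ⟨h1, h2⟩ := (Module.Basis.is_basis_iff_det e (v := v)).2 (by rw [hdet]; exact hd.ne'.isUnit)
  refine ⟨Module.Basis.mk h1 h2.ge, by simp [hv], by simp [hv], ?_⟩
  rw [← he, eq_comm, Module.Basis.orientation_eq_iff_det_pos, Module.Basis.coe_mk, hdet]
  exact hd

/-- `(a, b)` is a positive orthonormal basis. -/
structure OrthoPos (o : Orientation ℝ X (Fin 2)) (a b : X) : Prop where
  norm_left : ‖a‖ = 1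
  norm_right : ‖b‖ = 1
  orth : inner ℝ a b = 0
  pos : PosPair o a b

lemma OrthoPos.expand (h : OrthoPos o a b) (w : X) :
    w = inner ℝ a w • a + inner ℝ b w • b := by
  obtain ⟨x, y, rfl⟩ := h.pos.exists_coeff w
  have h1 : inner ℝ b a = 0 := by rw [real_inner_comm]; exact h.orth
  simp only [inner_add_right, inner_smul_right, real_inner_self_eq_norm_sq, h.norm_left,
    h.norm_right, h.orth, h1]
  simp

lemma OrthoPos.norm_sq (h : OrthoPos o a b) (w : X) :
    ‖w‖ ^ 2 = inner ℝ a w ^ 2 + inner ℝ b w ^ 2 := by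
  have : inner ℝ w w = inner ℝ w (inner ℝ a w • a + inner ℝ b w • b) := by rw [← h.expand w]
  rw [real_inner_self_eq_norm_sq, inner_add_right, inner_smul_right, inner_smul_right,
    real_inner_comm a w, real_inner_comm b w] at this
  rw [this]; ring

lemma OrthoPos.area_pos (h : OrthoPos o a b) (huw : PosPair o u w) :
    0 < inner ℝ a u * inner ℝ b w - inner ℝ b u * inner ℝ a w := by
  have h1 : inner ℝ b a = 0 := by rw [real_inner_comm]; exact h.orth
  have := (h.pos.pos_iff huw (wedge (innerSL ℝ a) (innerSL ℝ b))).2 (by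
    simp [wedge_apply, h.norm_left, h.norm_right, h.orth])
  simp only [wedge_apply, innerSL_apply_apply, Matrix.cons_val_zero, Matrix.cons_val_one] at this
  linarith

lemma OrthoPos.unique {b' : X} (h : OrthoPos o a b) (h' : OrthoPos o a b') : b = b' := by
  have e := h.expand b'
  rw [h'.orth, zero_smul, zero_add] at e
  have h1 := h.area_pos h'.pos
  rw [real_inner_self_eq_norm_sq, h.norm_left, h'.orth] at h1
  have h2 : ‖inner ℝ b b' • b‖ = 1 := by rw [← e]; exact h'.norm_right
  rw [norm_smul, h.norm_right, mul_one, Real.norm_eq_abs, abs_of_pos (by linarith)] at h2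
  rw [h2, one_smul] at e
  exact e.symm

lemma OrthoPos.rotate (h : OrthoPos o a b) {c s : ℝ} (hcs : c ^ 2 + s ^ 2 = 1) :
    OrthoPos o (c • a + s • b) (-s • a + c • b) := by
  have h1 : inner ℝ b a = 0 := by rw [real_inner_comm]; exact h.orth
  have n : ∀ x y : ℝ, ‖x • a + y • b‖ ^ 2 = x ^ 2 + y ^ 2 := fun x y => by
    rw [← real_inner_self_eq_norm_sq]
    simp only [inner_add_left, inner_add_right, inner_smul_left, inner_smul_right,
      real_inner_self_eq_norm_sq, h.norm_left, h.norm_right, h.orth, h1]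
    simp
    ring
  have n1 : ∀ x y : ℝ, x ^ 2 + y ^ 2 = 1 → ‖x • a + y • b‖ = 1 := fun x y hxy =>
    (pow_eq_one_iff_of_nonneg (norm_nonneg _) two_ne_zero).1 ((n x y).trans hxy)
  refine ⟨n1 _ _ hcs, n1 _ _ (by rw [← hcs]; ring), ?_, h.pos.comb (by nlinarith)⟩
  simp only [inner_add_left, inner_add_right, inner_smul_left, inner_smul_right,
    real_inner_self_eq_norm_sq, h.norm_left, h.norm_right, h.orth, h1]
  simp
  ring

/-- Gram-Schmidt orthonormalization of a positive pair. -/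
lemma PosPair.orthoPos (h : PosPair o a b) :
    ‖a‖ ≠ 0 ∧ ‖b - (inner ℝ a b * (‖a‖ ^ 2)⁻¹) • a‖ ≠ 0 ∧
      OrthoPos o (‖a‖⁻¹ • a) (‖b - (inner ℝ a b * (‖a‖ ^ 2)⁻¹) • a‖⁻¹ •
        (b - (inner ℝ a b * (‖a‖ ^ 2)⁻¹) • a)) := by
  have hli : LinearIndependent ℝ ![a, b] := by
    obtain ⟨e, rfl, rfl, -⟩ := h
    have : (![e 0, e 1] : Fin 2 → X) = e := by ext i; fin_cases i <;> rfl
    rw [this]; exact e.linearIndependent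
  rw [LinearIndependent.pair_iff] at hli
  set x := inner ℝ a b * (‖a‖ ^ 2)⁻¹
  have ha : ‖a‖ ≠ 0 := fun h0 => by
    have := (hli 1 0 (by simp [norm_eq_zero.1 h0])).1
    exact one_ne_zero this
  have hb : ‖b - x • a‖ ≠ 0 := fun h0 => by
    have := (hli (-x) 1 (by rw [← norm_eq_zero.1 h0]; simp; abel)).2
    exact one_ne_zero this
  refine ⟨ha, hb, by rw [norm_smul, norm_inv, norm_norm, inv_mul_cancel₀ ha],
    by rw [norm_smul, norm_inv, norm_norm, inv_mul_cancel₀ hb], ?_, ?_⟩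
  · rw [inner_smul_left, inner_smul_right, inner_sub_right, inner_smul_right,
      real_inner_self_eq_norm_sq, inv_mul_cancel_right₀ (pow_ne_zero 2 ha)]
    simp
  · have := h.comb (p := ‖a‖⁻¹) (q := 0) (r := -(‖b - x • a‖⁻¹ * x)) (t := ‖b - x • a‖⁻¹)
      (by
        have h1 := inv_pos.2 ((norm_nonneg a).lt_of_ne' ha)
        have h2 := inv_pos.2 ((norm_nonneg (b - x • a)).lt_of_ne' hb)
        nlinarith [mul_pos h1 h2])
    convert this using 1
    · simp
    · rw [smul_sub, smul_smul, neg_smul]; abel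

end OrthoPos

section Frames

variable {C : Type*} [TopologicalSpace C] [ChartedSpace Plane C] [IsManifold (𝓡 2) ∞ C]
  {E : C → Type*} [TopologicalSpace (TotalSpace Plane E)]
  [∀ x, NormedAddCommGroup (E x)] [∀ x, InnerProductSpace ℝ (E x)]
  [FiberBundle Plane E] [VectorBundle ℝ Plane E]
  [ContMDiffVectorBundle ∞ Plane E (𝓡 2)]
  [IsContMDiffRiemannianBundle (𝓡 2) ∞ Plane E]
  {oE : BundleOrientation E} {s t : ∀ x, E x} {y : C}

/-- The section `s` is smooth near `y`. -/
def SmoothSec (s : ∀ x, E x) (y : C) : Prop :=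
  SmoothNear (𝓡 2) totalModel (fun z => TotalSpace.mk' Plane z (s z)) y

lemma SmoothSec.add (hs : SmoothSec s y) (ht : SmoothSec t y) :
    SmoothSec (fun z => s z + t z) y := by
  filter_upwards [hs, ht] with z h1 h2 using ContMDiffAt.add_section h1 h2

lemma SmoothSec.smul {h : C → ℝ} (hh : SmoothNear (𝓡 2) 𝓘(ℝ, ℝ) h y) (hs : SmoothSec s y) :
    SmoothSec (fun z => h z • s z) y := by
  filter_upwards [hh, hs] with z h1 h2 using ContMDiffAt.smul_section h1 h2

lemma SmoothSec.inner_sec (hs : SmoothSec s y) (ht : SmoothSec t y) :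
    SmoothNear (𝓡 2) 𝓘(ℝ, ℝ) (fun z => inner ℝ (s z) (t z)) y := by
  filter_upwards [hs, ht] with z h1 h2
  exact ContMDiffAt.inner_bundle (b := fun z => z) (v := s) (w := t) h1 h2

lemma SmoothSec.congr (hs : SmoothSec s y) (h : ∀ᶠ z in 𝓝 y, t z = s z) : SmoothSec t y :=
  SmoothNear.congr hs (h.mono fun z hz => by simp only [hz])

lemma smoothSec_symm (y : C) (a : Plane) :
    SmoothSec (fun z => (trivializationAt Plane E y).symm z a) y := by
  refine Filter.mem_of_superset ((trivializationAt Plane E y).open_baseSet.mem_nhds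
    (mem_baseSet_trivializationAt Plane E y)) fun z hz => ?_
  have h1 := (trivializationAt Plane E y).contMDiffOn_symm (IB := 𝓡 2) (n := ∞)
  have h2 : ContMDiffAt ((𝓡 2).prod 𝓘(ℝ, Plane)) totalModel ∞
      (trivializationAt Plane E y).toOpenPartialHomeomorph.symm (z, a) := by
    refine h1.contMDiffAt ((trivializationAt Plane E y).open_target.mem_nhds ?_)
    rw [Trivialization.mem_target]; exact hz
  have h3 : ContMDiffAt (𝓡 2) ((𝓡 2).prod 𝓘(ℝ, Plane)) ∞ (fun z : C => (z, a)) z :=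
    contMDiffAt_id.prodMk contMDiffAt_const
  refine (ContMDiffAt.comp z h2 h3).congr_of_eventuallyEq ?_
  filter_upwards [(trivializationAt Plane E y).open_baseSet.mem_nhds hz] with z' hz'
  exact (trivializationAt Plane E y).mk_symm hz' a

lemma SmoothSec.eventually (hs : SmoothSec s y) : ∀ᶠ z in 𝓝 y, SmoothSec s z :=
  SmoothNear.eventually hs

/-- `(e₀, e₁)` is a frame near `y`: smooth, and orthonormal and positive at `y`. -/
structure FrameAt (oE : BundleOrientation E) (e₀ e₁ : ∀ x, E x) (y : C) : Prop where
  smooth_left : SmoothSec e₀ y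
  smooth_right : SmoothSec e₁ y
  ortho : OrthoPos (oE.or y) (e₀ y) (e₁ y)

/-- `(e₀, e₁)` is a positive orthonormal frame in a neighborhood of `y`. -/
def IsFrame (oE : BundleOrientation E) (e₀ e₁ : ∀ x, E x) (y : C) : Prop :=
  ∀ᶠ z in 𝓝 y, FrameAt oE e₀ e₁ z

variable {e₀ e₁ : ∀ x, E x}

lemma IsFrame.at (h : IsFrame oE e₀ e₁ y) : FrameAt oE e₀ e₁ y := Filter.Eventually.self_of_nhds h

lemma IsFrame.eventually (h : IsFrame oE e₀ e₁ y) : ∀ᶠ z in 𝓝 y, IsFrame oE e₀ e₁ z :=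
  eventually_eventually_nhds.2 h

/-- A pair of smooth sections that is positive at `y` gives a frame near `y`. -/
lemma exists_isFrame_of_posPair (hs : SmoothSec s y) (ht : SmoothSec t y)
    (h : ∀ᶠ z in 𝓝 y, PosPair (oE.or z) (s z) (t z)) : ∃ e₀ e₁ : ∀ x, E x, IsFrame oE e₀ e₁ y := by
  let t' : ∀ x, E x := fun z => t z - (inner ℝ (s z) (t z) * (‖s z‖ ^ 2)⁻¹) • s z
  have nrm : ∀ {r : ∀ x, E x} {z : C}, SmoothSec r z → ‖r z‖ ≠ 0 →
      SmoothNear (𝓡 2) 𝓘(ℝ, ℝ) (fun z => ‖r z‖⁻¹) z := by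
    intro r z hr h0
    have h1 : SmoothNear (𝓡 2) 𝓘(ℝ, ℝ) (fun z => Real.sqrt (inner ℝ (r z) (r z))) z :=
      (hr.inner_sec hr).comp_contDiffAt (φ := Real.sqrt) (by
        have : inner ℝ (r z) (r z) ≠ 0 := by
          rw [real_inner_self_eq_norm_sq]; exact pow_ne_zero 2 h0
        filter_upwards [eventually_ne_nhds this] with q hq using Real.contDiffAt_sqrt hq)
    have h2 : SmoothNear (𝓡 2) 𝓘(ℝ, ℝ) (fun z => ‖r z‖) z :=
      h1.congr (.of_forall fun z => norm_eq_sqrt_real_inner _)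
    exact h2.inv h0
  refine ⟨fun z => ‖s z‖⁻¹ • s z, fun z => ‖t' z‖⁻¹ • t' z, ?_⟩
  filter_upwards [h, hs.eventually, ht.eventually] with z hz h1 h2
  obtain ⟨ha, hb, ho⟩ := hz.orthoPos
  have ht' : SmoothSec t' z := by
    have h3 : SmoothNear (𝓡 2) 𝓘(ℝ, ℝ)
        (fun z => -(inner ℝ (s z) (t z) * (‖s z‖ ^ 2)⁻¹)) z := by
      have h4 : SmoothNear (𝓡 2) 𝓘(ℝ, ℝ) (fun z => (‖s z‖ ^ 2)⁻¹) z := by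
        have h5 := (h1.inner_sec h1).inv (by rw [real_inner_self_eq_norm_sq]; exact pow_ne_zero 2 ha)
        exact h5.congr (.of_forall fun z => by
          change (‖s z‖ ^ 2)⁻¹ = (inner ℝ (s z) (s z))⁻¹
          rw [real_inner_self_eq_norm_sq])
      have := ((smoothNear_const (-1 : ℝ) z).mul ((h1.inner_sec h2).mul h4))
      exact this.congr (.of_forall fun z => (neg_one_mul _).symm)
    exact (h2.add (h1.smul h3)).congr (.of_forall fun z => by simp only [t', neg_smul, sub_eq_add_neg])
  exact ⟨h1.smul (nrm h1 ha), ht'.smul (nrm ht' hb), ho⟩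

lemma exists_isFrame (oE : BundleOrientation E) (y : C) : ∃ e₀ e₁ : ∀ x, E x, IsFrame oE e₀ e₁ y := by
  set T := trivializationAt Plane E y
  have hy : y ∈ T.baseSet := mem_baseSet_trivializationAt Plane E y
  have hfin : Module.finrank ℝ (E y) = 2 := by
    rw [(T.continuousLinearEquivAt ℝ y hy).toLinearEquiv.finrank_eq, finrank_euclideanSpace_fin]
  have : FiniteDimensional ℝ (E y) :=
    (T.continuousLinearEquivAt ℝ y hy).toLinearEquiv.symm.finiteDimensional
  obtain ⟨u, w, huw⟩ := exists_posPair hfin (oE.or y)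
  have hs : ∀ u : E y, T.symm y (T.continuousLinearMapAt ℝ y u) = u := fun u =>
    (Trivialization.symmL_apply (R := ℝ) _ hy _).symm.trans
      (Trivialization.symmL_continuousLinearMapAt (R := ℝ) _ hy u)
  exact exists_isFrame_of_posPair (smoothSec_symm y (T.continuousLinearMapAt ℝ y u))
    (smoothSec_symm y (T.continuousLinearMapAt ℝ y w))
    (oE.continuous y _ _ (by rw [hs, hs]; exact huw))

/-- The fiber coordinates given by a frame. -/
def frameMap (e₀ e₁ : ∀ x, E x) (v : TotalSpace Plane E) : Plane :=
  !₂[inner ℝ (e₀ v.1) v.2, inner ℝ (e₁ v.1) v.2]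

/-- The bundle projection. -/
def proj (v : TotalSpace Plane E) : C := v.1

lemma smoothNear_proj (v : TotalSpace Plane E) :
    SmoothNear totalModel (𝓡 2) (proj : TotalSpace Plane E → C) v :=
  ContMDiff.smoothNear (Bundle.contMDiff_proj E) v

lemma SmoothSec.inner_fiber {v : TotalSpace Plane E} (hs : SmoothSec s v.1) :
    SmoothNear totalModel 𝓘(ℝ, ℝ) (fun v : TotalSpace Plane E => inner ℝ (s v.1) v.2) v := by
  have h1 : SmoothNear totalModel totalModel
      (fun v : TotalSpace Plane E => TotalSpace.mk' Plane v.1 (s v.1)) v :=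
    SmoothNear.comp (I' := 𝓡 2) (f := proj) hs (smoothNear_proj v)
  filter_upwards [h1] with w h2
  exact ContMDiffAt.inner_bundle (b := fun v : TotalSpace Plane E => v.1) (v := fun v => s v.1)
    (w := fun v => v.2) h2 contMDiffAt_id

lemma FrameAt.smoothNear {v : TotalSpace Plane E} (h : FrameAt oE e₀ e₁ v.1) :
    SmoothNear totalModel 𝓘(ℝ, Plane) (frameMap e₀ e₁) v :=
  smoothNear_of_co h.smooth_left.inner_fiber h.smooth_right.inner_fiber

lemma contMDiff_sqNorm : ContMDiff totalModel 𝓘(ℝ, ℝ) ∞ (sqNorm (E := E)) := fun v => by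
  have : ContMDiffAt totalModel 𝓘(ℝ, ℝ) ∞
      (fun v : TotalSpace Plane E => inner ℝ v.2 v.2) v :=
    ContMDiffAt.inner_bundle (b := fun v : TotalSpace Plane E => v.1) (v := fun v => v.2)
      (w := fun v => v.2) contMDiffAt_id contMDiffAt_id
  refine this.congr_of_eventuallyEq (.of_forall fun v => ?_)
  exact (real_inner_self_eq_norm_sq _).symm

lemma FrameAt.sqNorm_eq {v : TotalSpace Plane E} (h : FrameAt oE e₀ e₁ v.1) :
    sqNorm v = ‖frameMap e₀ e₁ v‖ ^ 2 := by
  rw [plane_norm_sq]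
  exact h.ortho.norm_sq v.2

lemma IsFrame.sqNorm_eventuallyEq {v : TotalSpace Plane E} (h : IsFrame oE e₀ e₁ v.1) :
    ∀ᶠ w in 𝓝 v, sqNorm w = ‖frameMap e₀ e₁ w‖ ^ 2 :=
  ((smoothNear_proj v).continuousAt.eventually h).mono fun _ hw => FrameAt.sqNorm_eq hw

/-- The section with coordinates `a` in a frame. -/
def frameSec (e₀ e₁ : ∀ x, E x) (a : Plane) (z : C) : E z := a 0 • e₀ z + a 1 • e₁ z

lemma FrameAt.smoothSec_frameSec (h : FrameAt oE e₀ e₁ y) (a : Plane) :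
    SmoothSec (frameSec e₀ e₁ a) y :=
  (h.smooth_left.smul (smoothNear_const _ _)).add (h.smooth_right.smul (smoothNear_const _ _))

lemma OrthoPos.inner_comb {X : Type*} [NormedAddCommGroup X] [InnerProductSpace ℝ X]
    {o : Orientation ℝ X (Fin 2)} {a b : X} (h : OrthoPos o a b) (x y : ℝ) :
    inner ℝ a (x • a + y • b) = x ∧ inner ℝ b (x • a + y • b) = y := by
  have h1 : inner ℝ b a = 0 := by rw [real_inner_comm]; exact h.orth
  constructor <;>
  · rw [inner_add_right, inner_smul_right, inner_smul_right]
    simp [h.orth, h1, h.norm_left, h.norm_right]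

lemma FrameAt.frameMap_frameSec (h : FrameAt oE e₀ e₁ y) (a : Plane) :
    frameMap e₀ e₁ ⟨y, frameSec e₀ e₁ a y⟩ = a := by
  obtain ⟨h1, h2⟩ := h.ortho.inner_comb (a 0) (a 1)
  ext i
  fin_cases i
  · exact h1
  · exact h2

lemma FrameAt.frameSec_frameMap (h : FrameAt oE e₀ e₁ y) (w : E y) :
    frameSec e₀ e₁ (frameMap e₀ e₁ ⟨y, w⟩) y = w :=
  (h.ortho.expand w).symm

end Frames

section TangentTotal

variable {C : Type*} [TopologicalSpace C] [ChartedSpace Plane C] [IsManifold (𝓡 2) ∞ C]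
  {E : C → Type*} [TopologicalSpace (TotalSpace Plane E)]
  [∀ x, NormedAddCommGroup (E x)] [∀ x, InnerProductSpace ℝ (E x)]
  [FiberBundle Plane E] [VectorBundle ℝ Plane E]
  [ContMDiffVectorBundle ∞ Plane E (𝓡 2)]
  [IsContMDiffRiemannianBundle (𝓡 2) ∞ Plane E]
  {oE : BundleOrientation E} {e₀ e₁ : ∀ x, E x}

/-- The derivative of the bundle projection. -/
def dproj (v : TotalSpace Plane E) : TangentSpace totalModel v →L[ℝ] TangentSpace (𝓡 2) v.1 :=
  mfderiv totalModel (𝓡 2) (proj : TotalSpace Plane E → C) v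

lemma contMDiff_fiberIncl (y : C) :
    ContMDiff 𝓘(ℝ, E y) totalModel ∞ (fiberIncl (E := E) y) := fun w => by
  rw [Bundle.contMDiffAt_totalSpace]
  refine ⟨contMDiffAt_const, ?_⟩
  refine ContMDiffAt.congr_of_eventuallyEq (f :=
    (trivializationAt Plane E y).continuousLinearMapAt ℝ y) ?_ (.of_forall fun w' => ?_)
  · exact (ContinuousLinearMap.contDiff _).contMDiff.contMDiffAt
  · exact (Trivialization.continuousLinearMapAt_apply_of_mem (R := ℝ) _
      (mem_baseSet_trivializationAt Plane E y) w').symm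

lemma dproj_vertical (v : TotalSpace Plane E) (w : E v.1) : dproj v (vertical v w) = 0 := by
  have h := mfderiv_comp (I := 𝓘(ℝ, E v.1)) (I' := totalModel) (I'' := 𝓡 2) v.2
    (g := (proj : TotalSpace Plane E → C)) (f := fiberIncl (E := E) v.1)
    (smoothNear_proj v).mdiff ((contMDiff_fiberIncl v.1).contMDiffAt.mdifferentiableAt (by simp))
  have h2 : (proj : TotalSpace Plane E → C) ∘ fiberIncl (E := E) v.1 = fun _ => v.1 := rfl
  rw [h2, mfderiv_const] at h
  exact (DFunLike.congr_fun h w).symm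

lemma FrameAt.planeDeriv_vertical {v : TotalSpace Plane E} (h : FrameAt oE e₀ e₁ v.1) (w : E v.1) :
    planeDeriv totalModel (frameMap e₀ e₁) v (vertical v w) = frameMap e₀ e₁ ⟨v.1, w⟩ := by
  have key := mfderiv_comp (I := 𝓘(ℝ, E v.1)) (I' := totalModel) (I'' := 𝓘(ℝ, Plane)) v.2
    (g := frameMap e₀ e₁) (f := fiberIncl (E := E) v.1)
    h.smoothNear.mdiff ((contMDiff_fiberIncl v.1).contMDiffAt.mdifferentiableAt (by simp))
  let L : E v.1 →L[ℝ] Plane :=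
    (innerSL ℝ (e₀ v.1)).smulRight (EuclideanSpace.single 0 1 : Plane) +
      (innerSL ℝ (e₁ v.1)).smulRight (EuclideanSpace.single 1 1 : Plane)
  have hL : ∀ w : E v.1, L w = frameMap e₀ e₁ ⟨v.1, w⟩ := fun w => by
    ext i; fin_cases i <;> simp [L, frameMap]
  have h2 : frameMap e₀ e₁ ∘ fiberIncl (E := E) v.1 = L := funext fun w => (hL w).symm
  rw [h2, mfderiv_eq_fderiv, L.fderiv] at key
  exact (DFunLike.congr_fun key w).symm.trans (hL w)

/-- A tangent vector of the total space is determined by its projection and by its fiber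
coordinates in a frame, both of which are arbitrary. -/
lemma FrameAt.exists_lift {v : TotalSpace Plane E} (h : FrameAt oE e₀ e₁ v.1)
    (w : TangentSpace (𝓡 2) v.1) (a : Plane) : ∃ X : TangentSpace totalModel v,
      dproj v X = w ∧ planeDeriv totalModel (frameMap e₀ e₁) v X = a := by
  obtain ⟨y, u⟩ := v
  obtain ⟨b, rfl⟩ : ∃ b, u = frameSec e₀ e₁ b y := ⟨_, (h.frameSec_frameMap u).symm⟩
  let v : TotalSpace Plane E := ⟨y, frameSec e₀ e₁ b y⟩
  let τ : C → TotalSpace Plane E := fun z => TotalSpace.mk' Plane z (frameSec e₀ e₁ b z)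
  have hτ : SmoothNear (𝓡 2) totalModel τ y := h.smoothSec_frameSec b
  let X₁ : TangentSpace totalModel v := mfderiv (𝓡 2) totalModel τ y w
  have h1 : dproj v X₁ = w := by
    have k := mfderiv_comp (I := 𝓡 2) (I' := totalModel) (I'' := 𝓡 2) y
      (g := (proj : TotalSpace Plane E → C)) (f := τ) (smoothNear_proj _).mdiff hτ.mdiff
    have k2 : (proj : TotalSpace Plane E → C) ∘ τ = id := rfl
    rw [k2, mfderiv_id] at k
    exact (DFunLike.congr_fun k w).symm
  let X₂ : TangentSpace totalModel v :=
    vertical v (frameSec e₀ e₁ (a - planeDeriv totalModel (frameMap e₀ e₁) v X₁) y)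
  refine ⟨X₁ + X₂, ?_, ?_⟩
  · refine (map_add (dproj v) X₁ X₂).trans ?_
    rw [h1, dproj_vertical]
    exact add_zero (M := Plane) _
  · have e : planeDeriv totalModel (frameMap e₀ e₁) v (X₁ + X₂) =
        planeDeriv totalModel (frameMap e₀ e₁) v X₁ +
          planeDeriv totalModel (frameMap e₀ e₁) v X₂ :=
      map_add (mfderiv totalModel 𝓘(ℝ, Plane) (frameMap e₀ e₁) v) X₁ X₂
    have e2 : planeDeriv totalModel (frameMap e₀ e₁) v X₂ =
        a - planeDeriv totalModel (frameMap e₀ e₁) v X₁ := by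
      refine (FrameAt.planeDeriv_vertical (v := v) h _).trans ?_
      exact h.frameMap_frameSec _
    rw [e, e2]
    abel

lemma FrameAt.eq_zero_of_deriv {v : TotalSpace Plane E} (h : FrameAt oE e₀ e₁ v.1)
    {X : TangentSpace totalModel v} (h1 : dproj v X = 0)
    (h2 : planeDeriv totalModel (frameMap e₀ e₁) v X = 0) : X = 0 := by
  let T : (Plane × Plane) →ₗ[ℝ] (Plane × Plane) :=
    LinearMap.prod (dproj v : TangentSpace totalModel v →ₗ[ℝ] TangentSpace (𝓡 2) v.1)
      (mfderiv totalModel 𝓘(ℝ, Plane) (frameMap e₀ e₁) v :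
        TangentSpace totalModel v →ₗ[ℝ] TangentSpace 𝓘(ℝ, Plane) (frameMap e₀ e₁ v))
  have hsurj : Function.Surjective T := by
    rintro ⟨w, a⟩
    obtain ⟨X, hX1, hX2⟩ := h.exists_lift w a
    exact ⟨X, Prod.ext hX1 hX2⟩
  have hinj := LinearMap.injective_iff_surjective.2 hsurj
  exact hinj (a₂ := (0 : Plane × Plane)) ((Prod.ext h1 h2 : T X = 0).trans (map_zero T).symm)

end TangentTotal

section Twist

variable {E : Type*} [NormedAddCommGroup E] [NormedSpace ℝ E]
  {H : Type*} [TopologicalSpace H] {I : ModelWithCorners ℝ E H}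
  {M : Type*} [TopologicalSpace M] [ChartedSpace H M]
  {E' : Type*} [NormedAddCommGroup E'] [NormedSpace ℝ E']
  {H' : Type*} [TopologicalSpace H'] {I' : ModelWithCorners ℝ E' H'}
  {M' : Type*} [TopologicalSpace M'] [ChartedSpace H' M'] {F f : M → Plane} {x : M}

/-- The complex quotient `F f̄ / |f|`, i.e. `F` turned back by the argument of `f`. -/
def untwist (f F : M → Plane) (y : M) : Plane :=
  !₂[‖f y‖⁻¹ * (f y 0 * F y 0 + f y 1 * F y 1), ‖f y‖⁻¹ * (f y 0 * F y 1 - f y 1 * F y 0)]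

lemma SmoothNear.norm (hf : SmoothNear I 𝓘(ℝ, Plane) f x) (h0 : f x ≠ 0) :
    SmoothNear I 𝓘(ℝ, ℝ) (fun y => ‖f y‖) x :=
  hf.comp_contDiffAt (φ := fun z : Plane => ‖z‖) (by
    filter_upwards [eventually_ne_nhds h0] with q hq using contDiffAt_norm ℝ hq)

lemma rot_untwist (hf : SmoothNear I 𝓘(ℝ, Plane) f x) (hF : SmoothNear I 𝓘(ℝ, Plane) F x)
    (h0 : f x ≠ 0) : rot I (untwist f F) x = rot I F x - ‖F x‖ ^ 2 • ang I f x := by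
  have hn := (hf.norm h0).inv (norm_ne_zero_iff.2 h0)
  set A₀ : M → ℝ := fun y => co f 0 y * co F 0 y + co f 1 y * co F 1 y with hA₀
  set A₁ : M → ℝ := fun y => co f 0 y * co F 1 y - co f 1 y * co F 0 y with hA₁
  have a0 : SmoothNear I 𝓘(ℝ, ℝ) A₀ x := ((hf.co 0).mul (hF.co 0)).add ((hf.co 1).mul (hF.co 1))
  have a1 : SmoothNear I 𝓘(ℝ, ℝ) A₁ x := ((hf.co 0).mul (hF.co 1)).sub ((hf.co 1).mul (hF.co 0))
  have e0 : dR I (co (untwist f F) 0) x =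
      ‖f x‖⁻¹ • dR I A₀ x + A₀ x • dR I (fun y => ‖f y‖⁻¹) x := dR_mul hn.mdiff a0.mdiff
  have e1 : dR I (co (untwist f F) 1) x =
      ‖f x‖⁻¹ • dR I A₁ x + A₁ x • dR I (fun y => ‖f y‖⁻¹) x := dR_mul hn.mdiff a1.mdiff
  have d0 : dR I A₀ x = _ := dR_add ((hf.co 0).mul (hF.co 0)).mdiff ((hf.co 1).mul (hF.co 1)).mdiff
  have d1 : dR I A₁ x = _ := dR_sub ((hf.co 0).mul (hF.co 1)).mdiff ((hf.co 1).mul (hF.co 0)).mdiff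
  rw [dR_mul (hf.co 0).mdiff (hF.co 0).mdiff, dR_mul (hf.co 1).mdiff (hF.co 1).mdiff] at d0
  rw [dR_mul (hf.co 0).mdiff (hF.co 1).mdiff, dR_mul (hf.co 1).mdiff (hF.co 0).mdiff] at d1
  rw [d0] at e0
  rw [d1] at e1
  ext u
  have hnz : ‖f x‖ ≠ 0 := norm_ne_zero_iff.2 h0
  have q0 := DFunLike.congr_fun e0 u
  have q1 := DFunLike.congr_fun e1 u
  change _ = ‖f x‖⁻¹ * (f x 0 * dR I (co F 0) x u + F x 0 * dR I (co f 0) x u +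
    (f x 1 * dR I (co F 1) x u + F x 1 * dR I (co f 1) x u)) +
    (f x 0 * F x 0 + f x 1 * F x 1) * dR I (fun y => ‖f y‖⁻¹) x u at q0
  change _ = ‖f x‖⁻¹ * (f x 0 * dR I (co F 1) x u + F x 1 * dR I (co f 0) x u -
    (f x 1 * dR I (co F 0) x u + F x 0 * dR I (co f 1) x u)) +
    (f x 0 * F x 1 - f x 1 * F x 0) * dR I (fun y => ‖f y‖⁻¹) x u at q1
  change (‖f x‖⁻¹ * (f x 0 * F x 0 + f x 1 * F x 1)) * dR I (co (untwist f F) 1) x u -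
    (‖f x‖⁻¹ * (f x 0 * F x 1 - f x 1 * F x 0)) * dR I (co (untwist f F) 0) x u =
    (F x 0 * dR I (co F 1) x u - F x 1 * dR I (co F 0) x u) -
    ‖F x‖ ^ 2 * ((‖f x‖ ^ 2)⁻¹ * (f x 0 * dR I (co f 1) x u - f x 1 * dR I (co f 0) x u))
  rw [q0, q1, plane_norm_sq (F x)]
  have hi : ‖f x‖⁻¹ ^ 2 * (f x 0 ^ 2 + f x 1 ^ 2) = 1 := by
    rw [← plane_norm_sq, inv_pow, inv_mul_cancel₀ (pow_ne_zero 2 hnz)]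
  rw [← inv_pow]
  generalize ‖f x‖⁻¹ = r at *
  generalize dR I (co F 1) x u = F1'
  generalize dR I (co F 0) x u = F0'
  linear_combination (F x 0 * F1' - F x 1 * F0') * hi

lemma ang_pull {g : M → M'} {f : M' → Plane} (hg : MDifferentiableAt I I' g x)
    (hf : MDifferentiableAt I' 𝓘(ℝ, ℝ) (co f 0) (g x))
    (hf' : MDifferentiableAt I' 𝓘(ℝ, ℝ) (co f 1) (g x)) :
    ang I (fun y => f (g y)) x = pull (I := I) g (ang I' f) x := by
  ext u
  have h0 := DFunLike.congr_fun (dR_pull hf hg) u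
  have h1 := DFunLike.congr_fun (dR_pull hf' hg) u
  change (‖f (g x)‖ ^ 2)⁻¹ * (f (g x) 0 * dR I (fun y => co f 1 (g y)) x u -
    f (g x) 1 * dR I (fun y => co f 0 (g y)) x u) = _
  rw [h0, h1]
  rfl

end Twist

section SectionFrame

variable {C : Type*} [TopologicalSpace C] [ChartedSpace Plane C] [IsManifold (𝓡 2) ∞ C]
  {E : C → Type*} [TopologicalSpace (TotalSpace Plane E)]
  [∀ x, NormedAddCommGroup (E x)] [∀ x, InnerProductSpace ℝ (E x)]
  [FiberBundle Plane E] [VectorBundle ℝ Plane E]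
  [ContMDiffVectorBundle ∞ Plane E (𝓡 2)]
  [IsContMDiffRiemannianBundle (𝓡 2) ∞ Plane E]
  {oC : SurfaceOrientation C} {oE : BundleOrientation E} {e₀ e₁ s : ∀ x, E x} {y : C}

/-- The coordinates of the section `s` in a frame. -/
def secMap (e₀ e₁ s : ∀ x, E x) (y : C) : Plane := frameMap e₀ e₁ ⟨y, s y⟩

/-- The first vector of the frame given by a section without zeros. -/
def secLeft (s : ∀ x, E x) (y : C) : E y := ‖s y‖⁻¹ • s y

open Classical in
/-- The second vector of the frame given by a section without zeros. -/
def secRight (oE : BundleOrientation E) (s : ∀ x, E x) (y : C) : E y :=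
  if h : ∃ b, OrthoPos (oE.or y) (secLeft s y) b then h.choose else 0

lemma FrameAt.smoothNear_secMap (h : FrameAt oE e₀ e₁ y) (hs : SmoothSec s y) :
    SmoothNear (𝓡 2) 𝓘(ℝ, Plane) (secMap e₀ e₁ s) y :=
  smoothNear_of_co (h.smooth_left.inner_sec hs) (h.smooth_right.inner_sec hs)

lemma FrameAt.norm_secMap (h : FrameAt oE e₀ e₁ y) : ‖secMap e₀ e₁ s y‖ = ‖s y‖ := by
  rw [← sq_eq_sq₀ (norm_nonneg _) (norm_nonneg _)]
  exact (FrameAt.sqNorm_eq (v := ⟨y, s y⟩) h).symm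

lemma FrameAt.secMap_ne_zero (h : FrameAt oE e₀ e₁ y) (h0 : s y ≠ 0) : secMap e₀ e₁ s y ≠ 0 := by
  rw [← norm_ne_zero_iff, h.norm_secMap]
  exact norm_ne_zero_iff.2 h0

lemma FrameAt.secLeft_eq (h : FrameAt oE e₀ e₁ y) :
    secLeft s y = (‖secMap e₀ e₁ s y‖⁻¹ * secMap e₀ e₁ s y 0) • e₀ y +
      (‖secMap e₀ e₁ s y‖⁻¹ * secMap e₀ e₁ s y 1) • e₁ y := by
  rw [mul_smul, mul_smul, ← smul_add, h.norm_secMap]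
  exact congrArg _ (h.frameSec_frameMap (s y)).symm

lemma FrameAt.secRight_eq (h : FrameAt oE e₀ e₁ y) (h0 : s y ≠ 0) :
    secRight oE s y = (-(‖secMap e₀ e₁ s y‖⁻¹ * secMap e₀ e₁ s y 1)) • e₀ y +
      (‖secMap e₀ e₁ s y‖⁻¹ * secMap e₀ e₁ s y 0) • e₁ y ∧
    OrthoPos (oE.or y) (secLeft s y) (secRight oE s y) := by
  have hc : (‖secMap e₀ e₁ s y‖⁻¹ * secMap e₀ e₁ s y 0) ^ 2 +
      (‖secMap e₀ e₁ s y‖⁻¹ * secMap e₀ e₁ s y 1) ^ 2 = 1 := by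
    rw [mul_pow, mul_pow, ← mul_add, ← plane_norm_sq, ← mul_pow, inv_mul_cancel₀, one_pow]
    exact norm_ne_zero_iff.2 (h.secMap_ne_zero h0)
  have hr := h.ortho.rotate hc
  rw [← h.secLeft_eq] at hr
  have hex : ∃ b, OrthoPos (oE.or y) (secLeft s y) b := ⟨_, hr⟩
  have e : secRight oE s y = hex.choose := dif_pos hex
  have h2 : OrthoPos (oE.or y) (secLeft s y) (secRight oE s y) := e ▸ hex.choose_spec
  exact ⟨h2.unique hr, h2⟩

lemma FrameAt.frameMap_sec {v : TotalSpace Plane E} (h : FrameAt oE e₀ e₁ v.1) (h0 : s v.1 ≠ 0) :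
    frameMap (secLeft s) (secRight oE s) v =
      untwist (fun v : TotalSpace Plane E => secMap e₀ e₁ s v.1) (frameMap e₀ e₁) v := by
  ext i
  fin_cases i
  · change inner ℝ (secLeft s v.1) v.2 = ‖secMap e₀ e₁ s v.1‖⁻¹ *
      (secMap e₀ e₁ s v.1 0 * inner ℝ (e₀ v.1) v.2 + secMap e₀ e₁ s v.1 1 * inner ℝ (e₁ v.1) v.2)
    rw [h.secLeft_eq, inner_add_left, inner_smul_left, inner_smul_left]
    simp only [RCLike.conj_to_real]
    ring
  · change inner ℝ (secRight oE s v.1) v.2 = ‖secMap e₀ e₁ s v.1‖⁻¹ *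
      (secMap e₀ e₁ s v.1 0 * inner ℝ (e₁ v.1) v.2 - secMap e₀ e₁ s v.1 1 * inner ℝ (e₀ v.1) v.2)
    rw [(h.secRight_eq h0).1, inner_add_left, inner_smul_left, inner_smul_left]
    simp only [RCLike.conj_to_real]
    ring

lemma IsFrame.sec (h : IsFrame oE e₀ e₁ y) (hs : SmoothSec s y) (h0 : s y ≠ 0) :
    IsFrame oE (secLeft s) (secRight oE s) y := by
  have hne : ∀ᶠ z in 𝓝 y, s z ≠ 0 := by
    have hc := (h.at.smoothNear_secMap hs).continuousAt.eventually_ne (h.at.secMap_ne_zero h0)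
    filter_upwards [hc, h] with z hz hf hz0
    have := hf.norm_secMap (s := s)
    rw [hz0, norm_zero] at this
    exact hz (norm_eq_zero.1 this)
  filter_upwards [h.eventually, hs.eventually, hne.eventually_nhds] with z hz hsz hz0
  have hf := hz.at.smoothNear_secMap hsz
  have hz0' : secMap e₀ e₁ s z ≠ 0 := hz.at.secMap_ne_zero hz0.self_of_nhds
  have hn := (hf.norm hz0').inv (norm_ne_zero_iff.2 hz0')
  refine ⟨?_, ?_, (hz.at.secRight_eq hz0.self_of_nhds).2⟩
  · refine SmoothSec.congr ((hz.at.smooth_left.smul (hn.mul (hf.co 0))).add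
      (hz.at.smooth_right.smul (hn.mul (hf.co 1)))) ?_
    filter_upwards [hz] with w hw using hw.secLeft_eq
  · have hneg : SmoothNear (𝓡 2) 𝓘(ℝ, ℝ)
        (fun y => -(‖secMap e₀ e₁ s y‖⁻¹ * secMap e₀ e₁ s y 1)) z :=
      ((smoothNear_const (-1 : ℝ) z).mul (hn.mul (hf.co 1))).congr
        (.of_forall fun w => (neg_one_mul _).symm)
    refine SmoothSec.congr ((hz.at.smooth_left.smul hneg).add
      (hz.at.smooth_right.smul (hn.mul (hf.co 0)))) ?_
    filter_upwards [hz, hz0] with w hw hw0 using (hw.secRight_eq hw0).1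

/-- The angular form of the fiber coordinates given by a section, in terms of a frame. -/
lemma IsFrame.rot_sec {v : TotalSpace Plane E} (h : IsFrame oE e₀ e₁ v.1) (hs : SmoothSec s v.1)
    (h0 : ∀ᶠ z in 𝓝 v.1, s z ≠ 0) :
    rot totalModel (frameMap (secLeft s) (secRight oE s)) v =
      rot totalModel (frameMap e₀ e₁) v -
        sqNorm v • pull (I := totalModel) (proj : TotalSpace Plane E → C)
          (ang (𝓡 2) (secMap e₀ e₁ s)) v := by
  have hf := h.at.smoothNear_secMap hs
  have hp := smoothNear_proj v
  have e : frameMap (secLeft s) (secRight oE s) =ᶠ[𝓝 v]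
      untwist (fun v : TotalSpace Plane E => secMap e₀ e₁ s v.1) (frameMap e₀ e₁) := by
    filter_upwards [hp.continuousAt.eventually (h.and h0)] with w hw
    exact FrameAt.frameMap_sec hw.1 hw.2
  have hf' : SmoothNear totalModel 𝓘(ℝ, Plane)
      (fun v : TotalSpace Plane E => secMap e₀ e₁ s v.1) v :=
    SmoothNear.comp (I' := 𝓡 2) (f := proj) hf hp
  rw [rot_congr e, rot_untwist hf' (h.at.smoothNear (v := v))
    (h.at.secMap_ne_zero h0.self_of_nhds), ← h.at.sqNorm_eq]
  congr 2
  exact ang_pull (I' := 𝓡 2) (g := proj) hp.mdiff (hf.co 0).mdiff (hf.co 1).mdiff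

section Zeros

lemma smoothNear_trivialization (hs : SmoothSec s y) :
    SmoothNear (𝓡 2) 𝓘(ℝ, Plane) (fun z => (trivializationAt Plane E y ⟨z, s z⟩).2) y := by
  have hb := (trivializationAt Plane E y).open_baseSet.mem_nhds
    (mem_baseSet_trivializationAt Plane E y)
  filter_upwards [hs, hb] with z hz hzb
  exact ((trivializationAt Plane E y).contMDiffAt_section_iff (IB := 𝓡 2) (n := ∞) hzb).1 hz

lemma SmoothSec.eventually_eq_symm :
    ∀ᶠ z in 𝓝 y, s z =
      (trivializationAt Plane E y ⟨z, s z⟩).2 0 •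
        (trivializationAt Plane E y).symm z (EuclideanSpace.single 0 1) +
      (trivializationAt Plane E y ⟨z, s z⟩).2 1 •
        (trivializationAt Plane E y).symm z (EuclideanSpace.single 1 1) := by
  filter_upwards [(trivializationAt Plane E y).open_baseSet.mem_nhds
    (mem_baseSet_trivializationAt Plane E y)] with z hz
  set T := trivializationAt Plane E y
  have h1 : T.symmL ℝ z (T ⟨z, s z⟩).2 = s z := by
    rw [Trivialization.symmL_apply (R := ℝ) _ hz]
    exact T.symm_apply_apply_mk hz (s z)
  conv_lhs => rw [← h1]
  rw [clm_plane_apply, Trivialization.symmL_apply (R := ℝ) _ hz,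
    Trivialization.symmL_apply (R := ℝ) _ hz]

/-- At a zero of `s`, the derivative of `s` in a frame is given by the vertical derivative. -/
lemma FrameAt.planeDeriv_secMap (h : FrameAt oE e₀ e₁ y) (hs : SmoothSec s y) (h0 : s y = 0)
    (u : TangentSpace (𝓡 2) y) :
    planeDeriv (𝓡 2) (secMap e₀ e₁ s) y u = frameMap e₀ e₁ ⟨y, vertDeriv s y u⟩ := by
  set T := trivializationAt Plane E y
  have hy : y ∈ T.baseSet := mem_baseSet_trivializationAt Plane E y
  have hσ := smoothNear_trivialization hs
  set σ : C → Plane := fun z => (T ⟨z, s z⟩).2 with hσd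
  have hσ0 : σ y = 0 := by
    simp only [hσd, h0]
    have := (T.continuousLinearMapAt ℝ y).map_zero
    rwa [Trivialization.continuousLinearMapAt_apply_of_mem (R := ℝ) _ hy] at this
  have key : ∀ e : ∀ x, E x, SmoothSec e y →
      dR (𝓡 2) (fun z => inner ℝ (e z) (s z)) y u = inner ℝ (e y) (vertDeriv s y u) := by
    intro e he
    have hT := fun a : Plane => he.inner_sec (smoothSec_symm (E := E) y a)
    have e1 : (fun z => inner ℝ (e z) (s z)) =ᶠ[𝓝 y] fun z =>
        co σ 0 z * inner ℝ (e z) (T.symm z (EuclideanSpace.single 0 1)) +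
        co σ 1 z * inner ℝ (e z) (T.symm z (EuclideanSpace.single 1 1)) := by
      filter_upwards [SmoothSec.eventually_eq_symm (s := s) (y := y)] with z hz
      conv_lhs => rw [hz]
      rw [inner_add_right, inner_smul_right, inner_smul_right]
      rfl
    rw [dR_congr e1, dR_add ((hσ.co 0).mul (hT _)).mdiff ((hσ.co 1).mul (hT _)).mdiff,
      dR_mul (hσ.co 0).mdiff (hT _).mdiff, dR_mul (hσ.co 1).mdiff (hT _).mdiff]
    have c0 : ∀ i, co σ i y = 0 := fun i => by change σ y i = 0; rw [hσ0]; rfl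
    rw [c0, c0, zero_smul, zero_smul, zero_add, zero_add]
    have e2 : vertDeriv s y u = planeDeriv (𝓡 2) σ y u 0 • T.symm y (EuclideanSpace.single 0 1) +
        planeDeriv (𝓡 2) σ y u 1 • T.symm y (EuclideanSpace.single 1 1) := by
      have : vertDeriv s y u = T.symmL ℝ y (planeDeriv (𝓡 2) σ y u) :=
        (Trivialization.symmL_apply (R := ℝ) _ hy _).symm
      rw [this, clm_plane_apply, Trivialization.symmL_apply (R := ℝ) _ hy,
        Trivialization.symmL_apply (R := ℝ) _ hy]
    rw [e2, inner_add_right, inner_smul_right, inner_smul_right, planeDeriv_apply hσ.mdiff,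
      planeDeriv_apply hσ.mdiff]
    change inner ℝ (e y) (T.symm y (EuclideanSpace.single 0 1)) * dR (𝓡 2) (co σ 0) y u +
      inner ℝ (e y) (T.symm y (EuclideanSpace.single 1 1)) * dR (𝓡 2) (co σ 1) y u = _
    ring
  ext i
  rw [planeDeriv_apply (h.smoothNear_secMap hs).mdiff]
  fin_cases i
  · exact key e₀ h.smooth_left
  · exact key e₁ h.smooth_right

lemma FrameAt.area_secMap_pos (h : FrameAt oE e₀ e₁ y) (hs : SmoothSec s y) (h0 : s y = 0)
    {u w : TangentSpace (𝓡 2) y}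
    (huw : PosPair (oE.or y) (vertDeriv s y u) (vertDeriv s y w)) :
    0 < area (𝓡 2) (secMap e₀ e₁ s) y ![u, w] := by
  rw [area_apply (h.smoothNear_secMap hs).mdiff, h.planeDeriv_secMap hs h0,
    h.planeDeriv_secMap hs h0]
  exact h.ortho.area_pos huw

/-- The complex conjugate of `f`. -/
def conj {M : Type*} (f : M → Plane) (y : M) : Plane := !₂[f y 0, -f y 1]

lemma co_conj_one (f : C → Plane) : co (conj f) 1 = fun y => (-1 : ℝ) * co f 1 y :=
  funext fun _ => (neg_one_mul _).symm

lemma SmoothNear.conj {f : C → Plane} (hf : SmoothNear (𝓡 2) 𝓘(ℝ, Plane) f y) :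
    SmoothNear (𝓡 2) 𝓘(ℝ, Plane) (conj f) y :=
  smoothNear_of_co (hf.co 0)
    (((smoothNear_const (-1 : ℝ) y).mul (hf.co 1)).congr (.of_forall fun _ => (neg_one_mul _).symm))

lemma dR_co_conj_one {f : C → Plane} (hf : SmoothNear (𝓡 2) 𝓘(ℝ, Plane) f y) :
    dR (𝓡 2) (co (conj f) 1) y = (-1 : ℝ) • dR (𝓡 2) (co f 1) y := by
  rw [co_conj_one, dR_mul (smoothNear_const (-1 : ℝ) y).mdiff (hf.co 1).mdiff, dR_const, smul_zero,
    add_zero]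

lemma area_conj {f : C → Plane} (hf : SmoothNear (𝓡 2) 𝓘(ℝ, Plane) f y)
    (u w : TangentSpace (𝓡 2) y) :
    area (𝓡 2) (conj f) y ![u, w] = area (𝓡 2) f y ![w, u] := by
  change dR (𝓡 2) (co f 0) y u * dR (𝓡 2) (co (conj f) 1) y w -
    dR (𝓡 2) (co f 0) y w * dR (𝓡 2) (co (conj f) 1) y u =
    dR (𝓡 2) (co f 0) y w * dR (𝓡 2) (co f 1) y u - dR (𝓡 2) (co f 0) y u * dR (𝓡 2) (co f 1) y w
  have h1 : ∀ u, dR (𝓡 2) (co (conj f) 1) y u = -1 * dR (𝓡 2) (co f 1) y u := fun u =>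
    DFunLike.congr_fun (dR_co_conj_one hf) u
  rw [h1, h1]
  ring

lemma ang_conj {f : C → Plane} (hf : SmoothNear (𝓡 2) 𝓘(ℝ, Plane) f y) :
    ang (𝓡 2) (conj f) y = (-1 : ℝ) • ang (𝓡 2) f y := by
  ext u
  have h1 : ∀ u, dR (𝓡 2) (co (conj f) 1) y u = -1 * dR (𝓡 2) (co f 1) y u := fun u =>
    DFunLike.congr_fun (dR_co_conj_one hf) u
  change (‖conj f y‖ ^ 2)⁻¹ * (f y 0 * dR (𝓡 2) (co (conj f) 1) y u -
    -f y 1 * dR (𝓡 2) (co f 0) y u) = -1 * ((‖f y‖ ^ 2)⁻¹ *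
      (f y 0 * dR (𝓡 2) (co f 1) y u - f y 1 * dR (𝓡 2) (co f 0) y u))
  have h2 : ‖conj f y‖ ^ 2 = ‖f y‖ ^ 2 := by
    rw [plane_norm_sq, plane_norm_sq]
    change f y 0 ^ 2 + (-f y 1) ^ 2 = _
    ring
  rw [h1, h2]
  ring

lemma PosPair.not_swap {X : Type*} [AddCommGroup X] [Module ℝ X] {o : Orientation ℝ X (Fin 2)}
    {u w : X} (h : PosPair o u w) : ¬ PosPair o w u := by
  obtain ⟨b, rfl, rfl, rfl⟩ := h
  rintro ⟨b', h0, h1, h⟩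
  rw [Module.Basis.orientation_eq_iff_det_pos] at h
  have e : (b : Fin 2 → X) = b' ∘ Equiv.swap 0 1 := by
    ext i
    fin_cases i
    · simp [h1]
    · simp [h0]
  rw [e, AlternatingMap.map_swap _ _ (by decide), Module.Basis.det_self] at h
  linarith

/-- A section as in the definition of the degree, with coordinates at its zeros. -/
theorem HasDegree.exists_section {d : ℤ} (h : HasDegree oC oE d) :
    ∃ (s : ∀ x, E x) (Z : Finset C) (ε : C → ℝ), (∀ y, SmoothSec s y) ∧ (∀ y, s y = 0 ↔ y ∈ Z) ∧
      ∑ z ∈ Z, ε z = d ∧ (∀ z ∈ Z, ∀ e₀ e₁ : ∀ x, E x, IsFrame oE e₀ e₁ z →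
        ∃ f : C → Plane, IsCoord oC f z ∧
          ∀ᶠ y in 𝓝 z, ang (𝓡 2) (secMap e₀ e₁ s) y = ε z • ang (𝓡 2) f y) := by
  classical
  obtain ⟨s, P, N, hs, h0, hP, hN, hd⟩ := h
  have hs' : ∀ y, SmoothSec s y := fun y => ContMDiff.smoothNear hs y
  have hdisj : Disjoint P N := Finset.disjoint_left.2 fun z hzP hzN => by
    obtain ⟨u, w, huw⟩ := exists_posPair_tangent oC z
    exact (hP z hzP u w huw).not_swap (hN z hzN u w huw)
  have hz : ∀ y, s y = 0 ↔ y ∈ P ∪ N := fun y => by rw [h0, Finset.mem_union]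
  refine ⟨s, P ∪ N, fun z => if z ∈ P then 1 else -1, hs', hz, ?_, fun z hzZ e₀ e₁ he => ?_⟩
  · rw [Finset.sum_union hdisj, Finset.sum_congr rfl fun z hz => if_pos hz,
      Finset.sum_congr rfl (s₁ := N) fun z hz => if_neg (Finset.disjoint_right.1 hdisj hz), ← hd]
    simp [sub_eq_add_neg]
  · have hf := he.at.smoothNear_secMap (hs' z)
    have hf0 : secMap e₀ e₁ s z = 0 := by
      rw [← norm_eq_zero, he.at.norm_secMap, (hz z).2 hzZ, norm_zero]
    by_cases hzP : z ∈ P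
    · refine ⟨secMap e₀ e₁ s, ⟨hf, hf0, fun u w huw =>
        he.at.area_secMap_pos (hs' z) ((hz z).2 hzZ) (hP z hzP u w huw)⟩, .of_forall fun y => ?_⟩
      simp only [if_pos hzP, one_smul]
    · have hzN : z ∈ N := (Finset.mem_union.1 hzZ).resolve_left hzP
      refine ⟨conj (secMap e₀ e₁ s), ⟨hf.conj, ?_, fun u w huw => ?_⟩, ?_⟩
      · ext i
        fin_cases i <;> simp [conj, hf0]
      · rw [area_conj hf]
        exact he.at.area_secMap_pos (hs' z) ((hz z).2 hzZ) (hN z hzN u w huw)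
      · filter_upwards [hf.eventually] with y hy
        simp only [if_neg hzP]
        rw [ang_conj hy, smul_smul]
        norm_num

end Zeros

end SectionFrame

section Connection

variable {C : Type*} [TopologicalSpace C] [ChartedSpace Plane C] [IsManifold (𝓡 2) ∞ C]
  {E : C → Type*} [TopologicalSpace (TotalSpace Plane E)]
  [∀ x, NormedAddCommGroup (E x)] [∀ x, InnerProductSpace ℝ (E x)]
  [FiberBundle Plane E] [VectorBundle ℝ Plane E]
  [ContMDiffVectorBundle ∞ Plane E (𝓡 2)]
  [IsContMDiffRiemannianBundle (𝓡 2) ∞ Plane E]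
  {oC : SurfaceOrientation C} {oE : BundleOrientation E}

/-- The form `ρ (dφ + p^* η)`, where `ρ` is the squared norm and `φ` is the angular coordinate in
the frame. -/
def connForm (e₀ e₁ : ∀ x, E x) (η : OneForm (𝓡 2) C) : OneForm totalModel (TotalSpace Plane E) :=
  fun v => rot totalModel (frameMap e₀ e₁) v +
    sqNorm v • pull (I := totalModel) (proj : TotalSpace Plane E → C) η v

/-- A metric connection, given near each point by a frame and the connection form in this frame. -/
structure Conn (oE : BundleOrientation E) where
  left : C → ∀ x, E x
  right : C → ∀ x, E x
  form : C → OneForm (𝓡 2) C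
  frame : ∀ y, IsFrame oE (left y) (right y) y
  repAt : ∀ y, RepAt (form y) y
  compat : ∀ y, ∀ᶠ z in 𝓝 y, ∀ v : TotalSpace Plane E, v.1 = z →
    connForm (left z) (right z) (form z) v = connForm (left y) (right y) (form y) v
  compat_extd : ∀ y, ∀ᶠ z in 𝓝 y, extd (form z) z = extd (form y) z

/-- A sum of angular forms of the coordinates `f z`, cut off near the points `z`. -/
lemma exists_sum_ang [T2Space C] (Q Z : Finset C) (f : C → C → Plane)
    (hf : ∀ z ∈ Z, IsCoord oC (f z) z) (ε : C → ℝ) :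
    ∃ η : OneForm (𝓡 2) C, (∀ y, y ∉ Z → RepAt η y) ∧
      (∀ q ∈ Q, q ∉ Z → ∀ᶠ y in 𝓝 q, η y = 0) ∧
      ∀ z ∈ Z, ∀ᶠ y in 𝓝 z, η y = ε z • ang (𝓡 2) (f z) y := by
  classical
  let O : C → Set C := fun z => {y | y ∈ Q ∪ Z → y = z}
  have hO : ∀ z, O z ∈ 𝓝 z := fun z => by
    have h1 : (((Q ∪ Z).erase z : Finset C) : Set C)ᶜ ∈ 𝓝 z :=
      (Finset.finite_toSet _).isClosed.isOpen_compl.mem_nhds (by simp)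
    refine Filter.mem_of_superset h1 fun y hy hyQ => ?_
    by_contra hne
    exact hy (Finset.mem_coe.2 (Finset.mem_erase.2 ⟨hne, hyQ⟩))
  let D : ∀ z : Z, Disc oC (f z) z (O z) := fun z => ((hf z z.2).exists_disc (hO z)).some
  let h : Z → C → ℝ := fun z y => 1 - step ((D z).t / 3) (2 * (D z).t / 3) ((D z).s y)
  have ht : ∀ z : Z, (D z).t / 3 < 2 * (D z).t / 3 := fun z => by linarith [(D z).t_pos]
  have hs : ∀ (z : Z) y, SmoothNear (𝓡 2) 𝓘(ℝ, ℝ) (h z) y := fun z y =>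
    (smoothNear_const (1 : ℝ) y).sub (smoothNear_step (D z).smooth _ _ y)
  have hzero : ∀ (z : Z) y, 2 * (D z).t / 3 < (D z).s y → ∀ᶠ w in 𝓝 y, h z w = 0 := fun z y hy => by
    filter_upwards [((D z).smooth.continuous.tendsto y).eventually (lt_mem_nhds hy)] with w hw
    change 1 - step _ _ _ = 0
    rw [step_of_ge (ht z) hw.le, sub_self]
  have hone : ∀ z : Z, ∀ᶠ w in 𝓝 (z : C), h z w = 1 := fun z => by
    filter_upwards [(D z).mem_nhds (show 0 < (D z).t / 3 by linarith [(D z).t_pos])] with w hw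
    change 1 - step _ _ _ = 1
    rw [step_of_le (ht z) (le_of_lt hw), sub_zero]
  have hfar : ∀ (z : Z) q, q ∈ Q ∪ Z → q ≠ z → ∀ᶠ w in 𝓝 q, h z w = 0 := fun z q hq hne => by
    refine hzero z q ?_
    by_contra hlt
    exact hne ((D z).subset q (by linarith [(D z).t_pos]) hq)
  let θ : Z → OneForm (𝓡 2) C := fun z y => (ε z * h z y) • ang (𝓡 2) (f z) y
  have hθ0 : ∀ (z : Z) y, (∀ᶠ w in 𝓝 y, h z w = 0) → ∀ᶠ w in 𝓝 y, θ z w = 0 := fun z y hy => by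
    filter_upwards [hy] with w hw
    change (ε z * h z w) • _ = _
    rw [hw, mul_zero, zero_smul]
  have happ : ∀ y, (∑ z : Z, θ z) y = ∑ z : Z, θ z y := fun y => Finset.sum_apply _ _ _
  refine ⟨∑ z : Z, θ z, fun y hy => repAt_sum _ fun z _ => ?_, fun q hq hqZ => ?_, fun z hz => ?_⟩
  · by_cases hlt : (D z).s y < (D z).t
    · have hne : y ≠ z := fun e => hy (e ▸ z.2)
      exact (repAt_ang ((D z).smooth_f y hlt) ((D z).f_ne_zero hlt hne)).fsmul
        ((smoothNear_const (ε z) y).mul (hs z y))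
    · exact repAt_zero.congr (hθ0 z y (hzero z y (by linarith [(D z).t_pos])))
  · have : ∀ᶠ y in 𝓝 q, ∀ z : Z, θ z y = 0 := Filter.eventually_all.2 fun z =>
      hθ0 z q (hfar z q (Finset.mem_union_left _ hq) fun e => hqZ (e ▸ z.2))
    filter_upwards [this] with y hy
    rw [happ]
    exact Finset.sum_eq_zero fun z _ => hy z
  · have : ∀ᶠ y in 𝓝 z, ∀ z' : Z, z' ≠ ⟨z, hz⟩ → θ z' y = 0 := Filter.eventually_all.2 fun z' => by
      by_cases e : z' = ⟨z, hz⟩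
      · exact .of_forall fun y h => absurd e h
      · filter_upwards [hθ0 z' z (hfar z' z (Finset.mem_union_right _ hz) fun h =>
          e (Subtype.ext h.symm))] with y hy _ using hy
    filter_upwards [this, hone ⟨z, hz⟩] with y hy h1
    rw [happ, Finset.sum_eq_single ⟨z, hz⟩ (fun z' _ hne => hy z' hne)
      fun h => absurd (Finset.mem_univ _) h]
    change (ε z * h ⟨z, hz⟩ y) • _ = _
    rw [h1, mul_one]

lemma IsCoord.eventually_ne_zero [T2Space C] {f : C → Plane} {z : C} (h : IsCoord oC f z) :
    ∀ᶠ y in 𝓝 z, y ≠ z → f y ≠ 0 := by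
  obtain ⟨D⟩ := h.exists_disc Filter.univ_mem
  filter_upwards [D.mem_nhds D.t_pos] with y hy hne using D.f_ne_zero hy hne

open Classical in
/-- A bundle of degree `d` has a connection that is given by the angular forms of coordinates near
finitely many points and is flat near these points. -/
theorem HasDegree.exists_conn [T2Space C] {d : ℤ} (h : HasDegree oC oE d) (Q₀ : Finset C) :
    ∃ (Q : Finset C) (𝒟 : Conn oE) (f : C → C → Plane) (ε : C → ℝ) (η : OneForm (𝓡 2) C),
      Q₀ ⊆ Q ∧ (∀ q ∈ Q, IsCoord oC (f q) q) ∧ ∑ q ∈ Q, ε q = d ∧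
      (∀ q ∈ Q, (∀ᶠ y in 𝓝 q, η y = ε q • ang (𝓡 2) (f q) y) ∧ ∀ᶠ y in 𝓝 q, 𝒟.form q y = 0) ∧
      ∀ y, y ∉ Q → 𝒟.form y = η := by
  obtain ⟨s, Z, ε, hs, h0, hd, hcoord⟩ := h.exists_section
  choose E₀ E₁ hE using fun y => exists_isFrame oE y
  have hex : ∀ q, ∃ f : C → Plane, IsCoord oC f q ∧ (q ∈ Z →
      ∀ᶠ y in 𝓝 q, ang (𝓡 2) (secMap (E₀ q) (E₁ q) s) y = ε q • ang (𝓡 2) f y) := fun q => by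
    by_cases hq : q ∈ Z
    · obtain ⟨f, h1, h2⟩ := hcoord q hq _ _ (hE q)
      exact ⟨f, h1, fun _ => h2⟩
    · obtain ⟨f, h1⟩ := exists_isCoord oC q
      exact ⟨f, h1, fun hq' => absurd hq' hq⟩
  choose f hf hfang using hex
  obtain ⟨η, hη, hηQ, hηZ⟩ := exists_sum_ang (oC := oC) (Q₀ ∪ Z) Z f (fun z _ => hf z) ε
  have hZc : ∀ y, y ∉ Z → ∀ᶠ z in 𝓝 y, z ∉ Z := fun y hy =>
    (Finset.finite_toSet Z).isClosed.isOpen_compl.mem_nhds hy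
  have hZp : ∀ y, ∀ᶠ z in 𝓝 y, z ≠ y → z ∉ Z := fun y => by
    have h1 : ((Z.erase y : Finset C) : Set C)ᶜ ∈ 𝓝 y :=
      (Finset.finite_toSet _).isClosed.isOpen_compl.mem_nhds (by simp)
    filter_upwards [h1] with z hz hne hzZ
    exact hz (Finset.mem_coe.2 (Finset.mem_erase.2 ⟨hne, hzZ⟩))
  let 𝒟 : Conn oE :=
    { left := fun y => if y ∈ Z then E₀ y else secLeft s
      right := fun y => if y ∈ Z then E₁ y else secRight oE s
      form := fun y => if y ∈ Z then 0 else η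
      frame := fun y => by
        by_cases hy : y ∈ Z
        · simp only [if_pos hy]; exact hE y
        · simp only [if_neg hy]; exact (hE y).sec (hs y) (fun e => hy ((h0 y).1 e))
      repAt := fun y => by
        by_cases hy : y ∈ Z
        · simp only [if_pos hy]; exact repAt_zero
        · simp only [if_neg hy]; exact hη y hy
      compat := fun y => by
        by_cases hy : y ∈ Z
        · filter_upwards [hZp y, hηZ y hy, hfang y hy, (hE y).eventually] with z hz h1 h2 h3 v hv
          subst hv
          by_cases hne : v.1 = y
          · rw [hne]
          · have hvZ := hz hne
            simp only [if_pos hy, if_neg hvZ]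
            have h4 : ∀ᶠ z in 𝓝 v.1, s z ≠ 0 :=
              (hZc _ hvZ).mono fun z hz e => hz ((h0 z).1 e)
            have e := h3.rot_sec (v := v) (hs v.1) h4
            have e2 : η (proj v) = ang (𝓡 2) (secMap (E₀ y) (E₁ y) s) (proj v) := h1.trans h2.symm
            simp only [connForm]
            rw [e]
            simp only [pull]
            rw [e2]
            simp only [Pi.zero_apply, ContinuousLinearMap.zero_comp]
            rw [sub_add_cancel, smul_zero]
            exact (add_zero _).symm
        · filter_upwards [hZc y hy] with z hz v _
          simp only [if_neg hy, if_neg hz]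
      compat_extd := fun y => by
        by_cases hy : y ∈ Z
        · filter_upwards [hZp y, (hηZ y hy).eventually_nhds, (hf y).eventually_ne_zero,
            (hf y).smooth.eventually] with z hz h1 h2 h3
          by_cases hne : z = y
          · rw [hne]
          · simp only [if_pos hy, if_neg (hz hne)]
            rw [extd_zero, extd_congr ((repAt_ang h3 (h2 hne)).const_smul (ε y)) h1,
              extd_const_smul _ (repAt_ang h3 (h2 hne)), extd_ang h3 (h2 hne)]
            exact smul_zero _
        · filter_upwards [hZc y hy] with z hz
          simp only [if_neg hy, if_neg hz] }
  refine ⟨Q₀ ∪ Z, 𝒟, f, fun q => if q ∈ Z then ε q else 0, η, Finset.subset_union_left,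
    fun q _ => hf q, ?_, fun q hq => ?_, fun y hy => ?_⟩
  · rw [← hd, Finset.sum_ite_mem, Finset.inter_eq_right.2 Finset.subset_union_right]
  · by_cases hqZ : q ∈ Z
    · simp only [𝒟, if_pos hqZ]
      exact ⟨hηZ q hqZ, .of_forall fun _ => rfl⟩
    · simp only [𝒟, if_neg hqZ, zero_smul]
      exact ⟨hηQ q hq hqZ, hηQ q hq hqZ⟩
  · have : y ∉ Z := fun h => hy (Finset.mem_union_right _ h)
    simp only [𝒟, if_neg this]

end Connection

section PlaneForms

variable {C : Type*} [TopologicalSpace C] [ChartedSpace Plane C] [IsManifold (𝓡 2) ∞ C]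
  {oC : SurfaceOrientation C} {S : FormField (𝓡 2) C 2} {y : C}

lemma alt_two_comb {X : Type*} [AddCommGroup X] [Module ℝ X] [TopologicalSpace X]
    (F : X [⋀^Fin 2]→L[ℝ] ℝ) (a b : X) (p q r t : ℝ) :
    F ![p • a + q • b, r • a + t • b] = (p * t - q * r) * F ![a, b] := by
  have hz : ∀ c : X, F ![c, c] = 0 := fun c => F.map_eq_zero_of_eq _ (i := 0) (j := 1) rfl (by decide)
  have hl : ∀ c d e : X, F ![c + d, e] = F ![c, e] + F ![d, e] := fun c d e =>
    F.map_vecCons_add (m := ![e]) c d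
  have hls : ∀ (k : ℝ) (c e : X), F ![k • c, e] = k * F ![c, e] := fun k c e =>
    F.map_vecCons_smul (m := ![e]) k c
  have hsw : ∀ c d : X, F ![d, c] = -F ![c, d] := fun c d => by
    have h := hz (c + d)
    have h1 : F ![c + d, c + d] = F ![c, c + d] + F ![d, c + d] := hl _ _ _
    have e : F (![c, d] ∘ Equiv.swap 0 1) = -F ![c, d] :=
      F.toAlternatingMap.map_swap ![c, d] (by decide)
    rw [← e]
    congr 1
    ext i
    fin_cases i <;> simp
  have hr : ∀ c d e : X, F ![e, c + d] = F ![e, c] + F ![e, d] := fun c d e => by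
    rw [hsw, hl, hsw e c, hsw e d]; ring
  have hrs : ∀ (k : ℝ) (c e : X), F ![e, k • c] = k * F ![e, c] := fun k c e => by
    rw [hsw, hls, hsw e c]; ring
  rw [hl, hr, hr, hls, hls, hls, hls, hrs, hrs, hrs, hrs, hz, hz, hsw a b]
  ring

lemma PosForm.exists_dual (h : PosForm oC S y) (ℓ : TangentSpace (𝓡 2) y →L[ℝ] ℝ) :
    ∃ b, ∀ w, S y ![b, w] = ℓ w := by
  obtain ⟨u, w, huw⟩ := exists_posPair_tangent oC y
  have h0 := (h u w huw).ne'
  refine ⟨(ℓ w / S y ![u, w]) • u + (-(ℓ u / S y ![u, w])) • w, fun z => ?_⟩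
  obtain ⟨r, t, rfl⟩ := huw.exists_coeff z
  have e : ℓ (r • u + t • w) = r * ℓ u + t * ℓ w := by
    rw [map_add, map_smul, map_smul]; rfl
  rw [alt_two_comb, e]
  field_simp
  ring

lemma PosForm.eq_zero (h : PosForm oC S y) {b : TangentSpace (𝓡 2) y}
    (hb : ∀ w, S y ![b, w] = 0) : b = 0 := by
  obtain ⟨u, w, huw⟩ := exists_posPair_tangent oC y
  have h0 := (h u w huw).ne'
  obtain ⟨p, q, rfl⟩ := huw.exists_coeff b
  have h1 := hb ((1 : ℝ) • u + (0 : ℝ) • w)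
  have h2 := hb ((0 : ℝ) • u + (1 : ℝ) • w)
  rw [alt_two_comb] at h1 h2
  have hp : p = 0 := by
    have := (mul_eq_zero.1 h2).resolve_right h0
    linarith
  have hq : q = 0 := by
    have := (mul_eq_zero.1 h1).resolve_right h0
    linarith
  rw [hp, hq, zero_smul, zero_smul, add_zero]

lemma stdArea_left_cancel {a b : Plane} (h : ∀ w, stdArea a w = stdArea b w) : a = b := by
  have h0 := h (EuclideanSpace.single 0 1)
  have h1 := h (EuclideanSpace.single 1 1)
  simp [stdArea] at h0 h1
  ext i
  fin_cases i
  · exact h1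
  · exact h0

lemma stdArea_smul_left (c : ℝ) (a b : Plane) : stdArea (c • a) b = c * stdArea a b := by
  change c * a 0 * b 1 - c * a 1 * b 0 = c * (a 0 * b 1 - a 1 * b 0)
  ring

end PlaneForms

section Symplectic

variable {C : Type*} [TopologicalSpace C] [ChartedSpace Plane C] [IsManifold (𝓡 2) ∞ C]
  {E : C → Type*} [TopologicalSpace (TotalSpace Plane E)]
  [∀ x, NormedAddCommGroup (E x)] [∀ x, InnerProductSpace ℝ (E x)]
  [FiberBundle Plane E] [VectorBundle ℝ Plane E]
  [ContMDiffVectorBundle ∞ Plane E (𝓡 2)]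
  [IsContMDiffRiemannianBundle (𝓡 2) ∞ Plane E]
  {oC : SurfaceOrientation C} {oE : BundleOrientation E} {𝒟 : Conn oE}
  {e₀ e₁ : ∀ x, E x} {η : OneForm (𝓡 2) C} {y : C} {v : TotalSpace Plane E}

/-- The global form `ρ (dφ + p^* η)` of a connection. -/
def Conn.theta (𝒟 : Conn oE) : OneForm totalModel (TotalSpace Plane E) := fun v =>
  connForm (𝒟.left v.1) (𝒟.right v.1) (𝒟.form v.1) v

/-- The curvature of a connection. -/
def Conn.curv (𝒟 : Conn oE) : FormField (𝓡 2) C 2 := fun y => extd (𝒟.form y) y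

/-- The frame `(e₀, e₁)` and the form `η` represent the connection near `y`. -/
structure Conn.Local (𝒟 : Conn oE) (e₀ e₁ : ∀ x, E x) (η : OneForm (𝓡 2) C) (y : C) : Prop where
  frame : IsFrame oE e₀ e₁ y
  repAt : RepAt η y
  theta : ∀ᶠ z in 𝓝 y, ∀ v : TotalSpace Plane E, v.1 = z → 𝒟.theta v = connForm e₀ e₁ η v
  curv : 𝒟.curv y = extd η y

lemma Conn.eventually_local (𝒟 : Conn oE) (y : C) :
    ∀ᶠ z in 𝓝 y, 𝒟.Local (𝒟.left y) (𝒟.right y) (𝒟.form y) z := by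
  filter_upwards [(𝒟.frame y).eventually, (𝒟.repAt y).eventually,
    (𝒟.compat y).eventually_nhds, 𝒟.compat_extd y] with z h1 h2 h3 h4
  exact ⟨h1, h2, h3.mono fun z hz v hv => by subst hv; exact hz v rfl, h4⟩

lemma Conn.local_self (𝒟 : Conn oE) (y : C) :
    𝒟.Local (𝒟.left y) (𝒟.right y) (𝒟.form y) y := (𝒟.eventually_local y).self_of_nhds

lemma repAt_connForm (h : IsFrame oE e₀ e₁ v.1) (hη : RepAt η v.1) :
    RepAt (connForm e₀ e₁ η) v :=
  (repAt_rot h.at.smoothNear).add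
    ((RepAt.pull (smoothNear_proj v) hη).fsmul (contMDiff_sqNorm.smoothNear v))

lemma Conn.Local.theta_eventuallyEq (h : 𝒟.Local e₀ e₁ η v.1) :
    ∀ᶠ w in 𝓝 v, 𝒟.theta w = connForm e₀ e₁ η w := by
  filter_upwards [(smoothNear_proj v).continuousAt.eventually h.theta] with w hw using hw w rfl

lemma Conn.repAt_theta (𝒟 : Conn oE) (v : TotalSpace Plane E) : RepAt 𝒟.theta v :=
  (repAt_connForm (𝒟.local_self v.1).frame (𝒟.local_self v.1).repAt).congr
    (𝒟.local_self v.1).theta_eventuallyEq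

/-- The covariant derivative of the fiber coordinates along a tangent vector. -/
def cov (e₀ e₁ : ∀ x, E x) (η : OneForm (𝓡 2) C) (v : TotalSpace Plane E)
    (X : TangentSpace totalModel v) : Plane :=
  !₂[planeDeriv totalModel (frameMap e₀ e₁) v X 0 - frameMap e₀ e₁ v 1 * η v.1 (dproj v X),
    planeDeriv totalModel (frameMap e₀ e₁) v X 1 + frameMap e₀ e₁ v 0 * η v.1 (dproj v X)]

lemma FrameAt.exists_cov (h : FrameAt oE e₀ e₁ v.1) (η : OneForm (𝓡 2) C)
    (w : TangentSpace (𝓡 2) v.1) (a : Plane) :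
    ∃ X : TangentSpace totalModel v, dproj v X = w ∧ cov e₀ e₁ η v X = a := by
  obtain ⟨X, h1, h2⟩ := h.exists_lift w
    !₂[a 0 + frameMap e₀ e₁ v 1 * η v.1 w, a 1 - frameMap e₀ e₁ v 0 * η v.1 w]
  refine ⟨X, h1, ?_⟩
  rw [cov, h1, h2]
  ext i
  fin_cases i <;> simp

lemma FrameAt.eq_zero_of_cov (h : FrameAt oE e₀ e₁ v.1) {X : TangentSpace totalModel v}
    (h1 : dproj v X = 0) (h2 : cov e₀ e₁ η v X = 0) : X = 0 := by
  refine h.eq_zero_of_deriv h1 ?_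
  rw [cov, h1, map_zero, mul_zero, mul_zero, sub_zero, add_zero] at h2
  ext i
  have := congrFun (congrArg WithLp.ofLp h2) i
  fin_cases i <;> exact this

lemma IsFrame.dR_sqNorm (h : IsFrame oE e₀ e₁ v.1) (X : TangentSpace totalModel v) :
    dR totalModel (sqNorm (E := E)) v X =
      2 * (frameMap e₀ e₁ v 0 * cov e₀ e₁ η v X 0 + frameMap e₀ e₁ v 1 * cov e₀ e₁ η v X 1) := by
  have hF := h.at.smoothNear (v := v)
  rw [dR_congr h.sqNorm_eventuallyEq, dR_normSq hF]
  change 2 * frameMap e₀ e₁ v 0 * dR totalModel (co (frameMap e₀ e₁) 0) v X +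
    2 * frameMap e₀ e₁ v 1 * dR totalModel (co (frameMap e₀ e₁) 1) v X =
    2 * (frameMap e₀ e₁ v 0 * (planeDeriv totalModel (frameMap e₀ e₁) v X 0 - _) +
      frameMap e₀ e₁ v 1 * (planeDeriv totalModel (frameMap e₀ e₁) v X 1 + _))
  rw [planeDeriv_apply hF.mdiff, planeDeriv_apply hF.mdiff]
  ring

lemma Conn.Local.theta_apply (h : 𝒟.Local e₀ e₁ η v.1) (X : TangentSpace totalModel v) :
    𝒟.theta v X = stdArea (frameMap e₀ e₁ v) (cov e₀ e₁ η v X) := by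
  have hF := h.frame.at.smoothNear (v := v)
  rw [h.theta_eventuallyEq.self_of_nhds]
  change rot totalModel (frameMap e₀ e₁) v X + sqNorm v * η v.1 (dproj v X) =
    frameMap e₀ e₁ v 0 * (planeDeriv totalModel (frameMap e₀ e₁) v X 1 +
      frameMap e₀ e₁ v 0 * η v.1 (dproj v X)) -
    frameMap e₀ e₁ v 1 * (planeDeriv totalModel (frameMap e₀ e₁) v X 0 -
      frameMap e₀ e₁ v 1 * η v.1 (dproj v X))
  rw [rot_apply hF.mdiff, h.frame.at.sqNorm_eq, plane_norm_sq, stdArea]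
  ring

lemma Conn.Local.extd_theta (h : 𝒟.Local e₀ e₁ η v.1) (X Y : TangentSpace totalModel v) :
    extd 𝒟.theta v ![X, Y] = 2 * stdArea (cov e₀ e₁ η v X) (cov e₀ e₁ η v Y) +
      sqNorm v * 𝒟.curv v.1 ![dproj v X, dproj v Y] := by
  have hF := h.frame.at.smoothNear (v := v)
  have hp := smoothNear_proj v
  have hρ := contMDiff_sqNorm.smoothNear v
  have hpull : RepAt (pull (I := totalModel) (proj : TotalSpace Plane E → C) η) v :=
    RepAt.pull hp h.repAt
  rw [extd_congr (repAt_connForm h.frame h.repAt) h.theta_eventuallyEq]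
  have e : extd (connForm e₀ e₁ η) v = extd (rot totalModel (frameMap e₀ e₁)) v +
      extd (fun v => sqNorm v • pull (I := totalModel) (proj : TotalSpace Plane E → C) η v) v :=
    extd_add (repAt_rot hF) (hpull.fsmul hρ)
  rw [e, extd_rot hF, extd_fsmul hρ hpull, extd_pull hp h.repAt, h.curv]
  change 2 * area totalModel (frameMap e₀ e₁) v ![X, Y] +
    ((dR totalModel sqNorm v X * η v.1 (dproj v Y) - dR totalModel sqNorm v Y * η v.1 (dproj v X)) +
      sqNorm v * pullbackForm (I := totalModel) proj (extd η) v ![X, Y]) = _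
  have e2 : pullbackForm (I := totalModel) proj (extd η) v ![X, Y] =
      extd η v.1 ![dproj v X, dproj v Y] := compContinuousLinearMap_two _ _ _ _
  rw [e2, area_apply hF.mdiff, h.frame.dR_sqNorm (η := η), h.frame.dR_sqNorm (η := η)]
  simp only [stdArea, cov]
  change 2 * _ + ((2 * (_ * (_ - _) + _ * (_ + _)) * _ - 2 * (_ * (_ - _) + _ * (_ + _)) * _) + _) =
    2 * ((_ - _) * (_ + _) - (_ + _) * (_ - _)) + _
  ring

/-- The form `p^* σ + (δ / 2) d (ρ (dφ + p^* η))`. -/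
def Conn.symp (𝒟 : Conn oE) (σ : FormField (𝓡 2) C 2) (δ : ℝ) :
    FormField totalModel (TotalSpace Plane E) 2 := fun v =>
  pullbackForm (I := totalModel) (proj : TotalSpace Plane E → C) σ v + (δ / 2) • extd 𝒟.theta v

/-- The horizontal part of the symplectic form, in the fiber at squared norm `ρ`. -/
def Conn.horiz (𝒟 : Conn oE) (σ : FormField (𝓡 2) C 2) (r : ℝ) : FormField (𝓡 2) C 2 := fun y =>
  σ y + (r / 2) • 𝒟.curv y

variable {σ : FormField (𝓡 2) C 2} {δ : ℝ}

lemma Conn.Local.symp_apply (h : 𝒟.Local e₀ e₁ η v.1) (X Y : TangentSpace totalModel v) :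
    𝒟.symp σ δ v ![X, Y] = 𝒟.horiz σ (δ * sqNorm v) v.1 ![dproj v X, dproj v Y] +
      δ * stdArea (cov e₀ e₁ η v X) (cov e₀ e₁ η v Y) := by
  have e2 : pullbackForm (I := totalModel) proj σ v ![X, Y] =
      σ v.1 ![dproj v X, dproj v Y] := compContinuousLinearMap_two _ _ _ _
  change pullbackForm (I := totalModel) proj σ v ![X, Y] + δ / 2 * extd 𝒟.theta v ![X, Y] =
    (σ v.1 ![dproj v X, dproj v Y] + δ * sqNorm v / 2 * 𝒟.curv v.1 ![dproj v X, dproj v Y]) + _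
  rw [e2, h.extd_theta]
  ring

lemma Conn.symp_nondegenerate (hδ : 0 < δ) (hpos : PosForm oC (𝒟.horiz σ (δ * sqNorm v)) v.1)
    {X : TangentSpace totalModel v} (hX : ∀ Y, 𝒟.symp σ δ v ![X, Y] = 0) : X = 0 := by
  have h := 𝒟.local_self v.1
  have hz : ∀ u : TangentSpace (𝓡 2) v.1, 𝒟.horiz σ (δ * sqNorm v) v.1 ![u, 0] = 0 := fun u =>
    (𝒟.horiz σ (δ * sqNorm v) v.1).map_coord_zero (m := ![u, 0]) 1 rfl
  have h1 : cov (𝒟.left v.1) (𝒟.right v.1) (𝒟.form v.1) v X = 0 := by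
    refine stdArea_left_cancel fun a => ?_
    obtain ⟨Y, hY1, hY2⟩ := h.frame.at.exists_cov (𝒟.form v.1) 0 a
    have := hX Y
    rw [h.symp_apply, hY1, hY2, hz, zero_add] at this
    rw [(mul_eq_zero.1 this).resolve_left hδ.ne']
    simp [stdArea]
  refine h.frame.at.eq_zero_of_cov (hpos.eq_zero fun w => ?_) h1
  obtain ⟨Y, hY1, hY2⟩ := h.frame.at.exists_cov (𝒟.form v.1) w 0
  have := hX Y
  rw [h.symp_apply, hY1, h1] at this
  simpa [stdArea] using this

/-- The Liouville form `p^* β + (1/2) (δ + B / ρ) ρ (dφ + p^* η)`. -/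
def Conn.liou (𝒟 : Conn oE) (β : OneForm (𝓡 2) C) (δ B : ℝ) :
    OneForm totalModel (TotalSpace Plane E) := fun v =>
  pull (I := totalModel) (proj : TotalSpace Plane E → C) β v +
    ((1 / 2) * (δ + B * (sqNorm v)⁻¹)) • 𝒟.theta v

variable {β : OneForm (𝓡 2) C} {B : ℝ}

lemma smoothNear_liou_coeff (hv : sqNorm v ≠ 0) (δ B : ℝ) : SmoothNear totalModel 𝓘(ℝ, ℝ)
    (fun v : TotalSpace Plane E => (1 / 2) * (δ + B * (sqNorm v)⁻¹)) v :=
  (smoothNear_const (1 / 2 : ℝ) v).mul ((smoothNear_const δ v).add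
    ((smoothNear_const B v).mul ((contMDiff_sqNorm.smoothNear v).inv hv)))

lemma Conn.repAt_liou (hβ : RepAt β v.1) (hv : sqNorm v ≠ 0) : RepAt (𝒟.liou β δ B) v :=
  RepAt.add (RepAt.pull (smoothNear_proj v) hβ)
    ((𝒟.repAt_theta v).fsmul (smoothNear_liou_coeff hv δ B))

lemma Conn.extd_liou (hβ : RepAt β v.1) (hv : sqNorm v ≠ 0)
    (hd : extd β v.1 = 𝒟.horiz σ (-B) v.1) : extd (𝒟.liou β δ B) v = 𝒟.symp σ δ v := by
  have h := 𝒟.local_self v.1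
  have hp := smoothNear_proj v
  have hρ := contMDiff_sqNorm.smoothNear v
  have e : extd (𝒟.liou β δ B) v =
      extd (pull (I := totalModel) (proj : TotalSpace Plane E → C) β) v +
      extd (fun v => ((1 / 2) * (δ + B * (sqNorm v)⁻¹)) • 𝒟.theta v) v :=
    extd_add (RepAt.pull hp hβ) ((𝒟.repAt_theta v).fsmul (smoothNear_liou_coeff hv δ B))
  refine alt_two_ext fun X Y => ?_
  rw [e, extd_pull hp hβ, extd_fsmul (smoothNear_liou_coeff hv δ B) (𝒟.repAt_theta v)]
  have hφ : HasDerivAt (fun t : ℝ => (1 / 2) * (δ + B * t⁻¹)) ((1 / 2) * (B * -(sqNorm v ^ 2)⁻¹))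
      (sqNorm v) :=
    (((hasDerivAt_inv hv).const_mul B).const_add δ).const_mul (1 / 2)
  have hd1 : dR totalModel (fun v : TotalSpace Plane E => (1 / 2) * (δ + B * (sqNorm v)⁻¹)) v =
      ((1 / 2) * (B * -(sqNorm v ^ 2)⁻¹)) • dR totalModel sqNorm v := dR_comp hφ hρ.mdiff
  rw [hd1]
  have e2 : pullbackForm (I := totalModel) proj (extd β) v ![X, Y] =
      extd β v.1 ![dproj v X, dproj v Y] := compContinuousLinearMap_two _ _ _ _
  change pullbackForm (I := totalModel) proj (extd β) v ![X, Y] +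
    ((((1 / 2) * (B * -(sqNorm v ^ 2)⁻¹)) * dR totalModel sqNorm v X * 𝒟.theta v Y -
      ((1 / 2) * (B * -(sqNorm v ^ 2)⁻¹)) * dR totalModel sqNorm v Y * 𝒟.theta v X) +
      ((1 / 2) * (δ + B * (sqNorm v)⁻¹)) * extd 𝒟.theta v ![X, Y]) = _
  have e3 : extd β v.1 ![dproj v X, dproj v Y] = σ v.1 ![dproj v X, dproj v Y] +
      -B / 2 * 𝒟.curv v.1 ![dproj v X, dproj v Y] := by rw [hd]; rfl
  have e4 : 𝒟.horiz σ (δ * sqNorm v) v.1 ![dproj v X, dproj v Y] = σ v.1 ![dproj v X, dproj v Y] +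
      δ * sqNorm v / 2 * 𝒟.curv v.1 ![dproj v X, dproj v Y] := rfl
  rw [h.symp_apply, e4, e2, e3, h.extd_theta, h.theta_apply, h.theta_apply,
    h.frame.dR_sqNorm (η := 𝒟.form v.1), h.frame.dR_sqNorm (η := 𝒟.form v.1)]
  have hn : sqNorm v = frameMap (𝒟.left v.1) (𝒟.right v.1) v 0 ^ 2 +
      frameMap (𝒟.left v.1) (𝒟.right v.1) v 1 ^ 2 := by
    rw [← plane_norm_sq]; exact h.frame.at.sqNorm_eq
  generalize 𝒟.curv v.1 ![dproj v X, dproj v Y] = κ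
  generalize σ v.1 ![dproj v X, dproj v Y] = s
  generalize cov (𝒟.left v.1) (𝒟.right v.1) (𝒟.form v.1) v X = P
  generalize cov (𝒟.left v.1) (𝒟.right v.1) (𝒟.form v.1) v Y = R
  generalize frameMap (𝒟.left v.1) (𝒟.right v.1) v = F at *
  generalize sqNorm v = r at *
  simp only [stdArea]
  have hr : r * r⁻¹ = 1 := mul_inv_cancel₀ hv
  rw [← inv_pow]
  linear_combination (B * κ / 2 - B * r⁻¹ * (P 0 * R 1 - P 1 * R 0)) * hr +
    B * r⁻¹ ^ 2 * (P 0 * R 1 - P 1 * R 0) * hn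

end Symplectic

section DualField

variable {E : Type*} [NormedAddCommGroup E] [NormedSpace ℝ E] [FiniteDimensional ℝ E]
  {H : Type*} [TopologicalSpace H] {I : ModelWithCorners ℝ E H}
  {M : Type*} [TopologicalSpace M] [ChartedSpace H M] [IsManifold I ∞ M] [I.Boundaryless]

lemma alt_one_finrank : Module.finrank ℝ (E [⋀^Fin 1]→L[ℝ] ℝ) = Module.finrank ℝ E := by
  have h1 := (ContinuousAlternatingMap.ofSubsingletonLIE (𝕜 := ℝ) (E := E) (F := ℝ)
    (0 : Fin 1)).toLinearEquiv.finrank_eq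
  have h2 := (LinearMap.toContinuousLinearMap (𝕜 := ℝ) (E := E) (F' := ℝ)).finrank_eq
  rw [← h1, ← h2]
  exact Subspace.dual_finrank_eq

/-- A nondegenerate alternating form as an equivalence of vectors and linear forms. -/
lemma exists_equiv_curryLeft (F : E [⋀^Fin 2]→L[ℝ] ℝ)
    (h : ∀ u, (∀ w, F ![u, w] = 0) → u = 0) :
    ∃ e : E ≃L[ℝ] (E [⋀^Fin 1]→L[ℝ] ℝ), (e : E →L[ℝ] (E [⋀^Fin 1]→L[ℝ] ℝ)) = F.curryLeft := by
  have : FiniteDimensional ℝ (E [⋀^Fin 1]→L[ℝ] ℝ) :=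
    (ContinuousAlternatingMap.ofSubsingletonLIE (𝕜 := ℝ) (E := E) (F := ℝ)
      (0 : Fin 1)).toLinearEquiv.finiteDimensional
  have hinj : Function.Injective (F.curryLeft : E →ₗ[ℝ] (E [⋀^Fin 1]→L[ℝ] ℝ)) := by
    rw [← LinearMap.ker_eq_bot, LinearMap.ker_eq_bot']
    intro u hu
    exact h u fun w => DFunLike.congr_fun hu ![w]
  let e := LinearEquiv.ofInjectiveOfFinrankEq (F.curryLeft : E →ₗ[ℝ] (E [⋀^Fin 1]→L[ℝ] ℝ)) hinj
    alt_one_finrank.symm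
  exact ⟨e.toContinuousLinearEquiv, by ext1 u; rfl⟩

lemma contDiff_curryLeft :
    ContDiff ℝ ∞ (fun F : E [⋀^Fin 2]→L[ℝ] ℝ => (F.curryLeft : E →L[ℝ] (E [⋀^Fin 1]→L[ℝ] ℝ))) := by
  let L : (E [⋀^Fin 2]→L[ℝ] ℝ) →L[ℝ] (E →L[ℝ] (E [⋀^Fin 1]→L[ℝ] ℝ)) :=
    (ContinuousAlternatingMap.curryLeftLI (𝕜 := ℝ) (E := E) (F := ℝ)
      (n := 1)).toContinuousLinearMap
  exact ContinuousLinearMap.contDiff (𝕜 := ℝ) (E := E [⋀^Fin 2]→L[ℝ] ℝ)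
    (F := E →L[ℝ] (E [⋀^Fin 1]→L[ℝ] ℝ)) L

/-- The vector field dual to a smooth `1`-form with respect to a smooth nondegenerate form is
smooth. -/
lemma contMDiffAt_of_contract {τ : FormField I M 2} {η : OneForm I M}
    {V : ∀ x : M, TangentSpace I x} {x : M}
    (hτ : ContDiffAt ℝ ∞ (chartForm τ x) (extChartAt I x x)) (hη : RepAt η x)
    (hnd : ∀ᶠ y in 𝓝 x, ∀ u, (∀ w, τ y ![u, w] = 0) → u = 0)
    (hV : ∀ᶠ y in 𝓝 x, ∀ w, τ y ![V y, w] = η y w) :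
    ContMDiffAt I I.tangent ∞ (fun y => (⟨y, V y⟩ : TangentBundle I M)) x := by
  have hx : x ∈ (chartAt H x).source := mem_chart_source H x
  have hxt : extChartAt I x x ∈ (extChartAt I x).target := mem_extChartAt_target x
  have hback : (extChartAt I x).symm (extChartAt I x x) = x :=
    extChartAt_to_inv x
  let A : E → E →L[ℝ] (E [⋀^Fin 1]→L[ℝ] ℝ) := fun z => (chartForm τ x z).curryLeft
  let U : E → E := fun z => (A z).inverse (chartForm (toForm η) x z)
  have chart : ∀ {y : M}, y ∈ (chartAt H x).source →
      ∃ (S : E →L[ℝ] TangentSpace I y) (P : TangentSpace I y →L[ℝ] E),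
        (∀ u, P u = mfderiv I 𝓘(ℝ, E) (extChartAt I x) y u) ∧ (∀ u, S (P u) = u) ∧
        (∀ u, P (S u) = u) ∧
        (∀ a b, chartForm τ x (extChartAt I x y) ![a, b] = τ y ![S a, S b]) ∧
        ∀ b, chartForm (toForm η) x (extChartAt I x y) ![b] = η y (S b) := by
    intro y hy
    have h2 : (extChartAt I x).symm (extChartAt I x y) = y :=
      (extChartAt I x).left_inv (by rwa [extChartAt_source])
    refine ⟨mfderiv 𝓘(ℝ, E) I (extChartAt I x).symm (extChartAt I x y),
      mfderiv I 𝓘(ℝ, E) (extChartAt I x) y, fun _ => rfl, fun u => ?_, fun u => ?_,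
      fun a b => ?_, fun b => ?_⟩
    · have h := mfderivWithin_extChartAt_symm_comp_mfderiv_extChartAt' (I := I) (x := x) (y := y)
        (by rwa [extChartAt_source])
      rw [I.range_eq_univ, mfderivWithin_univ] at h
      exact DFunLike.congr_fun h u
    · have h := mfderiv_extChartAt_comp_mfderivWithin_extChartAt_symm' (I := I) (x := x) (y := y)
        (by rwa [extChartAt_source])
      rw [I.range_eq_univ, mfderivWithin_univ] at h
      exact DFunLike.congr_fun h u
    · refine (compContinuousLinearMap_two _ _ _ _ : chartForm τ x (extChartAt I x y) ![a, b] =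
        τ ((extChartAt I x).symm (extChartAt I x y))
          ![mfderiv 𝓘(ℝ, E) I (extChartAt I x).symm (extChartAt I x y) a,
            mfderiv 𝓘(ℝ, E) I (extChartAt I x).symm (extChartAt I x y) b]).trans ?_
      have : ∀ (y' : M) (_ : y' = y) (a b : E), τ y' ![(a : TangentSpace I y'), b] =
          τ y ![(a : TangentSpace I y), b] := by rintro _ rfl _ _; rfl
      exact this _ h2 _ _
    · have : ∀ (y' : M) (_ : y' = y) (b : E), η y' (b : TangentSpace I y') =
          η y (b : TangentSpace I y) := by rintro _ rfl _; rfl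
      exact this _ h2 _
  have equiv : ∀ {y : M}, y ∈ (chartAt H x).source →
      (∀ u, (∀ w, τ y ![u, w] = 0) → u = 0) →
      ∃ e : E ≃L[ℝ] (E [⋀^Fin 1]→L[ℝ] ℝ),
        (e : E →L[ℝ] (E [⋀^Fin 1]→L[ℝ] ℝ)) = A (extChartAt I x y) := by
    intro y hy hnd
    obtain ⟨S, P, -, hSP, hPS, hτ2, -⟩ := chart hy
    refine exists_equiv_curryLeft _ fun u hu => ?_
    have h0 : S u = 0 := by
      refine hnd _ fun w => ?_
      have := hu (P w)
      rwa [hτ2, hSP] at this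
    rw [← hPS u, h0, map_zero]
  rw [Bundle.contMDiffAt_section]
  have hU : ContMDiffAt I 𝓘(ℝ, E) ∞ (fun y => U (extChartAt I x y)) x := by
    have h1 : ContDiffAt ℝ ∞ A (extChartAt I x x) :=
      contDiff_curryLeft.contDiffAt.comp _ hτ
    obtain ⟨e, he⟩ := equiv hx hnd.self_of_nhds
    have h2 : ContDiffAt ℝ ∞ (fun z => (A z).inverse) (extChartAt I x x) := by
      have h3 := contDiffAt_map_inverse (n := ∞) e
      rw [he] at h3
      exact h3.comp _ h1
    have h4 : ContDiffAt ℝ ∞ (chartForm (toForm η) x) (extChartAt I x x) :=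
      contDiffAt_chartForm_toForm x hxt (hback.symm ▸ hη)
    exact (h2.clm_apply h4).contMDiffAt.comp x (smoothNear_extChartAt hx).self
  refine hU.congr_of_eventuallyEq ?_
  filter_upwards [(chartAt H x).open_source.mem_nhds hx, hnd, hV] with y hy hnd hV
  have e1 : (trivializationAt E (TangentSpace I) x ⟨y, V y⟩).2 =
      mfderiv I 𝓘(ℝ, E) (extChartAt I x) y (V y) := by
    rw [← TangentBundle.continuousLinearMapAt_trivializationAt hy]
    exact (Trivialization.continuousLinearMapAt_apply_of_mem (R := ℝ) _
      (by rwa [TangentBundle.trivializationAt_baseSet]) _).symm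
  refine e1.trans ?_
  obtain ⟨e, he⟩ := equiv hy hnd
  change _ = (A (extChartAt I x y)).inverse (chartForm (toForm η) x (extChartAt I x y))
  rw [← he, ContinuousLinearMap.inverse_equiv]
  obtain ⟨S, P, hP, hSP, hPS, hτ2, hη2⟩ := chart hy
  rw [← hP]
  have e2 : e (P (V y)) = chartForm (toForm η) x (extChartAt I x y) := by
    refine Eq.trans (DFunLike.congr_fun he _) (alt_one_ext fun w => ?_)
    refine (hτ2 (P (V y)) w).trans ?_
    rw [hSP, hV]
    exact (hη2 w).symm
  exact (e.symm_apply_apply _).symm.trans (congrArg e.symm e2)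

end DualField

section Field

lemma alt_two_left_cancel {X : Type*} [AddCommGroup X] [Module ℝ X] [TopologicalSpace X]
    {F : X [⋀^Fin 2]→L[ℝ] ℝ} (hF : ∀ u, (∀ w, F ![u, w] = 0) → u = 0) {a b : X}
    (h : ∀ w, F ![a, w] = F ![b, w]) : a = b := by
  refine sub_eq_zero.1 (hF _ fun w => ?_)
  have h1 : F ![(a - b) + b, w] = F ![a - b, w] + F ![b, w] :=
    F.map_vecCons_add (m := ![w]) (a - b) b
  rw [sub_add_cancel, h] at h1
  linarith

variable {C : Type*} [TopologicalSpace C] [ChartedSpace Plane C] [IsManifold (𝓡 2) ∞ C]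
  {E : C → Type*} [TopologicalSpace (TotalSpace Plane E)]
  [∀ x, NormedAddCommGroup (E x)] [∀ x, InnerProductSpace ℝ (E x)]
  [FiberBundle Plane E] [VectorBundle ℝ Plane E]
  [ContMDiffVectorBundle ∞ Plane E (𝓡 2)]
  [IsContMDiffRiemannianBundle (𝓡 2) ∞ Plane E]
  {oC : SurfaceOrientation C} {oE : BundleOrientation E} {𝒟 : Conn oE}
  {e₀ e₁ : ∀ x, E x} {η : OneForm (𝓡 2) C} {v : TotalSpace Plane E}
  {σ : FormField (𝓡 2) C 2} {β : OneForm (𝓡 2) C} {δ B : ℝ}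

/-- The form `σ` is locally the differential of a smooth form. -/
def LocallyExact (σ : FormField (𝓡 2) C 2) : Prop :=
  ∀ y, ∃ θ : OneForm (𝓡 2) C, RepAt θ y ∧ ∀ᶠ z in 𝓝 y, σ z = extd θ z

lemma Conn.symp_locallyExact (hσ : LocallyExact σ) (v : TotalSpace Plane E) :
    ∃ θ : OneForm totalModel (TotalSpace Plane E), RepAt θ v ∧
      ∀ᶠ w in 𝓝 v, 𝒟.symp σ δ w = extd θ w := by
  obtain ⟨θ, h1, h2⟩ := hσ v.1
  have hp := smoothNear_proj v
  refine ⟨pull (I := totalModel) proj θ + (δ / 2) • 𝒟.theta,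
    (RepAt.pull hp h1).add ((𝒟.repAt_theta v).const_smul _), ?_⟩
  filter_upwards [hp.continuousAt.eventually (h1.eventually.and h2)] with w hw
  have hpw := smoothNear_proj w
  have hpull : RepAt (pull (I := totalModel) (proj : TotalSpace Plane E → C) θ) w :=
    RepAt.pull hpw hw.1
  rw [extd_add hpull ((𝒟.repAt_theta w).const_smul _), extd_pull hpw hw.1,
    extd_const_smul _ (𝒟.repAt_theta w)]
  have e : pullbackForm (I := totalModel) (proj : TotalSpace Plane E → C) σ w =
      pullbackForm (I := totalModel) (proj : TotalSpace Plane E → C) (extd θ) w := by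
    simp only [pullbackForm]
    rw [hw.2]
  change pullbackForm (I := totalModel) (proj : TotalSpace Plane E → C) σ w + _ = _
  rw [e]

lemma Conn.isSymplecticOn (hσ : LocallyExact σ) (hδ : 0 < δ) {Ω : Set (TotalSpace Plane E)}
    (hΩ : ∀ v ∈ Ω, PosForm oC (𝒟.horiz σ (δ * sqNorm v)) v.1) :
    IsSymplecticOn (𝒟.symp σ δ) Ω where
  smooth := smoothFormOn_of_locally_exact fun v _ => 𝒟.symp_locallyExact hσ v
  closed := closed_of_locally_exact fun v _ => 𝒟.symp_locallyExact hσ v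
  nondegenerate v hv _ hX := Conn.symp_nondegenerate hδ (hΩ v hv) hX

open Classical in
/-- The vector field dual to the Liouville form. -/
def Conn.field (𝒟 : Conn oE) (σ : FormField (𝓡 2) C 2) (β : OneForm (𝓡 2) C) (δ B : ℝ)
    (v : TotalSpace Plane E) : TangentSpace totalModel v :=
  if h : ∃ X : TangentSpace totalModel v, ∀ Y, 𝒟.symp σ δ v ![X, Y] = 𝒟.liou β δ B v Y then
    h.choose else 0

lemma Conn.Local.exists_dual (h : 𝒟.Local e₀ e₁ η v.1) (hδ : 0 < δ)
    (hpos : PosForm oC (𝒟.horiz σ (δ * sqNorm v)) v.1) (hv : sqNorm v ≠ 0) (β : OneForm (𝓡 2) C)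
    (B : ℝ) : ∃ X : TangentSpace totalModel v,
      (∀ w, 𝒟.horiz σ (δ * sqNorm v) v.1 ![dproj v X, w] = β v.1 w) ∧
      cov e₀ e₁ η v X = ((1 / 2) * (1 + B / (δ * sqNorm v))) • frameMap e₀ e₁ v ∧
      ∀ Y, 𝒟.symp σ δ v ![X, Y] = 𝒟.liou β δ B v Y := by
  obtain ⟨b, hb⟩ := hpos.exists_dual (β v.1)
  obtain ⟨X, h1, h2⟩ := h.frame.at.exists_cov η b
    (((1 / 2) * (1 + B / (δ * sqNorm v))) • frameMap e₀ e₁ v)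
  refine ⟨X, fun w => by rw [h1]; exact hb w, h2, fun Y => ?_⟩
  rw [h.symp_apply, h1, h2, hb, stdArea_smul_left]
  change _ = β v.1 (dproj v Y) + (1 / 2) * (δ + B * (sqNorm v)⁻¹) * 𝒟.theta v Y
  rw [h.theta_apply]
  have : δ * ((1 / 2) * (1 + B / (δ * sqNorm v))) = (1 / 2) * (δ + B * (sqNorm v)⁻¹) := by
    field_simp
  rw [← mul_assoc, this]

lemma Conn.field_spec (hδ : 0 < δ) (hpos : PosForm oC (𝒟.horiz σ (δ * sqNorm v)) v.1)
    (hv : sqNorm v ≠ 0) (Y : TangentSpace totalModel v) :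
    𝒟.symp σ δ v ![𝒟.field σ β δ B v, Y] = 𝒟.liou β δ B v Y := by
  have h : ∃ X : TangentSpace totalModel v, ∀ Y, 𝒟.symp σ δ v ![X, Y] = 𝒟.liou β δ B v Y := by
    obtain ⟨X, -, -, hX⟩ := (𝒟.local_self v.1).exists_dual hδ hpos hv β B
    exact ⟨X, hX⟩
  have e : 𝒟.field σ β δ B v = h.choose := dif_pos h
  rw [e]
  exact h.choose_spec Y

lemma Conn.Local.field_eq (h : 𝒟.Local e₀ e₁ η v.1) (hδ : 0 < δ)
    (hpos : PosForm oC (𝒟.horiz σ (δ * sqNorm v)) v.1) (hv : sqNorm v ≠ 0) :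
    (∀ w, 𝒟.horiz σ (δ * sqNorm v) v.1 ![dproj v (𝒟.field σ β δ B v), w] = β v.1 w) ∧
      cov e₀ e₁ η v (𝒟.field σ β δ B v) =
        ((1 / 2) * (1 + B / (δ * sqNorm v))) • frameMap e₀ e₁ v := by
  obtain ⟨X, h1, h2, h3⟩ := h.exists_dual hδ hpos hv β B
  have e : X = 𝒟.field σ β δ B v := by
    refine alt_two_left_cancel (F := 𝒟.symp σ δ v)
      (fun u hu => Conn.symp_nondegenerate hδ hpos hu) fun w => ?_
    rw [h3, Conn.field_spec hδ hpos hv]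
  exact ⟨e ▸ h1, e ▸ h2⟩

/-- Along the Liouville field, `dρ (V) = ρ + B / δ`. -/
lemma Conn.dR_sqNorm_field (hδ : 0 < δ) (hpos : PosForm oC (𝒟.horiz σ (δ * sqNorm v)) v.1)
    (hv : sqNorm v ≠ 0) :
    dR totalModel (sqNorm (E := E)) v (𝒟.field σ β δ B v) = sqNorm v + B / δ := by
  have h := 𝒟.local_self v.1
  have hF := h.frame.at.sqNorm_eq (v := v)
  rw [plane_norm_sq] at hF
  rw [h.frame.dR_sqNorm (η := 𝒟.form v.1), (h.field_eq hδ hpos hv).2]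
  have : (1 / 2) * (1 + B / (δ * sqNorm v)) * (2 * sqNorm v) = sqNorm v + B / δ := by
    field_simp
  rw [← this]
  generalize frameMap (𝒟.left v.1) (𝒟.right v.1) v = F at *
  generalize (1 / 2) * (1 + B / (δ * sqNorm v)) = c
  change (2 : ℝ) * (F 0 * (c * F 0) + F 1 * (c * F 1)) = _
  linear_combination (-2 * c) * hF

/-- The derivative along the Liouville field of coordinates on the surface in which the data are
standard. -/
lemma Conn.planeDeriv_field {f : C → Plane} {k a : ℝ} (hk : 0 < k) (hδ : 0 < δ)
    (hf : SmoothNear (𝓡 2) 𝓘(ℝ, Plane) f v.1) (hfpos : PosForm oC (area (𝓡 2) f) v.1)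
    (hσ : σ v.1 = (2 * k) • area (𝓡 2) f v.1) (hκ : 𝒟.curv v.1 = 0)
    (hβ : β v.1 = k • rot (𝓡 2) f v.1 + (a / 2) • ang (𝓡 2) f v.1) (hv : sqNorm v ≠ 0) :
    planeDeriv (𝓡 2) f v.1 (dproj v (𝒟.field σ β δ B v)) =
      ((1 / 2) * (1 + a / (2 * k * ‖f v.1‖ ^ 2))) • f v.1 := by
  have hS : ∀ r, 𝒟.horiz σ r v.1 = (2 * k) • area (𝓡 2) f v.1 := fun r => by
    change σ v.1 + (r / 2) • 𝒟.curv v.1 = _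
    rw [hσ, hκ]
    exact (congrArg _ (smul_zero _)).trans (add_zero _)
  have hpos : ∀ r, PosForm oC (𝒟.horiz σ r) v.1 := fun r u w huw => by
    rw [hS]
    exact mul_pos (by linarith) (hfpos u w huw)
  have h := ((𝒟.local_self v.1).field_eq (β := β) (B := B) hδ (hpos _) hv).1
  generalize dproj v (𝒟.field σ β δ B v) = b at h ⊢
  have key : ∀ w, stdArea (planeDeriv (𝓡 2) f v.1 b) (planeDeriv (𝓡 2) f v.1 w) =
      stdArea (((1 / 2) * (1 + a / (2 * k * ‖f v.1‖ ^ 2))) • f v.1)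
        (planeDeriv (𝓡 2) f v.1 w) := fun w => by
    have hw := h w
    rw [hS, hβ] at hw
    change 2 * k * area (𝓡 2) f v.1 ![b, w] = k * rot (𝓡 2) f v.1 w +
      a / 2 * ((‖f v.1‖ ^ 2)⁻¹ * rot (𝓡 2) f v.1 w) at hw
    rw [area_apply hf.mdiff, rot_apply hf.mdiff] at hw
    rw [stdArea_smul_left]
    have h2 : (1 / 2) * (1 + a / (2 * k * ‖f v.1‖ ^ 2)) =
        (2 * k)⁻¹ * (k + a / 2 * (‖f v.1‖ ^ 2)⁻¹) := by
      rw [div_eq_mul_inv a, mul_inv]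
      field_simp
    rw [h2]
    have hk' : (2 * k)⁻¹ * (2 * k) = 1 := inv_mul_cancel₀ (by positivity)
    linear_combination (2 * k)⁻¹ * hw - stdArea (planeDeriv (𝓡 2) f v.1 b)
      (planeDeriv (𝓡 2) f v.1 w) * hk'
  obtain ⟨u, w, huw⟩ := exists_posPair_tangent oC v.1
  have hu := hfpos u w huw
  rw [area_apply hf.mdiff] at hu
  have h1 := key u
  have h2 := key w
  generalize planeDeriv (𝓡 2) f v.1 b = p at *
  generalize ((1 / 2) * (1 + a / (2 * k * ‖f v.1‖ ^ 2))) • f v.1 = q at *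
  generalize planeDeriv (𝓡 2) f v.1 u = r at *
  generalize planeDeriv (𝓡 2) f v.1 w = s at *
  simp only [stdArea] at h1 h2 hu
  have hne := hu.ne'
  ext i
  fin_cases i
  · refine mul_right_cancel₀ hne ?_
    change p 0 * _ = q 0 * _
    linear_combination (-s 0) * h1 + r 0 * h2
  · refine mul_right_cancel₀ hne ?_
    change p 1 * _ = q 1 * _
    linear_combination (-s 1) * h1 + r 1 * h2

lemma Conn.isLiouvilleOn (hσ : LocallyExact σ) (hδ : 0 < δ) {S : Set (TotalSpace Plane E)}
    (hS : IsOpen S) (hpos : ∀ v ∈ S, PosForm oC (𝒟.horiz σ (δ * sqNorm v)) v.1)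
    (hv : ∀ v ∈ S, sqNorm v ≠ 0)
    (hβ : ∀ v ∈ S, RepAt β v.1 ∧ extd β v.1 = 𝒟.horiz σ (-B) v.1) :
    IsLiouvilleOn (𝒟.symp σ δ) (𝒟.field σ β δ B) S where
  smooth v hvS := by
    refine ContMDiffAt.contMDiffWithinAt (contMDiffAt_of_contract (τ := 𝒟.symp σ δ)
      (η := 𝒟.liou β δ B) ?_ (Conn.repAt_liou (hβ v hvS).1 (hv v hvS)) ?_ ?_)
    · obtain ⟨θ, h1, h2⟩ := 𝒟.symp_locallyExact (δ := δ) hσ v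
      have hb : (extChartAt totalModel v).symm (extChartAt totalModel v v) = v := extChartAt_to_inv v
      refine ContDiffAt.congr_of_eventuallyEq (contDiffAt_chartForm_extd v
        (mem_extChartAt_target v) (η := θ) (hb.symm ▸ h1)) ?_
      exact chartForm_congr v (mem_extChartAt_target v) (hb.symm ▸ h2)
    · filter_upwards [hS.mem_nhds hvS] with w hw u hu
      exact Conn.symp_nondegenerate hδ (hpos w hw) hu
    · filter_upwards [hS.mem_nhds hvS] with w hw Y
      exact Conn.field_spec hδ (hpos w hw) (hv w hw) Y
  liouville := by
    refine extDerivEqOn_of_repAt (η := 𝒟.liou β δ B) hS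
      (fun v hvS => Conn.repAt_liou (hβ v hvS).1 (hv v hvS)) (fun v hvS => ?_)
      fun v hvS => (Conn.extd_liou (hβ v hvS).1 (hv v hvS) (hβ v hvS).2).symm
    refine alt_one_ext fun Y => ?_
    exact Conn.field_spec hδ (hpos v hvS) (hv v hvS) Y

end Field

section Standard

lemma planeDeriv_const_smul {E : Type*} [NormedAddCommGroup E] [NormedSpace ℝ E]
    {H : Type*} [TopologicalSpace H] {I : ModelWithCorners ℝ E H}
    {M : Type*} [TopologicalSpace M] [ChartedSpace H M] {f : M → Plane} {x : M}
    (c : ℝ) (hf : SmoothNear I 𝓘(ℝ, Plane) f x) (u : TangentSpace I x) :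
    planeDeriv I (fun y => c • f y) x u = c • planeDeriv I f x u := by
  have hc : SmoothNear I 𝓘(ℝ, Plane) (fun y => c • f y) x := (smoothNear_const c x).smul hf
  ext i
  rw [planeDeriv_apply hc.mdiff]
  have e : dR I (co (fun y => c • f y) i) x = _ := dR_mul (smoothNear_const c x).mdiff (hf.co i).mdiff
  rw [e, dR_const, smul_zero, add_zero]
  change c * dR I (co f i) x u = c * planeDeriv I f x u i
  rw [planeDeriv_apply hf.mdiff]

lemma stdArea_smul_smul (c : ℝ) (a b : Plane) : stdArea (c • a) (c • b) = c ^ 2 * stdArea a b := by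
  change c * a 0 * (c * b 1) - c * a 1 * (c * b 0) = _
  rw [stdArea]
  ring

lemma smul_eq_radialField (a : ℝ) (q : Plane) :
    ((1 / 2) * (1 + a / ‖q‖ ^ 2)) • q = radialField a q := by
  by_cases hq : q = 0
  · simp [hq, radialField, radialUnit]
  · have : ‖q‖ ≠ 0 := norm_ne_zero_iff.2 hq
    rw [radialField, radialUnit, smul_smul]
    congr 1
    field_simp

variable {C : Type*} [TopologicalSpace C] [ChartedSpace Plane C] [IsManifold (𝓡 2) ∞ C]
  {E : C → Type*} [TopologicalSpace (TotalSpace Plane E)]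
  [∀ x, NormedAddCommGroup (E x)] [∀ x, InnerProductSpace ℝ (E x)]
  [FiberBundle Plane E] [VectorBundle ℝ Plane E]
  [ContMDiffVectorBundle ∞ Plane E (𝓡 2)]
  [IsContMDiffRiemannianBundle (𝓡 2) ∞ Plane E]
  {oC : SurfaceOrientation C} {oE : BundleOrientation E} {𝒟 : Conn oE}
  {e₀ e₁ : ∀ x, E x} {η : OneForm (𝓡 2) C} {v : TotalSpace Plane E}
  {σ : FormField (𝓡 2) C 2} {β : OneForm (𝓡 2) C} {δ B : ℝ}

/-- The zero section pulls the symplectic form back to `σ`. -/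
lemma Conn.pullbackForm_zeroSection (𝒟 : Conn oE) (σ : FormField (𝓡 2) C 2) (δ : ℝ) :
    pullbackForm (I := 𝓡 2) (zeroSection Plane E) (𝒟.symp σ δ) = σ := by
  funext y
  refine alt_two_ext fun u w => ?_
  have h := 𝒟.local_self y
  have hz : SmoothNear (𝓡 2) totalModel (zeroSection Plane E) y :=
    ContMDiff.smoothNear (Bundle.contMDiff_zeroSection ℝ E) y
  have hF0 : ∀ z, frameMap (𝒟.left y) (𝒟.right y) (zeroSection Plane E z) = 0 := fun z => by
    ext i
    fin_cases i
    · exact inner_zero_right _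
    · exact inner_zero_right _
  have hproj : ∀ u : TangentSpace (𝓡 2) y, dproj (zeroSection Plane E y)
      (mfderiv (𝓡 2) totalModel (zeroSection Plane E) y u) = u := fun u => by
    have k := mfderiv_comp (I := 𝓡 2) (I' := totalModel) (I'' := 𝓡 2) y
      (g := (proj : TotalSpace Plane E → C)) (f := zeroSection Plane E) (smoothNear_proj _).mdiff
      hz.mdiff
    have k2 : (proj : TotalSpace Plane E → C) ∘ zeroSection Plane E = id := rfl
    rw [k2, mfderiv_id] at k
    exact (DFunLike.congr_fun k u).symm
  have hcov : ∀ u : TangentSpace (𝓡 2) y, cov (𝒟.left y) (𝒟.right y) (𝒟.form y)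
      (zeroSection Plane E y) (mfderiv (𝓡 2) totalModel (zeroSection Plane E) y u) = 0 := fun u => by
    have k := mfderiv_comp (I := 𝓡 2) (I' := totalModel) (I'' := 𝓘(ℝ, Plane)) y
      (g := frameMap (𝒟.left y) (𝒟.right y)) (f := zeroSection Plane E)
      (h.frame.at.smoothNear (v := zeroSection Plane E y)).mdiff hz.mdiff
    have k2 : frameMap (𝒟.left y) (𝒟.right y) ∘ zeroSection Plane E = fun _ => 0 := funext hF0
    rw [k2, mfderiv_const] at k
    have k3 : planeDeriv totalModel (frameMap (𝒟.left y) (𝒟.right y)) (zeroSection Plane E y)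
        (mfderiv (𝓡 2) totalModel (zeroSection Plane E) y u) = 0 := (DFunLike.congr_fun k u).symm
    rw [cov, k3, hF0]
    ext i
    fin_cases i <;> simp
  have e1 : pullbackForm (I := 𝓡 2) (zeroSection Plane E) (𝒟.symp σ δ) y ![u, w] =
      𝒟.symp σ δ (zeroSection Plane E y)
        ![mfderiv (𝓡 2) totalModel (zeroSection Plane E) y u,
          mfderiv (𝓡 2) totalModel (zeroSection Plane E) y w] := compContinuousLinearMap_two _ _ _ _
  have e2 := Conn.Local.symp_apply (v := zeroSection Plane E y) (σ := σ) (δ := δ) h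
    (mfderiv (𝓡 2) totalModel (zeroSection Plane E) y u)
    (mfderiv (𝓡 2) totalModel (zeroSection Plane E) y w)
  rw [hcov, hcov, hproj, hproj] at e2
  have e3 : sqNorm (zeroSection Plane E y) = 0 := by
    change ‖(0 : E y)‖ ^ 2 = 0
    rw [norm_zero]; norm_num
  rw [e3] at e2
  refine e1.trans (e2.trans ?_)
  change σ y ![u, w] + δ * 0 / 2 * 𝒟.curv y ![u, w] + _ = _
  simp [stdArea]

lemma Conn.symp_vertical_pos (hδ : 0 < δ) {u w : E v.1} (h : PosPair (oE.or v.1) u w) :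
    0 < 𝒟.symp σ δ v ![vertical v u, vertical v w] := by
  have hl := 𝒟.local_self v.1
  have hc : ∀ u : E v.1, cov (𝒟.left v.1) (𝒟.right v.1) (𝒟.form v.1) v (vertical v u) =
      frameMap (𝒟.left v.1) (𝒟.right v.1) ⟨v.1, u⟩ := fun u => by
    rw [cov, dproj_vertical, map_zero, hl.frame.at.planeDeriv_vertical]
    ext i
    fin_cases i <;> simp
  rw [hl.symp_apply, dproj_vertical, dproj_vertical, hc, hc]
  have h0 : 𝒟.horiz σ (δ * sqNorm v) v.1 ![0, 0] = 0 :=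
    (𝒟.horiz σ (δ * sqNorm v) v.1).map_eq_zero_of_eq _ (i := 0) (j := 1) rfl (by decide)
  rw [h0, zero_add]
  exact mul_pos hδ (hl.frame.at.ortho.area_pos h)

/-- On a compact surface, a positive form stays positive after adding a small multiple of the
curvature. -/
lemma Conn.exists_pos_horiz [CompactSpace C] (𝒟 : Conn oE) (hσ : LocallyExact σ)
    (hpos : ∀ y, PosForm oC σ y) :
    ∃ ε > 0, ∀ r, |r| ≤ ε → ∀ y, PosForm oC (𝒟.horiz σ r) y := by
  have hloc : ∀ y, ∃ ε > 0, ∀ᶠ z in 𝓝 y, ∀ r : ℝ, |r| ≤ ε → PosForm oC (𝒟.horiz σ r) z := fun y => by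
    obtain ⟨θ, h1, h2⟩ := hσ y
    have hp : PosForm oC (extd θ) y := fun u w huw => by
      rw [← h2.self_of_nhds]; exact hpos y u w huw
    obtain ⟨ε, hε, h⟩ := hp.eventually_add_smul h1 (𝒟.repAt y)
    refine ⟨ε, hε, ?_⟩
    filter_upwards [h, h2, 𝒟.compat_extd y] with z hz h3 h4 r hr u w huw
    have := hz (r / 2) (by rw [abs_div, abs_two]; linarith [abs_nonneg r]) u w huw
    change 0 < (σ z + (r / 2) • 𝒟.curv z) ![u, w]
    change 0 < (extd θ z + (r / 2) • extd (𝒟.form y) z) ![u, w] at this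
    rw [h3, Conn.curv, h4]
    exact this
  choose ε hε h using hloc
  obtain ⟨t, -, ht⟩ := isCompact_univ.elim_nhds_subcover (fun y => {z | ∀ r : ℝ, |r| ≤ ε y →
    PosForm oC (𝒟.horiz σ r) z}) fun y _ => h y
  rcases t.eq_empty_or_nonempty with rfl | hne
  · exact ⟨1, one_pos, fun r _ y => by simpa using ht (mem_univ y)⟩
  · obtain ⟨x₀, -, hx₀⟩ := t.exists_min_image (fun x => ε x) hne
    refine ⟨ε x₀, hε _, fun r hr y => ?_⟩
    obtain ⟨x, hx, hy⟩ := mem_iUnion₂.1 (ht (mem_univ y))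
    exact hy r (hr.trans (hx₀ x hx))

/-- Near a point where all data are standard, there are coordinates in which the symplectic form
and the vector field are standard. -/
theorem Conn.exists_darboux {f : C → Plane} {q : C} {k a : ℝ} (hk : 0 < k) (hf : IsCoord oC f q)
    (hη : ∀ᶠ y in 𝓝 q, 𝒟.form q y = 0) (hσ : ∀ᶠ y in 𝓝 q, σ y = (2 * k) • area (𝓡 2) f y)
    (hβ : ∀ᶠ y in 𝓝 q, β y = k • rot (𝓡 2) f y + (a / 2) • ang (𝓡 2) f y) {O : Set C}
    (hO : O ∈ 𝓝 q) (B : ℝ) :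
    ∃ δ₀ > 0, ∀ δ, 0 < δ → δ ≤ δ₀ → ∃ (ψ : OpenPartialHomeomorph C Plane)
      (χ : TotalSpace Plane E → Plane), ψ ∈ IsManifold.maximalAtlas (𝓡 2) ∞ C ∧
        q ∈ ψ.source ∧ ψ.source ⊆ O ∧ ψ q = 0 ∧
        ψ.target = Metric.ball (0 : Plane) (Real.sqrt δ) ∧
        ContMDiffOn totalModel 𝓘(ℝ, Plane) ∞ χ {v | v.1 ∈ ψ.source} ∧
        (∀ y ∈ ψ.source, ∃ L : E y →ₗ[ℝ] Plane, ∀ w : E y,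
          χ ⟨y, w⟩ = L w ∧ ‖L w‖ = Real.sqrt δ * ‖w‖) ∧
        (∀ v : TotalSpace Plane E, v.1 ∈ ψ.source → ∀ u w : TangentSpace totalModel v,
          𝒟.symp σ δ v ![u, w] =
            stdArea (planeDeriv totalModel (fun z => ψ z.1) v u)
              (planeDeriv totalModel (fun z => ψ z.1) v w) +
            stdArea (planeDeriv totalModel χ v u) (planeDeriv totalModel χ v w)) ∧
        ∀ v : TotalSpace Plane E, v.1 ∈ ψ.source → sqNorm v ≠ 0 →
          planeDeriv totalModel (fun z => ψ z.1) v (𝒟.field σ β δ B v) = radialField a (ψ v.1) ∧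
          planeDeriv totalModel χ v (𝒟.field σ β δ B v) = radialField B (χ v) := by
  set s := Real.sqrt (2 * k) with hs
  have hs0 : 0 < s := Real.sqrt_pos.2 (by linarith)
  have hs2 : s ^ 2 = 2 * k := Real.sq_sqrt (by linarith)
  have hsm : ∀ {y}, SmoothNear (𝓡 2) 𝓘(ℝ, Plane) f y →
      SmoothNear (𝓡 2) 𝓘(ℝ, Plane) (fun y => s • f y) y := fun h => (smoothNear_const s _).smul h
  have hcoord : IsCoord oC (fun y => s • f y) q := by
    refine ⟨hsm hf.smooth, by simp only [hf.zero, smul_zero], fun u w huw => ?_⟩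
    have := hf.pos u w huw
    rw [area_apply hf.smooth.mdiff] at this
    rw [area_apply (hsm hf.smooth).mdiff, planeDeriv_const_smul _ hf.smooth,
      planeDeriv_const_smul _ hf.smooth, stdArea_smul_smul]
    positivity
  have hgood : ∀ᶠ y in 𝓝 q, 𝒟.Local (𝒟.left q) (𝒟.right q) (𝒟.form q) y ∧ 𝒟.form q y = 0 ∧
      𝒟.curv y = 0 ∧ σ y = (2 * k) • area (𝓡 2) f y ∧
      β y = k • rot (𝓡 2) f y + (a / 2) • ang (𝓡 2) f y ∧
      SmoothNear (𝓡 2) 𝓘(ℝ, Plane) f y ∧ PosForm oC (area (𝓡 2) f) y ∧ y ∈ O := by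
    filter_upwards [𝒟.eventually_local q, hη.eventually_nhds, hσ, hβ, hf.smooth.eventually,
      area_pos_eventually hf.smooth hf.pos, hO] with y h1 h2 h3 h4 h5 h6 h7
    refine ⟨h1, h2.self_of_nhds, ?_, h3, h4, h5, h6, h7⟩
    rw [h1.curv, extd_congr repAt_zero h2, extd_zero]
  obtain ⟨r₀, hr₀, hchart⟩ := hcoord.exists_chart hgood
  refine ⟨r₀ ^ 2, by positivity, fun δ hδ hδ₀ => ?_⟩
  obtain ⟨ψ, hψ, hq, hsub, htar, heq⟩ := hchart (Real.sqrt δ) (Real.sqrt_pos.2 hδ)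
    (Real.sqrt_le_iff.2 ⟨hr₀.le, hδ₀⟩)
  have hd0 : 0 < Real.sqrt δ := Real.sqrt_pos.2 hδ
  have hd2 : Real.sqrt δ ^ 2 = δ := Real.sq_sqrt hδ.le
  have hψd : ∀ v : TotalSpace Plane E, v.1 ∈ ψ.source → ∀ X : TangentSpace totalModel v,
      planeDeriv totalModel (fun z => ψ z.1) v X = s • planeDeriv (𝓡 2) f v.1 (dproj v X) := by
    intro v hv X
    have hg := hsub hv
    have e : (fun z : TotalSpace Plane E => ψ z.1) =ᶠ[𝓝 v]
        (fun y => s • f y) ∘ (proj : TotalSpace Plane E → C) := by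
      filter_upwards [(smoothNear_proj v).continuousAt (ψ.open_source.mem_nhds hv)] with w hw
      exact (heq _ hw).1
    have k := mfderiv_comp (I := totalModel) (I' := 𝓡 2) (I'' := 𝓘(ℝ, Plane)) v
      (g := fun y => s • f y) (f := (proj : TotalSpace Plane E → C))
      (hsm hg.2.2.2.2.2.1).mdiff (smoothNear_proj v).mdiff
    have k2 : planeDeriv totalModel (fun z => ψ z.1) v X =
        planeDeriv (𝓡 2) (fun y => s • f y) v.1 (dproj v X) :=
      (DFunLike.congr_fun e.mfderiv_eq X).trans (DFunLike.congr_fun k X)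
    rw [k2, planeDeriv_const_smul _ hg.2.2.2.2.2.1]
  have hFn : ∀ v : TotalSpace Plane E, v.1 ∈ ψ.source →
      SmoothNear totalModel 𝓘(ℝ, Plane) (frameMap (𝒟.left q) (𝒟.right q)) v := fun v hv =>
    (hsub hv).1.frame.at.smoothNear
  have hχd : ∀ v : TotalSpace Plane E, v.1 ∈ ψ.source → ∀ X : TangentSpace totalModel v,
      planeDeriv totalModel (fun v => Real.sqrt δ • frameMap (𝒟.left q) (𝒟.right q) v) v X =
        Real.sqrt δ • cov (𝒟.left q) (𝒟.right q) (𝒟.form q) v X := by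
    intro v hv X
    rw [planeDeriv_const_smul _ (hFn v hv), cov, (hsub hv).2.1]
    congr 1
    ext i
    fin_cases i <;> simp
  refine ⟨ψ, fun v => Real.sqrt δ • frameMap (𝒟.left q) (𝒟.right q) v, hψ, hq,
    fun y hy => (hsub hy).2.2.2.2.2.2.2, by rw [(heq q hq).1, hf.zero, smul_zero], htar,
    fun v hv => ((smoothNear_const (Real.sqrt δ) v).smul (hFn v hv)).self.contMDiffWithinAt,
    fun y hy => ?_, fun v hv X Y => ?_, fun v hv hv0 => ?_⟩
  · refine ⟨Real.sqrt δ • ((innerₛₗ ℝ (𝒟.left q y)).smulRight (EuclideanSpace.single 0 1 : Plane) +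
      (innerₛₗ ℝ (𝒟.right q y)).smulRight (EuclideanSpace.single 1 1 : Plane)), fun w => ?_⟩
    have e : frameMap (𝒟.left q) (𝒟.right q) ⟨y, w⟩ =
        ((innerₛₗ ℝ (𝒟.left q y)).smulRight (EuclideanSpace.single 0 1 : Plane) +
        (innerₛₗ ℝ (𝒟.right q y)).smulRight (EuclideanSpace.single 1 1 : Plane)) w := by
      ext i
      fin_cases i <;> simp [frameMap]
    rw [LinearMap.smul_apply, ← e]
    refine ⟨rfl, ?_⟩
    have hn := (hsub hy).1.frame.at.sqNorm_eq (v := ⟨y, w⟩)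
    rw [sqNorm, sq_eq_sq₀ (norm_nonneg _) (norm_nonneg _)] at hn
    rw [norm_smul, Real.norm_of_nonneg hd0.le, ← hn]
  · obtain ⟨hl, h0, hκ, hσv, hβv, hfs, hfp, -⟩ := hsub hv
    rw [hψd v hv, hψd v hv, hχd v hv, hχd v hv, stdArea_smul_smul, stdArea_smul_smul, hs2, hd2,
      hl.symp_apply]
    congr 1
    change σ v.1 ![dproj v X, dproj v Y] + (δ * sqNorm v) / 2 * 𝒟.curv v.1 ![dproj v X, dproj v Y] = _
    rw [hσv, hκ]
    change 2 * k * area (𝓡 2) f v.1 ![dproj v X, dproj v Y] + (δ * sqNorm v) / 2 * (0 : ℝ) = _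
    rw [area_apply hfs.mdiff]
    ring
  · obtain ⟨hl, h0, hκ, hσv, hβv, hfs, hfp, -⟩ := hsub hv
    have hpos : PosForm oC (𝒟.horiz σ (δ * sqNorm v)) v.1 := fun u w huw => by
      change 0 < σ v.1 ![u, w] + (δ * sqNorm v) / 2 * 𝒟.curv v.1 ![u, w]
      rw [hσv, hκ]
      have := hfp u w huw
      change 0 < 2 * k * area (𝓡 2) f v.1 ![u, w] + (δ * sqNorm v) / 2 * (0 : ℝ)
      rw [mul_zero, add_zero]
      positivity
    constructor
    · rw [hψd v hv, Conn.planeDeriv_field (oC := oC) hk hδ hfs hfp hσv hκ hβv hv0, smul_comm,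
        ← smul_eq_radialField, (heq _ hv).1, norm_smul, mul_pow, Real.norm_of_nonneg hs0.le, hs2]
    · rw [hχd v hv, (hl.field_eq hδ hpos hv0).2, smul_comm, ← smul_eq_radialField, norm_smul,
        mul_pow, Real.norm_of_nonneg hd0.le, hd2, ← hl.frame.at.sqNorm_eq]

end Standard

section ConvexNbhd

lemma exists_pos_lt_of_isCompact {X : Type*} [TopologicalSpace X] {S : Set X} {φ : X → ℝ}
    (hS : IsCompact S) (hφ : Continuous φ) (hpos : ∀ x ∈ S, 0 < φ x) :
    ∃ ε > 0, ∀ x ∈ S, ε < φ x := by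
  rcases S.eq_empty_or_nonempty with rfl | hne
  · exact ⟨1, one_pos, fun x hx => absurd hx (notMem_empty x)⟩
  · obtain ⟨x₀, hx₀, hmin⟩ := hS.exists_isMinOn hne hφ.continuousOn
    exact ⟨φ x₀ / 2, half_pos (hpos x₀ hx₀), fun x hx =>
      (half_lt_self (hpos x₀ hx₀)).trans_le (hmin hx)⟩

variable {C : Type*} [TopologicalSpace C] [ChartedSpace Plane C] [IsManifold (𝓡 2) ∞ C]
  {E : C → Type*} [TopologicalSpace (TotalSpace Plane E)]
  [∀ x, NormedAddCommGroup (E x)] [∀ x, InnerProductSpace ℝ (E x)]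
  [FiberBundle Plane E] [VectorBundle ℝ Plane E]
  [ContMDiffVectorBundle ∞ Plane E (𝓡 2)]
  [IsContMDiffRiemannianBundle (𝓡 2) ∞ Plane E]
  {oC : SurfaceOrientation C} {oE : BundleOrientation E}

lemma continuous_sqNorm : Continuous (sqNorm (E := E)) :=
  (contMDiff_sqNorm (E := E)).continuous

lemma sqNorm_nonneg (v : TotalSpace Plane E) : 0 ≤ sqNorm v := sq_nonneg _

lemma mem_diskBundle_iff {v : TotalSpace Plane E} : v ∈ diskBundle E ↔ sqNorm v ≤ 1 := by
  change ‖v.2‖ ≤ 1 ↔ ‖v.2‖ ^ 2 ≤ 1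
  rw [sq_le_one_iff₀ (norm_nonneg _)]

lemma sqNorm_eq_zero_iff {v : TotalSpace Plane E} : sqNorm v = 0 ↔ v.2 = 0 := by
  rw [sqNorm, sq_eq_zero_iff, norm_eq_zero]

lemma isClosed_diskBundle : IsClosed (diskBundle E) := by
  have : diskBundle E = {v | sqNorm v ≤ 1} := Set.ext fun v => mem_diskBundle_iff
  rw [this]
  exact isClosed_le continuous_sqNorm continuous_const

lemma exists_isCompact_over [T2Space C] [LocallyCompactSpace C] (oE : BundleOrientation E) (y : C) :
    ∃ U ∈ 𝓝 y, IsClosed U ∧ ∃ S : Set (TotalSpace Plane E), IsCompact S ∧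
      ∀ v ∈ diskBundle E, v.1 ∈ U → v ∈ S := by
  obtain ⟨e₀, e₁, h⟩ := exists_isFrame oE y
  set T := trivializationAt Plane E y with hT
  have hb : ∀ᶠ z in 𝓝 y, z ∈ T.baseSet := T.open_baseSet.mem_nhds
    (mem_baseSet_trivializationAt Plane E y)
  have hbd : ∀ e : ∀ x, E x, SmoothSec e y → ∃ R, ∀ᶠ z in 𝓝 y, ‖(T ⟨z, e z⟩).2‖ < R := fun e he =>
    ⟨_, (smoothNear_trivialization he).continuousAt.norm.eventually_lt_const (lt_add_one _)⟩
  obtain ⟨R₀, h0⟩ := hbd e₀ h.at.smooth_left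
  obtain ⟨R₁, h1⟩ := hbd e₁ h.at.smooth_right
  obtain ⟨U, hU, hUs, hUc⟩ := local_compact_nhds (h.and (hb.and (h0.and h1)))
  refine ⟨U, hU, hUc.isClosed, T.toOpenPartialHomeomorph.symm ''
    (U ×ˢ Metric.closedBall 0 (R₀ + R₁)), ?_, fun v hv hvU => ?_⟩
  · refine (hUc.prod (isCompact_closedBall _ _)).image_of_continuousOn
      (T.toOpenPartialHomeomorph.continuousOn_symm.mono fun z hz => ?_)
    exact T.mem_target.2 (hUs hz.1).2.1
  · obtain ⟨hf, hbs, hn0, hn1⟩ := hUs hvU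
    refine ⟨T v, ⟨?_, ?_⟩, T.toOpenPartialHomeomorph.left_inv (T.mem_source.2 hbs)⟩
    · rwa [T.coe_fst (T.mem_source.2 hbs)]
    · rw [mem_closedBall_zero_iff]
      have e1 : (T v).2 = frameMap e₀ e₁ v 0 • (T ⟨v.1, e₀ v.1⟩).2 +
          frameMap e₀ e₁ v 1 • (T ⟨v.1, e₁ v.1⟩).2 := by
        have k : ∀ w : E v.1, T.continuousLinearMapAt ℝ v.1 w = (T ⟨v.1, w⟩).2 := fun w =>
          Trivialization.continuousLinearMapAt_apply_of_mem (R := ℝ) _ hbs w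
        have k2 : v.2 = frameMap e₀ e₁ v 0 • e₀ v.1 + frameMap e₀ e₁ v 1 • e₁ v.1 :=
          (FrameAt.frameSec_frameMap hf v.2).symm
        rw [← k (e₀ v.1), ← k (e₁ v.1)]
        refine ((k v.2).symm.trans (congrArg _ k2)).trans ((map_add _ _ _).trans ?_)
        exact congrArg₂ _ (map_smul _ _ _) (map_smul _ _ _)
      have e2 : frameMap e₀ e₁ v 0 ^ 2 + frameMap e₀ e₁ v 1 ^ 2 ≤ 1 := by
        rw [← plane_norm_sq, ← hf.sqNorm_eq]
        exact mem_diskBundle_iff.1 hv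
      have a0 : |frameMap e₀ e₁ v 0| ≤ 1 := abs_le_one_iff_mul_self_le_one.2 (by nlinarith)
      have a1 : |frameMap e₀ e₁ v 1| ≤ 1 := abs_le_one_iff_mul_self_le_one.2 (by nlinarith)
      rw [e1]
      refine (norm_add_le _ _).trans (add_le_add ?_ ?_)
      · rw [norm_smul]
        exact (mul_le_of_le_one_left (norm_nonneg _) a0).trans hn0.le
      · rw [norm_smul]
        exact (mul_le_of_le_one_left (norm_nonneg _) a1).trans hn1.le

lemma isCompact_diskBundle [T2Space C] [CompactSpace C] (oE : BundleOrientation E) :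
    IsCompact (diskBundle E) := by
  choose U hU _ S hS hSU using fun y : C => exists_isCompact_over oE y
  obtain ⟨t, -, ht⟩ := isCompact_univ.elim_nhds_subcover U fun y _ => hU y
  refine (t.isCompact_biUnion fun y _ => hS y).of_isClosed_subset isClosed_diskBundle fun v hv => ?_
  obtain ⟨y, hy, hvy⟩ := mem_iUnion₂.1 (ht (mem_univ v.1))
  exact mem_iUnion₂.2 ⟨y, hy, hSU y v hv hvy⟩

lemma dR_comp_proj {g : C → ℝ} {v : TotalSpace Plane E}
    (hg : MDifferentiableAt (𝓡 2) 𝓘(ℝ, ℝ) g v.1) (X : TangentSpace totalModel v) :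
    dR totalModel (fun v : TotalSpace Plane E => g v.1) v X = dR (𝓡 2) g v.1 (dproj v X) :=
  DFunLike.congr_fun (dR_pull (h := (proj : TotalSpace Plane E → C)) hg (smoothNear_proj v).mdiff) X

variable {ι : Type} [Fintype ι] {f : ι → C → Plane} {p : ι → C} {O : ι → Set C}

/-- The product of the functions `s` of finitely many disks. -/
def discProd (D : ∀ i, Disc oC (f i) (p i) (O i)) (y : C) : ℝ := ∏ i, (D i).s y

lemma contMDiff_discProd (D : ∀ i, Disc oC (f i) (p i) (O i)) :
    ContMDiff (𝓡 2) 𝓘(ℝ, ℝ) ∞ (discProd D) :=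
  contMDiff_finsetProd fun i _ => (D i).smooth

lemma Disc.s_nonneg {f : C → Plane} {p : C} {O : Set C} (D : Disc oC f p O) (y : C) :
    0 ≤ D.s y := by
  by_cases h : y = p
  · rw [h, D.zero]
  · exact (D.s_pos h).le

lemma discProd_nonneg (D : ∀ i, Disc oC (f i) (p i) (O i)) (y : C) : 0 ≤ discProd D y :=
  Finset.prod_nonneg fun i _ => (D i).s_nonneg y

lemma discProd_eq_zero_iff (D : ∀ i, Disc oC (f i) (p i) (O i)) {y : C} :
    discProd D y = 0 ↔ ∃ i, y = p i := by
  rw [discProd, Finset.prod_eq_zero_iff]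
  constructor
  · rintro ⟨i, -, hi⟩
    by_contra! h
    exact ((D i).s_pos (h i)).ne' hi
  · rintro ⟨i, rfl⟩
    exact ⟨i, Finset.mem_univ i, (D i).zero⟩

open Classical in
lemma dR_discProd (D : ∀ i, Disc oC (f i) (p i) (O i)) (y : C) :
    dR (𝓡 2) (discProd D) y =
      ∑ i, (∏ j ∈ Finset.univ.erase i, (D j).s y) • dR (𝓡 2) (D i).s y := by
  have h := HasMFDerivAt.prod (I := 𝓡 2) (t := Finset.univ) (f := fun i => (D i).s) (z := y)
    (f' := fun i => mfderiv (𝓡 2) 𝓘(ℝ, ℝ) (D i).s y)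
    fun i _ => ((D i).smooth.mdifferentiable (by simp) y).hasMFDerivAt
  have e : (∏ i, (D i).s) = discProd D := by
    funext z
    rw [Finset.prod_apply]
    rfl
  rw [e] at h
  exact h.mfderiv

lemma dR_discProd_apply_nonneg (D : ∀ i, Disc oC (f i) (p i) (O i)) {y : C}
    {u : TangentSpace (𝓡 2) y} (h : ∀ i, y ∈ O i → 0 ≤ dR (𝓡 2) (fun z => ‖f i z‖ ^ 2) y u) :
    0 ≤ dR (𝓡 2) (discProd D) y u := by
  classical
  rw [dR_discProd, sum_smul_clm_apply]
  refine Finset.sum_nonneg fun i _ => mul_nonneg (Finset.prod_nonneg fun j _ => (D j).s_nonneg y) ?_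
  rcases (D i).grad y with h0 | ⟨hy, c, hc, h1⟩
  · rw [h0]; exact le_rfl
  · rw [h1]; exact mul_nonneg hc (h i hy)

lemma exists_dR_discProd_ne_zero (D : ∀ i, Disc oC (f i) (p i) (O i))
    (hO : ∀ i j, i ≠ j → Disjoint (O i) (O j)) {y : C} {i : ι} (hy : (D i).s y < (D i).t)
    (h0 : discProd D y ≠ 0) : ∃ u, dR (𝓡 2) (discProd D) y u ≠ 0 := by
  classical
  have hne : ∀ j, y ≠ p j := fun j e => h0 ((discProd_eq_zero_iff D).2 ⟨j, e⟩)
  have hf := (D i).smooth_f y hy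
  have hf0 := (D i).f_ne_zero hy (hne i)
  have e : dR (𝓡 2) (discProd D) y =
      (∏ j ∈ Finset.univ.erase i, (D j).s y) • dR (𝓡 2) (fun z => ‖f i z‖ ^ 2) y := by
    rw [dR_discProd, Finset.sum_eq_single i]
    · congr 1
      refine dR_congr ?_
      filter_upwards [((D i).isOpen (D i).t).mem_nhds hy] with z hz using (D i).eq z hz
    · intro j _ hj
      rcases (D j).grad y with h | ⟨hyj, -⟩
      · rw [h]; exact smul_zero _
      · exact absurd ((D i).subset y hy) (Set.disjoint_left.1 (hO j i hj) hyj)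
    · exact fun h => absurd (Finset.mem_univ i) h
  have hP : (∏ j ∈ Finset.univ.erase i, (D j).s y) ≠ 0 :=
    Finset.prod_ne_zero_iff.2 fun j _ => ((D j).s_pos (hne j)).ne'
  by_contra! hall
  have hz : ∀ u, dR (𝓡 2) (fun z => ‖f i z‖ ^ 2) y u = 0 := fun u => by
    have := hall u
    rw [e] at this
    exact (mul_eq_zero.1 this).resolve_left hP
  obtain ⟨u, w, huw⟩ := exists_posPair_tangent oC y
  have hA := (D i).pos y hy u w huw
  have hu := hz u
  have hw := hz w
  rw [dR_normSq hf] at hu hw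
  change 2 * f i y 0 * dR (𝓡 2) (co (f i) 0) y u + 2 * f i y 1 * dR (𝓡 2) (co (f i) 1) y u = 0 at hu
  change 2 * f i y 0 * dR (𝓡 2) (co (f i) 0) y w + 2 * f i y 1 * dR (𝓡 2) (co (f i) 1) y w = 0 at hw
  change 0 < dR (𝓡 2) (co (f i) 0) y u * dR (𝓡 2) (co (f i) 1) y w -
    dR (𝓡 2) (co (f i) 0) y w * dR (𝓡 2) (co (f i) 1) y u at hA
  generalize dR (𝓡 2) (co (f i) 0) y u = a at *
  generalize dR (𝓡 2) (co (f i) 1) y u = b at *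
  generalize dR (𝓡 2) (co (f i) 0) y w = c at *
  generalize dR (𝓡 2) (co (f i) 1) y w = d at *
  have h2 : f i y 0 * (a * d - c * b) = 0 := by linear_combination (d / 2) * hu - (b / 2) * hw
  have h3 : f i y 1 * (a * d - c * b) = 0 := by linear_combination (a / 2) * hw - (c / 2) * hu
  refine hf0 ?_
  ext j
  fin_cases j
  · exact (mul_eq_zero.1 h2).resolve_right hA.ne'
  · exact (mul_eq_zero.1 h3).resolve_right hA.ne'

/-- Sublevel sets in the disk bundle of the product of `ρ` and of the squared distances to finitely
many fibers are convex neighborhoods. -/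
theorem exists_isConvexNbhd [T2Space C] [CompactSpace C] (oE : BundleOrientation E)
    (D : ∀ i, Disc oC (f i) (p i) (O i)) (hO : ∀ i j, i ≠ j → Disjoint (O i) (O j))
    {V : ∀ v : TotalSpace Plane E, TangentSpace totalModel v} {K : Set (TotalSpace Plane E)}
    (hK : K = zeroSec E ∪ {v | ∃ i, v.1 = p i})
    (hρ : ∀ v ∈ diskBundle E, v ∉ K → 0 < dR totalModel sqNorm v (V v))
    (hf : ∀ v ∈ diskBundle E, v ∉ K → ∀ i, v.1 ∈ O i →
      0 ≤ dR (𝓡 2) (fun z => ‖f i z‖ ^ 2) v.1 (dproj v (V v)))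
    {W : Set (TotalSpace Plane E)} (hW : IsOpen W) (hKW : K ∩ diskBundle E ⊆ W) :
    ∃ N : Set (TotalSpace Plane E), N ⊆ W ∧ IsConvexNbhd V K N := by
  set g := discProd D with hg
  have hgs := contMDiff_discProd D
  let F : TotalSpace Plane E → ℝ := fun v => sqNorm v * g v.1
  have hgp : ∀ v : TotalSpace Plane E, SmoothNear totalModel 𝓘(ℝ, ℝ)
      (fun v : TotalSpace Plane E => g v.1) v := fun v =>
    SmoothNear.comp (I' := 𝓡 2) (f := proj) (hgs.smoothNear v.1) (smoothNear_proj v)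
  have hF : ∀ v, SmoothNear totalModel 𝓘(ℝ, ℝ) F v := fun v =>
    (contMDiff_sqNorm.smoothNear v).mul (hgp v)
  have hFc : Continuous F := continuous_iff_continuousAt.2 fun v => (hF v).continuousAt
  have hF0 : ∀ v, 0 ≤ F v := fun v => mul_nonneg (sqNorm_nonneg v) (discProd_nonneg D _)
  have hFK : ∀ v, F v = 0 ↔ v ∈ K := fun v => by
    rw [hK, mul_eq_zero, sqNorm_eq_zero_iff, discProd_eq_zero_iff]
    rfl
  have hDc := isCompact_diskBundle oE
  obtain ⟨ε₁, hε₁, h1⟩ := exists_pos_lt_of_isCompact (hDc.diff hW) hFc fun v hv => by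
    refine (hF0 v).lt_of_ne' fun h => hv.2 (hKW ⟨(hFK v).1 h, hv.1⟩)
  obtain ⟨ε₂, hε₂, h2⟩ := exists_pos_lt_of_isCompact
    (isCompact_univ.diff (isOpen_iUnion fun i => (D i).isOpen (D i).t)) hgs.continuous fun y hy => by
      refine (discProd_nonneg D y).lt_of_ne' fun h => ?_
      obtain ⟨i, rfl⟩ := (discProd_eq_zero_iff D).1 h
      exact hy.2 (mem_iUnion.2 ⟨i, (D i).mem⟩)
  set ε := min ε₁ ε₂ with hε
  have hε0 : 0 < ε := lt_min hε₁ hε₂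
  have hN : IsClosed (diskBundle E ∩ {v | F v ≤ ε}) :=
    isClosed_diskBundle.inter (isClosed_le hFc continuous_const)
  refine ⟨diskBundle E ∩ {v | F v ≤ ε}, fun v hv => ?_, ?_⟩
  · by_contra hvW
    have := h1 v ⟨hv.1, hvW⟩
    exact absurd (hv.2.trans (min_le_left _ _)) (not_le.2 this)
  refine ⟨inter_subset_left, hDc.of_isClosed_subset hN inter_subset_left, hN, fun v hv hvD => ?_,
    fun v hv => ?_, fun v hv hvK hv1 => hρ v hv.1 hvK⟩
  · have : ∀ᶠ w in 𝓝 v, F w < ε := hFc.continuousAt.eventually_lt_const (by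
      rw [(hFK v).2 hv]; exact hε0)
    filter_upwards [nhdsWithin_le_nhds this, self_mem_nhdsWithin] with w hw hwD
    exact ⟨hwD, hw.le⟩
  · have hFv : F v = ε := by
      refine le_antisymm hv.1.2 (not_lt.1 fun hlt => ?_)
      have h3 : {w | F w < ε} ∈ 𝓝 v := hFc.continuousAt.eventually_lt_const hlt
      obtain ⟨w, hw1, hw2, hw3⟩ := mem_closure_iff_nhds.1 hv.2 _ h3
      exact hw3 ⟨hw2, le_of_lt (show F w < ε from hw1)⟩
    have hprod : 0 < sqNorm v * g v.1 := hε0.trans_eq hFv.symm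
    have hg0 : 0 < g v.1 := pos_of_mul_pos_right hprod (sqNorm_nonneg v)
    have hs0 : 0 < sqNorm v := pos_of_mul_pos_left hprod hg0.le
    have hvK : v ∉ K := fun h => hprod.ne' ((hFK v).2 h)
    have hdF : ∀ X : TangentSpace totalModel v, dirDeriv totalModel (fun v => F v - ε) v X =
        sqNorm v * dR (𝓡 2) g v.1 (dproj v X) + g v.1 * dR totalModel sqNorm v X := fun X => by
      have e1 : dR totalModel (fun v => F v - ε) v = dR totalModel F v := by
        rw [dR_sub (hF v).mdiff (smoothNear_const ε v).mdiff, dR_const, sub_zero]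
      have e2 : dR totalModel F v = _ :=
        dR_mul (contMDiff_sqNorm.smoothNear v).mdiff (hgp v).mdiff
      change dR totalModel (fun v => F v - ε) v X = _
      rw [e1, e2, ← dR_comp_proj ((hgs.smoothNear v.1).mdiff)]
      rfl
    refine ⟨univ, fun v => F v - ε, isOpen_univ, mem_univ v,
      fun w _ => ((hF w).sub (smoothNear_const ε w)).self.contMDiffWithinAt, fun w hw => ?_, ?_,
      fun h1v => ?_⟩
    · rw [sub_nonpos]
      exact ⟨fun h => h.2, fun h => ⟨hw.2, h⟩⟩
    · rw [hdF]
      exact add_pos_of_nonneg_of_pos (mul_nonneg hs0.le (dR_discProd_apply_nonneg D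
        fun i hi => hf v hv.1.1 hvK i hi)) (mul_pos hg0 (hρ v hv.1.1 hvK))
    · have hgε : g v.1 = ε := by rw [← hFv]; change _ = sqNorm v * g v.1; rw [h1v, one_mul]
      obtain ⟨i, hi⟩ : ∃ i, (D i).s v.1 < (D i).t := by
        by_contra! hno
        have := h2 v.1 ⟨mem_univ _, fun hm => by
          obtain ⟨i, hi⟩ := mem_iUnion.1 hm
          exact absurd hi (not_lt.2 (hno i))⟩
        exact absurd (min_le_right ε₁ ε₂) (not_le.2 (this.trans_eq hgε))
      obtain ⟨w, hw⟩ := exists_dR_discProd_ne_zero D hO hi hg0.ne'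
      obtain ⟨e₀, e₁, he⟩ := exists_isFrame oE v.1
      obtain ⟨X, hX1, hX2⟩ := he.at.exists_cov 0 w 0
      have hX3 : dR totalModel sqNorm v X = 0 := by
        rw [he.dR_sqNorm (η := 0), hX2]
        simp
      refine ⟨X, hX3, ?_⟩
      rw [hdF, hX3, hX1, mul_zero, add_zero]
      exact mul_ne_zero hs0.ne' hw

end ConvexNbhd

section Data

variable {C : Type*} [TopologicalSpace C] [ChartedSpace Plane C] [IsManifold (𝓡 2) ∞ C]
  {E : C → Type*} [TopologicalSpace (TotalSpace Plane E)]
  [∀ x, NormedAddCommGroup (E x)] [∀ x, InnerProductSpace ℝ (E x)]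
  [FiberBundle Plane E] [VectorBundle ℝ Plane E]
  [ContMDiffVectorBundle ∞ Plane E (𝓡 2)]
  [IsContMDiffRiemannianBundle (𝓡 2) ∞ Plane E]
  {oC : SurfaceOrientation C} {oE : BundleOrientation E}

/-- A connection on a bundle of degree `-d`, an area form `σ` of the base, and a primitive `β` of
`σ` minus a multiple of the curvature, with residues `w / 2` at given points, near which all of
these are standard. -/
theorem HasDegree.exists_base_data [T2Space C] [CompactSpace C] [ConnectedSpace C]
    [MeasurableSpace C] [BorelSpace C] {d : ℤ} (h : HasDegree oC oE (-d)) (Q₀ : Finset C)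
    (w : C → ℝ) (hw : ∀ q, q ∉ Q₀ → w q = 0) (B : ℝ) (hM : 0 < B * d - ∑ q ∈ Q₀, w q) :
    ∃ (𝒟 : Conn oE) (f : C → C → Plane) (k : C → ℝ) (σ : FormField (𝓡 2) C 2)
      (β : OneForm (𝓡 2) C), LocallyExact σ ∧ (∀ y, PosForm oC σ y) ∧
      (∃ ν : Measure C, IsAreaMeasure σ ν ∧
        ν univ = ENNReal.ofReal (Real.pi * (B * d - ∑ q ∈ Q₀, w q))) ∧
      (∀ y, w y = 0 → RepAt β y ∧ extd β y = 𝒟.horiz σ (-B) y) ∧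
      ∀ q ∈ Q₀, 0 < k q ∧ IsCoord oC (f q) q ∧ (∀ᶠ y in 𝓝 q, 𝒟.form q y = 0) ∧
        (∀ᶠ y in 𝓝 q, σ y = (2 * k q) • area (𝓡 2) (f q) y) ∧
        ∀ᶠ y in 𝓝 q, β y = k q • rot (𝓡 2) (f q) y + (w q / 2) • ang (𝓡 2) (f q) y := by
  obtain ⟨Q, 𝒟, f, ε, η, hQ, hf, hε, hη, hform⟩ := h.exists_conn Q₀
  have hwQ : ∑ q ∈ Q, w q = ∑ q ∈ Q₀, w q :=
    (Finset.sum_subset hQ fun q _ hq => hw q hq).symm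
  obtain ⟨β', σ, k, h1, h2, h3, ν, hν, hν2⟩ := exists_base_form oC Q f hf
    (fun q => B / 2 * ε q + w q / 2) (M := (B * d - ∑ q ∈ Q₀, w q) / 2) (by linarith) (by
      rw [Finset.sum_coe_sort Q (fun q => B / 2 * ε q + w q / 2), Finset.sum_add_distrib,
        ← Finset.mul_sum, ← Finset.sum_div, hε, hwQ]
      push_cast
      ring)
  have hQc : ∀ y, y ∉ Q → ∀ᶠ z in 𝓝 y, z ∉ Q := fun y hy =>
    (Finset.finite_toSet Q).isClosed.isOpen_compl.mem_nhds hy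
  have hrot : ∀ q ∈ Q, RepAt (k q • rot (𝓡 2) (f q)) q ∧
      ∀ᶠ y in 𝓝 q, extd (k q • rot (𝓡 2) (f q)) y = (2 * k q) • area (𝓡 2) (f q) y := fun q hq => by
    refine ⟨(repAt_rot (hf q hq).smooth).const_smul _, ?_⟩
    filter_upwards [(hf q hq).smooth.eventually] with y hy
    rw [extd_const_smul _ (repAt_rot hy), extd_rot hy, smul_smul, mul_comm]
  have hβ : ∀ q ∈ Q, ∀ᶠ y in 𝓝 q, (β' - (B / 2) • η) y =
      k q • rot (𝓡 2) (f q) y + (w q / 2) • ang (𝓡 2) (f q) y := fun q hq => by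
    filter_upwards [(h3 q hq).2.1, (hη q hq).1] with y hy1 hy2
    change β' y - (B / 2) • η y = _
    rw [hy1, hy2, smul_smul, add_smul]
    abel
  refine ⟨𝒟, f, k, σ, β' - (B / 2) • η, fun y => ?_, h2, ⟨ν, hν, ?_⟩, fun y hy => ?_, fun q hq =>
    ⟨(h3 q (hQ hq)).1, hf q (hQ hq), (hη q (hQ hq)).2, (h3 q (hQ hq)).2.2, hβ q (hQ hq)⟩⟩
  · by_cases hy : y ∈ Q
    · refine ⟨_, (hrot y hy).1, ?_⟩
      filter_upwards [(hrot y hy).2, (h3 y hy).2.2] with z hz1 hz2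
      rw [hz1, hz2]
    · exact ⟨β', (h1 y hy).1, (hQc y hy).mono fun z hz => (h1 z hz).2.symm⟩
  · rw [hν2]
    congr 1
    ring
  · by_cases hyQ : y ∈ Q
    · have e : ∀ᶠ z in 𝓝 y, (β' - (B / 2) • η) z = (k y • rot (𝓡 2) (f y)) z := by
        filter_upwards [hβ y hyQ] with z hz
        rw [hz, hy, zero_div, zero_smul, add_zero]
        rfl
      refine ⟨(hrot y hyQ).1.congr e, ?_⟩
      rw [extd_congr (hrot y hyQ).1 e, (hrot y hyQ).2.self_of_nhds,
        ← (h3 y hyQ).2.2.self_of_nhds]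
      have hκ : 𝒟.curv y = 0 := by
        rw [Conn.curv, extd_congr repAt_zero (hη y hyQ).2, extd_zero]
      change σ y = σ y + (-B / 2) • 𝒟.curv y
      rw [hκ]
      exact ((congrArg _ (smul_zero _)).trans (add_zero _)).symm
    · have hr : RepAt η y := hform y hyQ ▸ 𝒟.repAt y
      refine ⟨(h1 y hyQ).1.sub (hr.const_smul _), ?_⟩
      rw [extd_sub (h1 y hyQ).1 (hr.const_smul _), extd_const_smul _ hr, (h1 y hyQ).2]
      change _ = σ y + (-B / 2) • extd (𝒟.form y) y
      rw [hform y hyQ]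
      refine alt_two_ext fun u u' => ?_
      change σ y ![u, u'] - B / 2 * extd η y ![u, u'] = σ y ![u, u'] + -B / 2 * extd η y ![u, u']
      ring

lemma dR_normSq_field_nonneg {𝒟 : Conn oE} {σ : FormField (𝓡 2) C 2} {β : OneForm (𝓡 2) C}
    {δ B : ℝ} {v : TotalSpace Plane E} {f : C → Plane} {k a : ℝ} (hk : 0 < k) (ha : 0 ≤ a)
    (hδ : 0 < δ) (hf : SmoothNear (𝓡 2) 𝓘(ℝ, Plane) f v.1)
    (hfpos : PosForm oC (area (𝓡 2) f) v.1)
    (hσ : σ v.1 = (2 * k) • area (𝓡 2) f v.1) (hκ : 𝒟.curv v.1 = 0)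
    (hβ : β v.1 = k • rot (𝓡 2) f v.1 + (a / 2) • ang (𝓡 2) f v.1) (hv : sqNorm v ≠ 0) :
    0 ≤ dR (𝓡 2) (fun z => ‖f z‖ ^ 2) v.1 (dproj v (𝒟.field σ β δ B v)) := by
  have h := Conn.planeDeriv_field (B := B) hk hδ hf hfpos hσ hκ hβ hv
  rw [dR_normSq hf]
  change 0 ≤ 2 * f v.1 0 * dR (𝓡 2) (co f 0) v.1 _ + 2 * f v.1 1 * dR (𝓡 2) (co f 1) v.1 _
  rw [← planeDeriv_apply hf.mdiff, ← planeDeriv_apply hf.mdiff, h]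
  have hc : 0 ≤ (1 / 2) * (1 + a / (2 * k * ‖f v.1‖ ^ 2)) := by positivity
  generalize (1 / 2) * (1 + a / (2 * k * ‖f v.1‖ ^ 2)) = c at hc ⊢
  change 0 ≤ 2 * f v.1 0 * (c * f v.1 0) + 2 * f v.1 1 * (c * f v.1 1)
  have : 0 ≤ c * (f v.1 0 ^ 2 + f v.1 1 ^ 2) := by positivity
  linarith

lemma exists_pos_le_forall {ι : Type*} [Finite ι] (d : ι → ℝ) (hd : ∀ i, 0 < d i) {ε : ℝ}
    (hε : 0 < ε) : ∃ δ > 0, δ ≤ ε ∧ ∀ i, δ ≤ d i := by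
  rcases isEmpty_or_nonempty ι with h | h
  · exact ⟨ε, hε, le_rfl, fun i => h.elim i⟩
  · obtain ⟨i₀, h0⟩ := Finite.exists_min d
    exact ⟨min ε (d i₀), lt_min hε (hd i₀), min_le_left _ _, fun i =>
      (min_le_right _ _).trans (h0 i)⟩

end Data

end ConvexDisk

end

theorem lemma2p1
    {C : Type*} [TopologicalSpace C] [T2Space C] [CompactSpace C] [ConnectedSpace C]
    [ChartedSpace Plane C] [IsManifold (𝓡 2) ∞ C]
    [MeasurableSpace C] [BorelSpace C]
    (oC : SurfaceOrientation C)
    {E : C → Type*} [TopologicalSpace (TotalSpace Plane E)]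
    [∀ x, NormedAddCommGroup (E x)] [∀ x, InnerProductSpace ℝ (E x)]
    [FiberBundle Plane E] [VectorBundle ℝ Plane E]
    [ContMDiffVectorBundle ∞ Plane E (𝓡 2)]
    [IsContMDiffRiemannianBundle (𝓡 2) ∞ Plane E]
    (oE : BundleOrientation E)
    (m : ℕ) (hm : 0 < m) (hdeg : HasDegree oC oE (-(m : ℤ)))
    (x : Fin m → C) (hx : Function.Injective x)
    (n : Fin m → ℕ) (hn : ∀ i, 0 < n i)
    (A : ℝ) (a : Fin m → ℝ) (ha : ∀ i, 0 ≤ a i) (hA : ∑ i, a i / (n i : ℝ) < A) :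
    ∃ (Ω : Set (TotalSpace Plane E))
      (τ : FormField totalModel (TotalSpace Plane E) 2)
      (V : ∀ v : TotalSpace Plane E, TangentSpace totalModel v),
      -- `τ` is a symplectic form on (an open neighborhood of) the disk bundle
      IsOpen Ω ∧ diskBundle E ⊆ Ω ∧ IsSymplecticOn τ Ω ∧
      -- the zero section is symplectic (and positively oriented), with the stated area
      (∀ (y : C) (u w : TangentSpace (𝓡 2) y), PosPair (oC.or y) u w →
        0 < pullbackForm (I := 𝓡 2) (zeroSection Plane E) τ y ![u, w]) ∧
      (∃ ν : Measure C,
        IsAreaMeasure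
          (pullbackForm (I := 𝓡 2) (zeroSection Plane E) τ) ν ∧
        ν Set.univ = ENNReal.ofReal (Real.pi * (A - ∑ i, a i / (n i : ℝ)))) ∧
      -- the fibers are symplectic (and positively oriented)
      (∀ v ∈ diskBundle E, ∀ u w : E v.1, PosPair (oE.or v.1) u w →
        0 < τ v ![vertical v u, vertical v w]) ∧
      -- `V` is a Liouville field off the zero section and the fibers with `a i > 0`
      IsLiouvilleOn τ V
        (Ω \ (zeroSec E ∪ {v | ∃ i, 0 < a i ∧ v.1 = x i})) ∧
      -- Darboux trivializations: `ψ i` are the coordinates on `W i = (ψ i).source`, and `χ i` are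
      -- the fiber coordinates over `W i`
      (∃ (δ : ℝ) (ψ : Fin m → OpenPartialHomeomorph C Plane)
        (χ : Fin m → TotalSpace Plane E → Plane),
        0 < δ ∧
        (∀ i j, i ≠ j → Disjoint (ψ i).source (ψ j).source) ∧
        ∀ i, ψ i ∈ IsManifold.maximalAtlas (𝓡 2) ∞ C ∧
          x i ∈ (ψ i).source ∧ ψ i (x i) = 0 ∧
          (ψ i).target = Metric.ball (0 : Plane) (Real.sqrt δ) ∧
          ContMDiffOn totalModel 𝓘(ℝ, Plane) ∞ (χ i)
            {v | v.1 ∈ (ψ i).source} ∧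
          (∀ y ∈ (ψ i).source, ∃ L : E y →ₗ[ℝ] Plane, ∀ w : E y,
            χ i ⟨y, w⟩ = L w ∧ ‖L w‖ = Real.sqrt δ * ‖w‖) ∧
          (∀ v ∈ diskBundle E, v.1 ∈ (ψ i).source →
            ∀ u w : TangentSpace totalModel v,
            τ v ![u, w] =
              stdArea
                (planeDeriv totalModel (fun z => ψ i z.1) v u)
                (planeDeriv totalModel (fun z => ψ i z.1) v w) +
              stdArea
                (planeDeriv totalModel (χ i) v u)
                (planeDeriv totalModel (χ i) v w)) ∧
          (∀ v ∈ diskBundle E, v.1 ∈ (ψ i).source →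
            v ∉ zeroSec E ∪ {v | ∃ i, 0 < a i ∧ v.1 = x i} →
            planeDeriv totalModel (fun z => ψ i z.1) v (V v) =
              radialField (a i / (n i : ℝ)) (ψ i v.1) ∧
            planeDeriv totalModel (χ i) v (V v) =
              radialField (A / (m : ℝ)) (χ i v))) ∧
      -- every neighborhood of the zero section and these fibers contains a convex one
      (∀ O : Set (TotalSpace Plane E), IsOpen O →
        (zeroSec E ∪ {v | ∃ i, 0 < a i ∧ v.1 = x i}) ∩ diskBundle E ⊆ O →
        ∃ N : Set (TotalSpace Plane E), N ⊆ O ∧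
          IsConvexNbhd V
            (zeroSec E ∪ {v | ∃ i, 0 < a i ∧ v.1 = x i}) N) := by
  classical
  have hm' : (0 : ℝ) < m := Nat.cast_pos.2 hm
  let w : C → ℝ := fun q => ∑ i, if x i = q then a i / (n i : ℝ) else 0
  have hwx : ∀ i, w (x i) = a i / (n i : ℝ) := fun i => by
    change (∑ j, if x j = x i then a j / (n j : ℝ) else 0) = _
    rw [Finset.sum_eq_single i (fun j _ hj => if_neg fun h => hj (hx h))
      fun h => absurd (Finset.mem_univ i) h, if_pos rfl]
  have hw0 : ∀ q, (∀ i, 0 < a i → x i ≠ q) → w q = 0 := fun q hq =>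
    Finset.sum_eq_zero fun i _ => by
      split_ifs with h
      · rw [le_antisymm (not_lt.1 fun hpos => hq i hpos h) (ha i), zero_div]
      · rfl
  have hwn : ∀ i, 0 ≤ a i / (n i : ℝ) := fun i => div_nonneg (ha i) (Nat.cast_nonneg _)
  have hwsum : ∑ q ∈ Finset.univ.image x, w q = ∑ i, a i / (n i : ℝ) := by
    rw [Finset.sum_image fun i _ j _ h => hx h]
    exact Finset.sum_congr rfl fun i _ => hwx i
  have hBm : A / (m : ℝ) * ((m : ℤ) : ℝ) = A := by
    rw [Int.cast_natCast]
    exact div_mul_cancel₀ A hm'.ne'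
  have hA0 : 0 ≤ A := (Finset.sum_nonneg fun i _ => hwn i).trans hA.le
  obtain ⟨𝒟, f, k, σ, β, hσ, hpos, ⟨ν, hν, hν2⟩, hβ, hq⟩ := hdeg.exists_base_data
    (Finset.univ.image x) w (fun q hqx => hw0 q fun i _ h => hqx
      (Finset.mem_image.2 ⟨i, Finset.mem_univ i, h⟩)) (A / m) (by rw [hBm, hwsum]; linarith)
  rw [hBm, hwsum] at hν2
  have hq' := fun i => hq (x i) (Finset.mem_image_of_mem x (Finset.mem_univ i))
  obtain ⟨U, hU, hUd⟩ := (Set.finite_range x).t2_separation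
  have hUx : ∀ i, U (x i) ∈ 𝓝 (x i) := fun i => (hU _).2.mem_nhds (hU _).1
  have hUdisj : ∀ i j, i ≠ j → Disjoint (U (x i)) (U (x j)) := fun i j hij =>
    hUd (Set.mem_range_self i) (Set.mem_range_self j) fun h => hij (hx h)
  obtain ⟨ε, hε, hε2⟩ := 𝒟.exists_pos_horiz hσ hpos
  choose δ₀ hδ₀ hdarb using fun i => Conn.exists_darboux (hq' i).1 (hq' i).2.1 (hq' i).2.2.1
    (hq' i).2.2.2.1 (hq' i).2.2.2.2 (hUx i) (A / m)
  obtain ⟨δ, hδ, hδε, hδi⟩ := exists_pos_le_forall δ₀ hδ₀ (half_pos hε)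
  choose ψ χ hψ hψx hψU hψ0 hψt hχ hχl hψχ hfield using fun i => hdarb i δ hδ (hδi i)
  set K : Set (TotalSpace Plane E) := zeroSec E ∪ {v | ∃ i, 0 < a i ∧ v.1 = x i} with hK
  set Ω : Set (TotalSpace Plane E) := {v | sqNorm v < 2} with hΩ
  have hDΩ : diskBundle E ⊆ Ω := fun v hv => by
    have := mem_diskBundle_iff.1 hv
    change sqNorm v < 2
    linarith
  have hΩo : IsOpen Ω := isOpen_lt continuous_sqNorm continuous_const
  have hhor : ∀ v ∈ Ω, PosForm oC (𝒟.horiz σ (δ * sqNorm v)) v.1 := fun v hv => by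
    refine hε2 _ ?_ _
    rw [abs_of_nonneg (mul_nonneg hδ.le (sqNorm_nonneg v))]
    calc δ * sqNorm v ≤ δ * 2 := mul_le_mul_of_nonneg_left (le_of_lt hv) hδ.le
      _ ≤ ε := by linarith
  have hKc : IsClosed K := by
    have h1 : zeroSec E = {v | sqNorm v = 0} := Set.ext fun v => sqNorm_eq_zero_iff.symm
    have h2 : {v : TotalSpace Plane E | ∃ i, 0 < a i ∧ v.1 = x i} =
        (proj : TotalSpace Plane E → C) ⁻¹' (x '' {i | 0 < a i}) := by
      ext v
      exact ⟨fun ⟨i, h, e⟩ => ⟨i, h, e.symm⟩, fun ⟨i, h, e⟩ => ⟨i, h, e.symm⟩⟩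
    rw [hK, h1, h2]
    exact (isClosed_eq continuous_sqNorm continuous_const).union
      ((Set.toFinite _).isClosed.preimage (Bundle.contMDiff_proj (IB := 𝓡 2) (n := ∞) E).continuous)
  have hKv : ∀ v, v ∉ K → sqNorm v ≠ 0 := fun v hv h => hv (Or.inl (sqNorm_eq_zero_iff.1 h))
  have hKw : ∀ v : TotalSpace Plane E, v ∉ K → w v.1 = 0 := fun v hv =>
    hw0 _ fun i hi h => hv (Or.inr ⟨i, hi, h.symm⟩)
  refine ⟨Ω, 𝒟.symp σ δ, 𝒟.field σ β δ (A / m), hΩo, hDΩ, 𝒟.isSymplecticOn hσ hδ hhor, ?_, ?_,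
    fun v _ u u' h => 𝒟.symp_vertical_pos hδ h,
    𝒟.isLiouvilleOn hσ hδ (hΩo.sdiff hKc) (fun v hv => hhor v hv.1) (fun v hv => hKv v hv.2)
      fun v hv => hβ _ (hKw v hv.2), ?_, fun W hW hKW => ?_⟩
  · intro y u u' h
    rw [𝒟.pullbackForm_zeroSection]
    exact hpos y u u' h
  · rw [𝒟.pullbackForm_zeroSection]
    exact ⟨ν, hν, hν2⟩
  · refine ⟨δ, ψ, χ, hδ, fun i j hij => (hUdisj i j hij).mono (hψU i) (hψU j), fun i =>
      ⟨hψ i, hψx i, hψ0 i, hψt i, hχ i, hχl i, fun v _ hv => hψχ i v hv, fun v _ hv hvK => ?_⟩⟩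
    rw [← hwx]
    exact hfield i v hv (hKv v hvK)
  · let O : {i // 0 < a i} → Set C := fun i => {y | y ∈ U (x i) ∧
      SmoothNear (𝓡 2) 𝓘(ℝ, Plane) (f (x i)) y ∧ PosForm oC (area (𝓡 2) (f (x i))) y ∧
      σ y = (2 * k (x i)) • area (𝓡 2) (f (x i)) y ∧ 𝒟.curv y = 0 ∧
      β y = k (x i) • rot (𝓡 2) (f (x i)) y + (w (x i) / 2) • ang (𝓡 2) (f (x i)) y}
    have hO : ∀ i, O i ∈ 𝓝 (x i.1) := fun i => by
      obtain ⟨-, hf, hη, hσi, hβi⟩ := hq' i.1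
      filter_upwards [hUx i.1, hf.smooth.eventually, area_pos_eventually hf.smooth hf.pos, hσi, hβi,
        𝒟.eventually_local (x i.1), hη.eventually_nhds] with y h1 h2 h3 h4 h5 h6 h7
      refine ⟨h1, h2, h3, h4, ?_, h5⟩
      rw [h6.curv, extd_congr repAt_zero h7, extd_zero]
    refine exists_isConvexNbhd (f := fun i : {i // 0 < a i} => f (x i))
      (p := fun i : {i // 0 < a i} => x i) oE (fun i => ((hq' i).2.1.exists_disc (hO i)).some)
      (fun i j hij => (hUdisj i j fun h => hij (Subtype.ext h)).mono (fun y hy => hy.1)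
        fun y hy => hy.1) ?_ (fun v hvD hvK => ?_) (fun v hvD hvK i hi => ?_) hW hKW
    · ext v
      simp only [hK, Subtype.exists, Set.mem_union, Set.mem_ofPred_eq, exists_prop]
    · rw [𝒟.dR_sqNorm_field hδ (hhor v (hDΩ hvD)) (hKv v hvK)]
      exact add_pos_of_pos_of_nonneg ((sqNorm_nonneg v).lt_of_ne' (hKv v hvK))
        (div_nonneg (div_nonneg hA0 hm'.le) hδ.le)
    · exact dR_normSq_field_nonneg (hq' i).1 ((hwx i).symm ▸ hwn i) hδ hi.2.1 hi.2.2.1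
        hi.2.2.2.1 hi.2.2.2.2.1 hi.2.2.2.2.2 (hKv v hvK)
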